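/- **Setting.** Fix $r\ge 1$, $0\le\alpha<r$, integers $0\le s_k\le e$ ($1\le k\le r$) and $n\ge 0$. For $\mathbf m\in\mathbb Z_{\ge0}^r$ let $\tilde Z(\mathbf m)$ be the set of arrays $\Lambda=(a^{(k)}_i)_{1\le k\le r,\,1\le i\le m_k}$ of non-negative integers with $a^{(k)}_i-a^{(k)}_{i+1}\ge e$ and $a^{(k)}_{m_k}\ge s_k$. The shift adds $e$ to every entry and appends $s_k$ to the $k$-th row; an $r$-symbol is a class of arrays under the equivalence relation generated by the shift. Its defect is the class $\mathbf d$ of $\mathbf m$ under $\mathbf m\mapsto(m_1+1,\dots,m_r+1)$, represented by the tuple with minimum $0$; only defects with $\sum_k m_k\equiv\alpha \pmod r$ are considered. Put $\delta_k=0$ for $k\le\alpha$, $\delta_k=1$ for $k>\alpha$, $d'_k=d_k+\delta_k-\min_j(d_j+\delta_j)$, and $f(\mathbf d)=\sum_{k\le\alpha}d'_k(d'_k-1)/2+\sum_{k>\alpha}d'_k(d'_k+1)/2$. Let $\Lambda^0(\mathbf m)$ be the array with rows $s_k+(m_k-1)e,\dots,s_k+e,s_k$. If $f(\mathbf d)\le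 n$, put $n'=n-f(\mathbf d)$ and let $Z_{n,\mathbf d}$ be the set of the symbols $\Lambda(\boldsymbol\lambda)$ represented by $\Lambda^0(\mathbf m)+\boldsymbol\lambda$, with $\mathbf m$ large in the class $\mathbf d$ and $\boldsymbol\lambda\in\mathcal P_{n',r}$, the set of $r$-partitions of $n'$. Let $D$ be a set of defects $\mathbf d$ with $f(\mathbf d)\le n$ and $Z_{n,D}=\coprod_{\mathbf d\in D}Z_{n,\mathbf d}$, a finite set. Two symbols are similar, $\Lambda\sim\Lambda'$, if they have representatives with the same multiset of entries. Put $a(\Lambda)=\sum\min(a,a')-\sum\min(b,b')$, the sums being over unordered pairs of entries in distinct positions of a representative $\Lambda\in\tilde Z(\mathbf m)$, respectively of $\Lambda^0(M+1,\dots,M+1,M,\dots,M)$ ($\alpha$ entries $M+1$) with $\sum_k m_k=\alpha+rM$. Fix a total order $\preceq$ on $Z_{n,D}$ such that $\Lambda\prec\Lambda'$ if $a(\Lambda)>a(\Lambda')$ and such that every similarity class is an interval. Let $\mathbb Q(\mathbf t)=\mathbb Q(t_1,\dots,t_r)$. Consider symmetric functions over $\mathbb Q(\mathbf t)$ in $r$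 families $x^{(k)}=(x^{(k)}_1,x^{(k)}_2,\dots)$, $k\in\mathbb Z/r\mathbb Z$, of infinitely many variables (symmetric in each family), and let $s_{\boldsymbol\lambda}=\prod_k s_{\lambda^{(k)}}(x^{(k)})$, $m_{\boldsymbol\lambda}=\prod_k m_{\lambda^{(k)}}(x^{(k)})$ be the products of Schur functions and of monomial symmetric functions. Define $q^{(k)}_{a,\pm}(x;t)$ by $\sum_{a\ge0}q^{(k)}_{a,\pm}(x;t)u^a=\prod_i\frac{1-tux_i^{(k\mp1)}}{1-ux_i^{(k)}}$, and put $q^{\pm}_{\boldsymbol\lambda}=\prod_k\prod_i q^{(k)}_{\lambda^{(k)}_i,\pm}(x;t_{k-c})$, with $c=1$ for $+$ and $c=0$ for $-$. For $\mathbf d\in D$ fix an injective map $\theta_{\mathbf d}:\mathcal P_{n',r}\to\mathcal P_{n,r}$, and let $\Theta_{\mathbf d}$ be the linear map on symmetric functions of degree $n'$ with $s_{\boldsymbol\lambda}\mapsto s_{\theta_{\mathbf d}(\boldsymbol\lambda)}$. Let $\Xi^{n,\mathbf d}$ be its image, $\Xi^{n,D}=\bigoplus_{\mathbf d\in D}\Xi^{n,\mathbf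 d}$, and for $\Lambda=\Lambda(\boldsymbol\lambda)\in Z_{n,\mathbf d}$ let $s_\Lambda,m_\Lambda,q^\pm_\Lambda\in\Xi^{n,D}$ be the images of $s_{\boldsymbol\lambda},m_{\boldsymbol\lambda},q^\pm_{\boldsymbol\lambda}$ under $\Theta_{\mathbf d}$. Let $\langle\,,\rangle$ be the bilinear form on $\Xi^{n,D}$ with $\langle q^+_\Lambda,m_{\Lambda'}\rangle=\delta_{\Lambda,\Lambda'}$. The Hall–Littlewood functions $P^\pm_\Lambda$ are the unique elements of $\Xi^{n,D}$ such that $P^\pm_\Lambda=s_\Lambda+\sum_{\Lambda'\prec\Lambda,\,\Lambda'\not\sim\Lambda}u^\pm_{\Lambda,\Lambda'}s_{\Lambda'}$ with coefficients in $\mathbb Q(\mathbf t)$ without pole at $\mathbf t=0$, $\langle P^+_\Lambda,P^-_{\Lambda'}\rangle=0$ for $\Lambda\not\sim\Lambda'$, and $P^\pm_\Lambda|_{\mathbf t=0}=s_\Lambda$. For a similarity class $\mathcal C$ let $(b_{\Lambda,\Lambda'})_{\Lambda,\Lambda'\in\mathcal C}$ be the inverse of the matrix $(\langle P^+_\Lambda,P^-_{\Lambda'}\rangle)_{\Lambda,\Lambda'\in\mathcal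 C}$, and put $Q^+_\Lambda=\sum_{\Lambda'\sim\Lambda}b_{\Lambda,\Lambda'}P^+_{\Lambda'}$, $Q^-_\Lambda=\sum_{\Lambda'\sim\Lambda}b_{\Lambda',\Lambda}P^-_{\Lambda'}$. **Theorem 3.9.** All these objects are well defined: $\Theta_{\mathbf d}$, $\langle\,,\rangle$ and the family $(P^\pm_\Lambda)$ exist and are unique, and the matrices $(\langle P^+_\Lambda,P^-_{\Lambda'}\rangle)_{\Lambda,\Lambda'\in\mathcal C}$ are non-singular. Let $\mathcal C$ be a similarity class in $Z_{n,D}$. For each signature $\pm$, the family $(P^\pm_\Lambda)_{\Lambda\in\mathcal C}$ is the unique family in $\Xi^{n,D}$ such that (i) $P^\pm_\Lambda=\sum_{\Lambda'}c_{\Lambda,\Lambda'}(\mathbf t)\,q^\pm_{\Lambda'}$ for $\Lambda\in\mathcal C$, summed over the $\Lambda'\in Z_{n,D}$ with $\Lambda'\sim\Lambda$ or $\Lambda'\succeq\Lambda$, where $c_{\Lambda,\Lambda'}(\mathbf t)\in\mathbb Q(\mathbf t)$ and the matrix $(c_{\Lambda',\Lambda''}(\mathbf t))_{\Lambda',\Lambda''\in\mathcal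 C}$ is non-singular; and (ii) $P^\pm_\Lambda=\sum_{\Lambda'}u_{\Lambda,\Lambda'}(\mathbf t)\,s_{\Lambda'}$ for $\Lambda\in\mathcal C$, summed over the $\Lambda'\in Z_{n,D}$ with $\Lambda'\sim\Lambda$ or $\Lambda'\preceq\Lambda$, where $u_{\Lambda,\Lambda'}(\mathbf t)\in\mathbb Q(\mathbf t)$ and $(u_{\Lambda',\Lambda''}(\mathbf t))_{\Lambda',\Lambda''\in\mathcal C}$ is the identity matrix. Likewise, $(Q^\pm_\Lambda)_{\Lambda\in\mathcal C}$ is the unique family in $\Xi^{n,D}$ with expansions as in (i) and (ii), where now $(c_{\Lambda',\Lambda''}(\mathbf t))_{\Lambda',\Lambda''\in\mathcal C}$ is the identity matrix and $(u_{\Lambda',\Lambda''}(\mathbf t))_{\Lambda',\Lambda''\in\mathcal C}$ is non-singular. -/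

import Mathlib

namespace RSymbol

noncomputable section

/-! ### `r`-partitions -/

/-- `r`-partitions of `n`. The parts of `lam k` are `(lam k).rowLen 0 ≥ (lam k).rowLen 1 ≥ ⋯`,
and `(lam k).colLen 0` is the number of nonzero parts. -/
abbrev RPartition (r n : ℕ) : Type :=
  {lam : Fin r → YoungDiagram // ∑ k, (lam k).card = n}

theorem cells_subset_of_card_le {μ : YoungDiagram} {n : ℕ} (h : μ.card ≤ n) :
    μ.cells ⊆ Finset.range n ×ˢ Finset.range n := by
  rintro ⟨i, j⟩ hij
  have hij' : (i, j) ∈ μ := hij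
  have h1 : i < μ.colLen j := YoungDiagram.mem_iff_lt_colLen.1 hij'
  have h2 : j < μ.rowLen i := YoungDiagram.mem_iff_lt_rowLen.1 hij'
  have h3 : μ.colLen j ≤ μ.card := by
    rw [YoungDiagram.colLen_eq_card]; exact Finset.card_le_card (Finset.filter_subset _ _)
  have h4 : μ.rowLen i ≤ μ.card := by
    rw [YoungDiagram.rowLen_eq_card]; exact Finset.card_le_card (Finset.filter_subset _ _)
  simp only [Finset.mem_product, Finset.mem_range]
  omega

instance (r n : ℕ) : Finite (RPartition r n) := by
  let F : RPartition r n →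
      (Fin r → {S : Finset (ℕ × ℕ) // S ∈ (Finset.range n ×ˢ Finset.range n).powerset}) :=
    fun lam k => ⟨(lam.1 k).cells, Finset.mem_powerset.2 (cells_subset_of_card_le (by
      exact le_trans (Finset.single_le_sum (f := fun k => (lam.1 k).card)
        (fun _ _ => Nat.zero_le _) (Finset.mem_univ k)) lam.2.le))⟩
  refine Finite.of_injective F fun lam mu h => Subtype.ext (funext fun k => ?_)
  exact YoungDiagram.ext (congrArg Subtype.val (congrFun h k))

/-! ### `r`-symbols -/

/-- The set of arrays `(a^{(k)}_i)` with rows of lengths `m_k` such that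
`a^{(k)}_i - a^{(k)}_{i+1} ≥ e` and such that the last entry of row `k` is at least `s_k`. -/
@[ext] structure SymbolArray {r : ℕ} (e : ℕ) (s m : Fin r → ℕ) where
  entry : ∀ k, Fin (m k) → ℕ
  gap : ∀ (k : Fin r) (i : ℕ) (h : i + 1 < m k),
    entry k ⟨i + 1, h⟩ + e ≤ entry k ⟨i, Nat.lt_of_succ_lt h⟩
  last : ∀ (k : Fin r) (i : Fin (m k)), (i : ℕ) + 1 = m k → s k ≤ entry k i

namespace SymbolArray

variable {r e : ℕ} {s m : Fin r → ℕ}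

/-- The shift: add `e` to all entries and append `s_k` to row `k`. -/
def shift (X : SymbolArray e s m) : SymbolArray e s (fun k => m k + 1) where
  entry k i := if h : (i : ℕ) < m k then X.entry k ⟨i, h⟩ + e else s k
  gap k i h := by
    have h0 : i < m k := by omega
    by_cases h1 : i + 1 < m k
    · simpa [h0, h1] using X.gap k i h1
    · simpa [h0, h1] using X.last k ⟨i, h0⟩ (by simp only; omega)
  last k i h := by
    have : ¬ (i : ℕ) < m k := by omega
    simp [this]

/-- The array `Λ⁰(m)`, with rows `s_k + (m_k - 1) e, …, s_k + e, s_k`. -/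
def base (e : ℕ) (s m : Fin r → ℕ) : SymbolArray e s m where
  entry k i := s k + (m k - 1 - i) * e
  gap k i h := by
    have : m k - 1 - i = (m k - 1 - (i + 1)) + 1 := by omega
    simp only [this]
    rw [Nat.add_mul]
    omega
  last k i _ := Nat.le_add_right _ _

/-- The array `Λ⁰(m) + lam`. -/
def ofPartition (e : ℕ) (s m : Fin r → ℕ) (lam : Fin r → YoungDiagram) :
    SymbolArray e s m where
  entry k i := (base e s m).entry k i + (lam k).rowLen i
  gap k i h := by
    have h1 := (base e s m).gap k i h
    have h2 := (lam k).rowLen_anti i (i + 1) (Nat.le_succ i)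
    simp only
    omega
  last k i h := le_trans ((base e s m).last k i h) (Nat.le_add_right _ _)

/-- All entries of an array, with multiplicities. -/
def entries (X : SymbolArray e s m) : Multiset ℕ :=
  ∑ k, (Finset.univ : Finset (Fin (m k))).val.map (X.entry k)

/-- The sum of `min (a, a')` over all unordered pairs of entries in distinct positions. -/
def minSum (X : SymbolArray e s m) : ℕ :=
  ∑ p ∈ (Finset.univ : Finset (Σ k, Fin (m k))).sym2 with ¬ p.IsDiag,
    Sym2.lift ⟨fun x y => min (X.entry x.1 x.2) (X.entry y.1 y.2), fun _ _ => min_comm _ _⟩ p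

/-- The tuple `(M + 1, …, M + 1, M, …, M)` (with `α` entries `M + 1`) whose sum is `∑ m_k`, when
`∑ m_k ≡ α` modulo `r`. -/
def bullet (α : ℕ) (m : Fin r → ℕ) : Fin r → ℕ :=
  fun k => (∑ j, m j) / r + if (k : ℕ) < α then 1 else 0

/-- The `a`-function on arrays. -/
def aFun (α : ℕ) (X : SymbolArray e s m) : ℤ :=
  (X.minSum : ℤ) - ((base e s (bullet α m)).minSum : ℤ)

end SymbolArray

/-- `Y` is the shift of `X`. -/
def ShiftStep {r : ℕ} (e : ℕ) (s : Fin r → ℕ) (X Y : Σ m, SymbolArray e s m) : Prop :=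
  Y = ⟨_, X.2.shift⟩

/-- `r`-symbols: arrays modulo the equivalence relation generated by the shift. -/
def Symbol {r : ℕ} (e : ℕ) (s : Fin r → ℕ) : Type :=
  Quot (ShiftStep e s)

/-- Two `r`-symbols are similar if they have representatives with the same entries, counted with
multiplicities. -/
def Symbol.Similar {r e : ℕ} {s : Fin r → ℕ} (Λ Λ' : Symbol e s) : Prop :=
  ∃ X Y : (Σ m, SymbolArray e s m), Quot.mk _ X = Λ ∧ Quot.mk _ Y = Λ' ∧
    X.2.entries = Y.2.entries

/-- Defects: classes of tuples `m` with `∑ m_k ≡ α` modulo `r` under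
`(m_1, …, m_r) ↦ (m_1 + 1, …, m_r + 1)`, given by their representative with minimum `0`. -/
abbrev Defect (r α : ℕ) : Type :=
  {d : Fin r → ℕ // (∃ k, d k = 0) ∧ (∑ k, d k) ≡ α [MOD r]}

namespace Defect

variable {r α : ℕ} [NeZero r]

/-- `d'_k = m'_k - m_k`, for `m'` in the class `d` and `m = (M + 1, …, M + 1, M, …, M)` with `α`
entries `M + 1`, where `M` is such that the minimum of the `d'_k` is `0`. -/
def rel (d : Defect r α) (k : Fin r) : ℕ :=
  (d.1 k + if (k : ℕ) < α then 0 else 1) -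
    Finset.univ.inf' Finset.univ_nonempty fun j : Fin r => d.1 j + if (j : ℕ) < α then 0 else 1

/-- The number `f(d)`. -/
def f (d : Defect r α) : ℕ :=
  ∑ k : Fin r, if (k : ℕ) < α then d.rel k * (d.rel k - 1) / 2 else d.rel k * (d.rel k + 1) / 2

end Defect

/-- The lengths of the rows up to simultaneous translation, and the differences with `Λ⁰(m)`. -/
def arrayInvariant {r e : ℕ} {s : Fin r → ℕ} (X : Σ m, SymbolArray e s m) :
    (Fin r → Fin r → ℤ) × (Fin r → ℕ → ℕ) :=
  (fun j k => (X.1 j : ℤ) - X.1 k, fun k i =>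
    if h : i < X.1 k then X.2.entry k ⟨i, h⟩ - (SymbolArray.base e s X.1).entry k ⟨i, h⟩ else 0)

theorem arrayInvariant_shift {r e : ℕ} {s : Fin r → ℕ} {X Y : Σ m, SymbolArray e s m}
    (h : ShiftStep e s X Y) : arrayInvariant X = arrayInvariant Y := by
  subst h
  refine Prod.ext ?_ ?_
  · funext j k
    simp [arrayInvariant]
  · funext k i
    simp only [arrayInvariant, SymbolArray.shift, SymbolArray.base]
    by_cases h1 : i < X.1 k
    · have h2 : i < X.1 k + 1 := by omega
      have h3 : X.1 k + 1 - 1 - i = X.1 k - 1 - i + 1 := by omega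
      simp only [h1, h2, dif_pos, h3, Nat.add_mul]
      omega
    · by_cases h2 : i < X.1 k + 1
      · simp [h1, h2]
      · simp [h1, h2]

theorem rowLen_eq_zero_of_card_le {μ : YoungDiagram} {n i : ℕ} (h : μ.card ≤ n) (hi : n ≤ i) :
    μ.rowLen i = 0 := by
  by_contra h0
  have h1 : (i, 0) ∈ μ := YoungDiagram.mem_iff_lt_rowLen.2 (Nat.pos_of_ne_zero h0)
  have := cells_subset_of_card_le h h1
  simp only [Finset.mem_product, Finset.mem_range] at this
  omega

variable {r α : ℕ} [NeZero r]

/-- The set `Z_{n,D}` of symbols of rank `n` with defect in `D`, the disjoint union of the sets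
`Z_{n,d}`. The element `⟨d, lam⟩` stands for the symbol `Λ(lam)` of defect `d`,
see `ZSym.toSymbol` and `ZSym.toSymbol_injective`. -/
def ZSym (n : ℕ) (D : Finset (Defect r α)) : Type :=
  Σ d : D, RPartition r (n - d.1.f)

instance (n : ℕ) (D : Finset (Defect r α)) : Fintype (ZSym n D) :=
  @Fintype.ofFinite _ (inferInstanceAs (Finite (Σ d : D, RPartition r (n - d.1.f))))

namespace ZSym

variable {n : ℕ} {D : Finset (Defect r α)}

/-- The representative `Λ⁰(m) + lam` of the symbol `Λ(lam)`, at the level `m = d + (n', …, n')`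
(an element of `RPartition r n'` has components with at most `n'` parts). -/
def rep (e : ℕ) (s : Fin r → ℕ) (Λ : ZSym n D) :
    SymbolArray e s (fun k => Λ.1.1.1 k + (n - Λ.1.1.f)) :=
  SymbolArray.ofPartition e s _ Λ.2.1

/-- The symbol. -/
def toSymbol (e : ℕ) (s : Fin r → ℕ) (Λ : ZSym n D) : Symbol e s :=
  Quot.mk _ ⟨_, Λ.rep e s⟩

/-- Similarity of symbols. -/
def Similar (e : ℕ) (s : Fin r → ℕ) (Λ Λ' : ZSym n D) : Prop :=
  (Λ.toSymbol e s).Similar (Λ'.toSymbol e s)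

theorem Similar.refl (e : ℕ) (s : Fin r → ℕ) (Λ : ZSym n D) : Similar e s Λ Λ :=
  ⟨_, _, rfl, rfl, rfl⟩

/-- The `a`-function on symbols. -/
def aFun (e : ℕ) (s : Fin r → ℕ) (Λ : ZSym n D) : ℤ :=
  (Λ.rep e s).aFun α

end ZSym

/-- The similarity class of `Λ`. -/
abbrev SimClass {n : ℕ} {D : Finset (Defect r α)} (e : ℕ) (s : Fin r → ℕ) (Λ : ZSym n D) : Type :=
  {Λ' : ZSym n D // ZSym.Similar e s Λ' Λ}

instance {n : ℕ} {D : Finset (Defect r α)} (e : ℕ) (s : Fin r → ℕ) (Λ : ZSym n D) :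
    Fintype (SimClass e s Λ) := Fintype.ofFinite _

/-- Distinct elements of `ZSym n D` stand for distinct symbols. -/
theorem ZSym.toSymbol_injective {n : ℕ} {D : Finset (Defect r α)} (e : ℕ) (s : Fin r → ℕ) :
    Function.Injective (ZSym.toSymbol e s : ZSym n D → Symbol e s) := by
  rintro ⟨⟨⟨d, hd⟩, hdD⟩, ⟨lam, hlam⟩⟩ ⟨⟨⟨d', hd'⟩, hdD'⟩, ⟨mu, hmu⟩⟩ h
  have h1 := congrArg (Quot.lift arrayInvariant fun _ _ => arrayInvariant_shift) h
  have hA := congrArg Prod.fst h1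
  have hB := congrArg Prod.snd h1
  simp only [ZSym.toSymbol, arrayInvariant] at hA hB
  have hdd : d = d' := by
    obtain ⟨j, hj⟩ := hd.1
    obtain ⟨j', hj'⟩ := hd'.1
    funext k
    have e1 := congrFun (congrFun hA k) j
    have e2 := congrFun (congrFun hA k) j'
    push_cast at e1 e2
    omega
  subst hdd
  have hl : lam = mu := by
    funext k
    have key : ∀ i, (lam k).rowLen i = (mu k).rowLen i := by
      intro i
      have h2 := congrFun (congrFun hB k) i
      by_cases hi : i < d k + (n - Defect.f ⟨d, hd⟩)
      · simpa [hi, ZSym.rep, SymbolArray.ofPartition] using h2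
      · have b1 : (lam k).card ≤ n - Defect.f ⟨d, hd⟩ := hlam ▸
          Finset.single_le_sum (f := fun k => (lam k).card) (fun _ _ => Nat.zero_le _)
            (Finset.mem_univ k)
        have b2 : (mu k).card ≤ n - Defect.f ⟨d, hd⟩ := hmu ▸
          Finset.single_le_sum (f := fun k => (mu k).card) (fun _ _ => Nat.zero_le _)
            (Finset.mem_univ k)
        rw [rowLen_eq_zero_of_card_le b1 (by omega), rowLen_eq_zero_of_card_le b2 (by omega)]
    refine YoungDiagram.ext (Finset.ext fun c => ?_)
    obtain ⟨i, j⟩ := c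
    rw [YoungDiagram.mem_cells, YoungDiagram.mem_cells, YoungDiagram.mem_iff_lt_rowLen,
      YoungDiagram.mem_iff_lt_rowLen, key]
  subst hl
  rfl

/-! ### The field `ℚ(t_1, …, t_r)` -/

/-- The field of rational functions in `t_1, …, t_r` over `ℚ`. -/
abbrev ParamField (r : ℕ) : Type := FractionRing (MvPolynomial (Fin r) ℚ)

/-- The parameter `t_k`. -/
def tvar (k : Fin r) : ParamField r := algebraMap (MvPolynomial (Fin r) ℚ) _ (MvPolynomial.X k)

/-- The rational function `g` has no pole at `t = 0`, and its value there is `c`. -/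
def HasValueAtZero (g : ParamField r) (c : ℚ) : Prop :=
  ∃ p q : MvPolynomial (Fin r) ℚ, q.eval 0 ≠ 0 ∧
    g = algebraMap (MvPolynomial (Fin r) ℚ) (ParamField r) p / algebraMap _ (ParamField r) q ∧
    c = p.eval 0 / q.eval 0

/-! ### Symmetric functions in `r` families of infinitely many variables -/

/-- Formal power series in the variables `x^{(k)}_j`. -/
abbrev PS (r : ℕ) : Type := MvPowerSeries (Fin r × ℕ) (ParamField r)

/-- The permutation of the variables that permutes the `k`-th family by `σ k`. -/
def varPerm (σ : Fin r → Equiv.Perm ℕ) : Equiv.Perm (Fin r × ℕ) :=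
  Equiv.prodShear (Equiv.refl _) σ

/-- Symmetric functions of degree `n`: homogeneous power series of degree `n` that are symmetric
in each of the `r` families of variables. -/
def symFn (r n : ℕ) : Submodule (ParamField r) (PS r) where
  carrier := {f | (∀ σ : Fin r → Equiv.Perm ℕ,
      MvPowerSeries.renameEquiv (ParamField r) (varPerm σ) f = f) ∧
    ∀ ν : Fin r × ℕ →₀ ℕ, MvPowerSeries.coeff ν f ≠ 0 → ν.degree = n}
  zero_mem' := by simp
  add_mem' := by
    rintro f g ⟨hf, hf'⟩ ⟨hg, hg'⟩
    refine ⟨fun σ => by rw [map_add, hf, hg], fun ν hν => ?_⟩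
    by_contra hne
    apply hν
    rw [map_add, not_not.1 (mt (hf' ν) hne), not_not.1 (mt (hg' ν) hne), add_zero]
  smul_mem' := by
    rintro c f ⟨hf, hf'⟩
    refine ⟨fun σ => by rw [map_smul, hf], fun ν hν => hf' ν fun h0 => hν ?_⟩
    rw [map_smul, h0, smul_zero]

theorem mul_mem_symFn {r a b : ℕ} {f g : PS r} (hf : f ∈ symFn r a) (hg : g ∈ symFn r b) :
    f * g ∈ symFn r (a + b) := by
  classical
  refine ⟨fun σ => by rw [map_mul, hf.1, hg.1], fun ν hν => ?_⟩
  rw [MvPowerSeries.coeff_mul] at hν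
  obtain ⟨p, hp, hp0⟩ := Finset.exists_ne_zero_of_sum_ne_zero hν
  rw [← Finset.HasAntidiagonal.mem_antidiagonal.1 hp, map_add, hf.2 _ (left_ne_zero_of_mul hp0),
    hg.2 _ (right_ne_zero_of_mul hp0)]

theorem one_mem_symFn (r : ℕ) : (1 : PS r) ∈ symFn r 0 := by
  classical
  refine ⟨fun σ => map_one _, fun ν hν => ?_⟩
  rw [MvPowerSeries.coeff_one] at hν
  by_cases h : ν = 0
  · simp [h]
  · simp [h] at hν

theorem prod_mem_symFn {r : ℕ} {ι : Type} (S : Finset ι) (F : ι → PS r) (a : ι → ℕ)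
    (h : ∀ i ∈ S, F i ∈ symFn r (a i)) : ∏ i ∈ S, F i ∈ symFn r (∑ i ∈ S, a i) := by
  classical
  induction S using Finset.induction_on with
  | empty => simpa using one_mem_symFn r
  | insert i S hi ih =>
    rw [Finset.prod_insert hi, Finset.sum_insert hi]
    exact mul_mem_symFn (h i (Finset.mem_insert_self _ _))
      (ih fun j hj => h j (Finset.mem_insert_of_mem hj))

/-- The sum of all monomials whose exponent satisfies `p`. -/
def monoSum {r : ℕ} (p : (Fin r × ℕ →₀ ℕ) → Prop) : PS r :=
  open Classical in fun ν => if p ν then 1 else 0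

theorem monoSum_mem_symFn {r a : ℕ} {p : (Fin r × ℕ →₀ ℕ) → Prop}
    (h1 : ∀ (σ : Fin r → Equiv.Perm ℕ) ν, p ν → p (ν.equivMapDomain (varPerm σ)))
    (h2 : ∀ ν, p ν → ν.degree = a) : monoSum p ∈ symFn r a := by
  classical
  have hc : ∀ ν, MvPowerSeries.coeff ν (monoSum p) = if p ν then 1 else 0 := by
    intro ν
    simp only [monoSum, MvPowerSeries.coeff_apply]
  refine ⟨fun σ => ?_, fun ν hν => h2 ν ?_⟩
  · ext ν
    obtain ⟨ν', rfl⟩ : ∃ ν', ν = ν'.equivMapDomain (varPerm σ) :=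
      ⟨ν.equivMapDomain (varPerm σ).symm, by
        rw [← Finsupp.equivMapDomain_trans]; simp⟩
    have h3 : MvPowerSeries.coeff (ν'.equivMapDomain (varPerm σ))
        (MvPowerSeries.renameEquiv (ParamField r) (varPerm σ) (monoSum p)) =
        MvPowerSeries.coeff ν' (monoSum p) := by
      have := MvPowerSeries.coeff_embDomain_rename (varPerm σ).toEmbedding (monoSum p) ν'
      rw [Finsupp.embDomain_eq_mapDomain] at this
      rw [Finsupp.equivMapDomain_eq_mapDomain]
      exact this
    rw [h3, hc, hc]
    have h4 : p (ν'.equivMapDomain (varPerm σ)) ↔ p ν' := by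
      refine ⟨fun h => ?_, h1 σ ν'⟩
      have h5 := h1 (fun k => (σ k).symm) _ h
      rw [← Finsupp.equivMapDomain_trans] at h5
      have h6 : (varPerm σ).trans (varPerm fun k => (σ k).symm) = Equiv.refl _ := by
        ext x <;> simp [varPerm]
      rwa [h6, Finsupp.equivMapDomain_refl] at h5
    simp [h4]
  · rw [hc] at hν
    by_contra h
    simp [h] at hν

/-- The complete symmetric function `h_a` in the `k`-th family of variables. -/
def hFn {r : ℕ} (k : Fin r) (a : ℕ) : PS r :=
  monoSum fun ν => (∀ x, x.1 ≠ k → ν x = 0) ∧ ν.degree = a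

/-- The elementary symmetric function `e_b` in the `k`-th family of variables. -/
def eFn {r : ℕ} (k : Fin r) (b : ℕ) : PS r :=
  monoSum fun ν => (∀ x, x.1 ≠ k → ν x = 0) ∧ (∀ x, ν x ≤ 1) ∧ ν.degree = b

/-- The monomial symmetric function `m_lam`, the sum of all the monomials obtained from
`∏_k ∏_i (x^{(k)}_i) ^ lam^{(k)}_i` by permutations in each family of variables. -/
def mFn {r : ℕ} (lam : Fin r → YoungDiagram) : PS r :=
  monoSum fun ν => ∃ σ : Fin r → Equiv.Perm ℕ, ∀ k i, ν (k, σ k i) = (lam k).rowLen i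

/-- The entry `h_{lam_i - i + j}` of the Jacobi-Trudi matrix, with `h_a = 0` for `a < 0`. -/
def jtEntry {r : ℕ} (k : Fin r) (μ : YoungDiagram) (i j : ℕ) : PS r :=
  if i ≤ μ.rowLen i + j then hFn k (μ.rowLen i + j - i) else 0

/-- The Schur function `s_lam`, the product over `k` of the Schur functions
`det (h_{lam^{(k)}_i - i + j})` in the `k`-th family of variables. -/
def sFn {r : ℕ} (lam : Fin r → YoungDiagram) : PS r :=
  ∏ k, Matrix.det (Matrix.of fun i j : Fin ((lam k).colLen 0) => jtEntry k (lam k) i j)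

/-- The signatures `+` and `-`. -/
inductive Sign : Type
  | plus
  | minus

/-- `k ∓ 1`, as an element of `ℤ/rℤ`. -/
def Sign.adj (ε : Sign) (k : Fin r) : Fin r :=
  match ε with
  | .plus => k - 1
  | .minus => k + 1

/-- `k - c`, as an element of `ℤ/rℤ`, with `c = 1` for `+` and `c = 0` for `-`. -/
def Sign.sub (ε : Sign) (k : Fin r) : Fin r :=
  match ε with
  | .plus => k - 1
  | .minus => k

/-- `q^{(k)}_{a,±}(x; t)`, the coefficient of `u^a` in
`∏_i (1 - t u x^{(k ∓ 1)}_i) / (1 - u x^{(k)}_i) = (∑_b e_b(x^{(k ∓ 1)}) (-t u)^b) (∑_c h_c(x^{(k)}) u^c)`. -/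
def qOne (ε : Sign) (k : Fin r) (t : ParamField r) (a : ℕ) : PS r :=
  ∑ p ∈ Finset.HasAntidiagonal.antidiagonal a, (-t) ^ p.1 • (eFn (ε.adj k) p.1 * hFn k p.2)

/-- `q^±_lam(x; t_1, …, t_r)`. -/
def qFn (ε : Sign) (lam : Fin r → YoungDiagram) : PS r :=
  ∏ k, ∏ i ∈ Finset.range ((lam k).colLen 0), qOne ε k (tvar (ε.sub k)) ((lam k).rowLen i)

theorem hFn_mem {r : ℕ} (k : Fin r) (a : ℕ) : hFn k a ∈ symFn r a := by
  refine monoSum_mem_symFn (fun σ ν h => ⟨fun x hx => ?_, ?_⟩) fun ν h => h.2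
  · rw [Finsupp.equivMapDomain_apply]
    exact h.1 _ hx
  · rw [Finsupp.equivMapDomain_eq_mapDomain, Finsupp.degree_mapDomain, h.2]

theorem eFn_mem {r : ℕ} (k : Fin r) (a : ℕ) : eFn k a ∈ symFn r a := by
  refine monoSum_mem_symFn (fun σ ν h => ⟨fun x hx => ?_, fun x => ?_, ?_⟩) fun ν h => h.2.2
  · rw [Finsupp.equivMapDomain_apply]
    exact h.1 _ hx
  · rw [Finsupp.equivMapDomain_apply]
    exact h.2.1 _
  · rw [Finsupp.equivMapDomain_eq_mapDomain, Finsupp.degree_mapDomain, h.2.2]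

theorem sum_rowLen (μ : YoungDiagram) :
    ∑ i ∈ Finset.range (μ.colLen 0), μ.rowLen i = μ.card := by
  classical
  have h : ∀ c ∈ μ.cells, c.1 ∈ Finset.range (μ.colLen 0) := by
    rintro ⟨i, j⟩ hc
    have hc' : (i, j) ∈ μ := hc
    exact Finset.mem_range.2 (YoungDiagram.mem_iff_lt_colLen.1
      (μ.up_left_mem le_rfl (Nat.zero_le j) hc'))
  rw [YoungDiagram.card, Finset.card_eq_sum_card_fiberwise h]
  exact Finset.sum_congr rfl fun i _ => μ.rowLen_eq_card

theorem rowLen_eq_zero {μ : YoungDiagram} {i : ℕ} (h : μ.colLen 0 ≤ i) : μ.rowLen i = 0 := by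
  by_contra h0
  have h1 := YoungDiagram.mem_iff_lt_colLen.1
    (YoungDiagram.mem_iff_lt_rowLen.2 (Nat.pos_of_ne_zero h0))
  omega

theorem qFn_mem (ε : Sign) {n : ℕ} (lam : RPartition r n) : qFn ε lam.1 ∈ symFn r n := by
  have h := prod_mem_symFn Finset.univ _ _ fun k (_ : k ∈ Finset.univ) =>
    prod_mem_symFn (Finset.range ((lam.1 k).colLen 0))
      (fun i => qOne ε k (tvar (ε.sub k)) ((lam.1 k).rowLen i)) _ fun i _ =>
      show _ ∈ symFn r ((lam.1 k).rowLen i) from Submodule.sum_mem _ fun p hp => by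
        rw [← Finset.HasAntidiagonal.mem_antidiagonal.1 hp]
        exact Submodule.smul_mem _ _ (mul_mem_symFn (eFn_mem _ _) (hFn_mem _ _))
  simp only [sum_rowLen, lam.2] at h
  exact h

theorem sFn_mem {r n : ℕ} (lam : RPartition r n) : sFn lam.1 ∈ symFn r n := by
  have h := prod_mem_symFn Finset.univ
    (fun k => Matrix.det (Matrix.of fun i j : Fin ((lam.1 k).colLen 0) =>
      jtEntry k (lam.1 k) i j)) (fun k => (lam.1 k).card) fun k _ => by
    rw [Matrix.det_apply]
    refine Submodule.sum_mem _ fun σ _ => ?_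
    rw [Units.smul_def, ← Int.cast_smul_eq_zsmul (ParamField r)]
    refine Submodule.smul_mem _ _ ?_
    by_cases hz : ∀ i : Fin ((lam.1 k).colLen 0), (σ i : ℕ) ≤ (lam.1 k).rowLen (σ i) + i
    · have h1 := prod_mem_symFn Finset.univ
        (fun i => jtEntry k (lam.1 k) (σ i : ℕ) (i : ℕ)) _ fun i _ => by
          rw [jtEntry, if_pos (hz i)]
          exact hFn_mem _ _
      have h2 : ∑ i : Fin ((lam.1 k).colLen 0), ((lam.1 k).rowLen (σ i) + i - (σ i : ℕ)) =
          (lam.1 k).card := by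
        rw [Finset.sum_tsub_distrib _ fun i _ => hz i, Finset.sum_add_distrib,
          Equiv.sum_comp σ fun i : Fin ((lam.1 k).colLen 0) => (i : ℕ),
          Equiv.sum_comp σ fun i : Fin ((lam.1 k).colLen 0) => (lam.1 k).rowLen i,
          Nat.add_sub_cancel, Fin.sum_univ_eq_sum_range, sum_rowLen]
      rw [h2] at h1
      exact h1
    · obtain ⟨i, hi⟩ := not_forall.1 hz
      rw [Finset.prod_eq_zero (Finset.mem_univ i)]
      · exact Submodule.zero_mem _
      · simp [jtEntry, hi]
  rw [lam.2] at h
  exact h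

theorem mFn_mem {r n : ℕ} (lam : RPartition r n) : mFn lam.1 ∈ symFn r n := by
  refine monoSum_mem_symFn ?_ ?_
  · rintro τ ν ⟨σ, hσ⟩
    refine ⟨fun k => (σ k).trans (τ k), fun k i => ?_⟩
    rw [Finsupp.equivMapDomain_apply, ← hσ k i]
    simp [varPerm, Equiv.prodShear]
  · rintro ν ⟨σ, hσ⟩
    have h1 : ν.degree = ∑ k, ∑ i ∈ Finset.range ((lam.1 k).colLen 0), (lam.1 k).rowLen i := by
      rw [Finset.sum_sigma', Finsupp.degree_apply]
      symm
      refine Finset.sum_bij_ne_zero (fun x _ _ => (x.1, σ x.1 x.2)) ?_ ?_ ?_ ?_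
      · intro x _ hx
        simp only [Finsupp.mem_support_iff, hσ]
        exact hx
      · rintro ⟨k, i⟩ _ _ ⟨k', i'⟩ _ _ h
        obtain ⟨h1, h2⟩ := Prod.mk.inj h
        simp only at h1
        subst h1
        exact congrArg (Sigma.mk k) ((σ k).injective h2)
      · rintro ⟨k, j⟩ _ hx
        have h3 : ν (k, j) = (lam.1 k).rowLen ((σ k).symm j) := by rw [← hσ]; simp
        refine ⟨⟨k, (σ k).symm j⟩, ?_, by simpa [h3] using hx, by simp⟩
        simp only [Finset.mem_sigma, Finset.mem_univ, true_and, Finset.mem_range]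
        by_contra h4
        exact hx (h3.trans (rowLen_eq_zero (not_lt.1 h4)))
      · intro x _ _
        exact (hσ _ _).symm
    rw [h1]
    simp only [sum_rowLen, lam.2]

/-- The diagonal block of a matrix of coefficients at the similarity class of `Λ`. -/
def block {n : ℕ} {D : Finset (Defect r α)} {e : ℕ}
    {s : Fin r → ℕ} {Λ : ZSym n D}
    (c : Matrix (SimClass e s Λ) (ZSym n D) (ParamField r)) :
    Matrix (SimClass e s Λ) (SimClass e s Λ) (ParamField r) :=
  c.submatrix id Subtype.val

/-! ### The spaces `Ξ^{n,d}` and `Ξ^{n,D}` and their bases -/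

/-- The space `Ξ^{n,d}` over `ℚ(t)`, spanned by the Schur functions `s_{θ(lam)}`. -/
def defectSpace {r n' n : ℕ} (θ : RPartition r n' → RPartition r n) :
    Submodule (ParamField r) (PS r) :=
  Submodule.span (ParamField r) (Set.range fun lam => sFn (θ lam).1)

/-- `Θ` is the linear map with `s_lam ↦ s_{θ(lam)}`. -/
def IsTheta {r n' n : ℕ} (θ : RPartition r n' → RPartition r n)
    (Θ : symFn r n' →ₗ[ParamField r] defectSpace θ) : Prop :=
  ∀ lam : RPartition r n', (Θ ⟨sFn lam.1, sFn_mem lam⟩ : PS r) = sFn (θ lam).1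

/-- The linear map `Θ` with `s_lam ↦ s_{θ(lam)}`. -/
def bigTheta {r n' n : ℕ} (θ : RPartition r n' → RPartition r n) :
    symFn r n' →ₗ[ParamField r] defectSpace θ :=
  Classical.epsilon (IsTheta θ)

section

variable {n : ℕ} {D : Finset (Defect r α)}

/-- The space `Ξ^{n,D}` over `ℚ(t)`, the direct sum of the spaces `Ξ^{n,d}` for `d ∈ D`. -/
abbrev Xi (θ : ∀ d : D, RPartition r (n - d.1.f) → RPartition r n) : Type :=
  DirectSum D fun d => defectSpace (θ d)

variable (θ : ∀ d : D, RPartition r (n - d.1.f) → RPartition r n)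

/-- The Schur function `s_Λ`. -/
def sSym (Λ : ZSym n D) : Xi θ :=
  DirectSum.lof (ParamField r) D (fun d => defectSpace (θ d)) Λ.1
    (bigTheta (θ Λ.1) ⟨sFn Λ.2.1, sFn_mem Λ.2⟩)

/-- The monomial symmetric function `m_Λ`. -/
def mSym (Λ : ZSym n D) : Xi θ :=
  DirectSum.lof (ParamField r) D (fun d => defectSpace (θ d)) Λ.1
    (bigTheta (θ Λ.1) ⟨mFn Λ.2.1, mFn_mem Λ.2⟩)

/-- The function `q^±_Λ`. -/
def qSym (ε : Sign) (Λ : ZSym n D) : Xi θ :=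
  DirectSum.lof (ParamField r) D (fun d => defectSpace (θ d)) Λ.1
    (bigTheta (θ Λ.1) ⟨qFn ε Λ.2.1, qFn_mem ε Λ.2⟩)

/-- `B` is the bilinear form on `Ξ^{n,D}` for which `q^+_Λ` and `m_Λ` are dual bases. -/
def IsForm (B : Xi θ →ₗ[ParamField r] Xi θ →ₗ[ParamField r] ParamField r) : Prop :=
  ∀ Λ Λ' : ZSym n D, (Λ = Λ' → B (qSym θ .plus Λ) (mSym θ Λ') = 1) ∧
    (Λ ≠ Λ' → B (qSym θ .plus Λ) (mSym θ Λ') = 0)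

/-- The bilinear form `⟨ , ⟩` on `Ξ^{n,D}`. -/
def form : Xi θ →ₗ[ParamField r] Xi θ →ₗ[ParamField r] ParamField r :=
  Classical.epsilon (IsForm θ)

/-- `F` and `G` have the same specialization at `t = 0`. -/
def EqAtZero (F G : Xi θ) : Prop :=
  ∀ (d : D) (ν : Fin r × ℕ →₀ ℕ),
    HasValueAtZero (MvPowerSeries.coeff ν (F d : PS r) - MvPowerSeries.coeff ν (G d : PS r)) 0

/-! ### Hall-Littlewood functions -/

variable (e : ℕ) (s : Fin r → ℕ) [LinearOrder (ZSym n D)]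

/-- The properties that define the Hall-Littlewood functions `P^±_Λ`:
`P^±_Λ` is the sum of `s_Λ` and of a combination of the `s_{Λ'}` with `Λ' < Λ` and `Λ' ≁ Λ`, with
coefficients that have no pole at `t = 0`, one has `⟨P^+_Λ, P^-_{Λ'}⟩ = 0` for `Λ ≁ Λ'`, and
`P^±_Λ` specializes to `s_Λ` at `t = 0`. -/
def IsHallLittlewood (P : Sign → ZSym n D → Xi θ) : Prop :=
  (∀ (ε : Sign) (Λ : ZSym n D), ∃ u : ZSym n D → ParamField r,
    (∀ Λ', ∃ c, HasValueAtZero (u Λ') c) ∧ (∀ Λ', ZSym.Similar e s Λ' Λ → u Λ' = 0) ∧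
    P ε Λ = sSym θ Λ + ∑ Λ' with Λ' < Λ, u Λ' • sSym θ Λ') ∧
  (∀ Λ Λ' : ZSym n D, ¬ ZSym.Similar e s Λ Λ' → form θ (P .plus Λ) (P .minus Λ') = 0) ∧
  (∀ (ε : Sign) (Λ : ZSym n D), EqAtZero θ (P ε Λ) (sSym θ Λ))

/-- The Hall-Littlewood functions `P^±_Λ`. -/
def hallP : Sign → ZSym n D → Xi θ :=
  Classical.epsilon (IsHallLittlewood θ e s)

/-- The matrix `(⟨P^+_M, P^-_N⟩)` with `M`, `N` in the similarity class of `Λ`. -/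
def gram (Λ : ZSym n D) : Matrix (SimClass e s Λ) (SimClass e s Λ) (ParamField r) :=
  Matrix.of fun M N => form θ (hallP θ e s .plus M.1) (hallP θ e s .minus N.1)

/-- The Hall-Littlewood functions `Q^±_Λ`. -/
def hallQ (ε : Sign) (Λ : ZSym n D) : Xi θ :=
  match ε with
  | .plus => ∑ M : SimClass e s Λ,
      (gram θ e s Λ)⁻¹ ⟨Λ, ZSym.Similar.refl e s Λ⟩ M • hallP θ e s .plus M.1
  | .minus => ∑ M : SimClass e s Λ,
      (gram θ e s Λ)⁻¹ M ⟨Λ, ZSym.Similar.refl e s Λ⟩ • hallP θ e s .minus M.1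

open Classical in
/-- The functions `R_M`, for `M` in the similarity class of `Λ`, are combinations, with
coefficients `c_{M,Λ'}`, of the `q^±_{Λ'}` with `Λ' ∼ M` or `Λ' ≥ M`. -/
def IsUpper (ε : Sign) (Λ : ZSym n D) (R : SimClass e s Λ → Xi θ)
    (c : Matrix (SimClass e s Λ) (ZSym n D) (ParamField r)) : Prop :=
  ∀ M : SimClass e s Λ,
    R M = ∑ Λ' with (ZSym.Similar e s Λ' M.1 ∨ M.1 ≤ Λ'), c M Λ' • qSym θ ε Λ'

open Classical in
/-- The functions `R_M`, for `M` in the similarity class of `Λ`, are combinations, with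
coefficients `u_{M,Λ'}`, of the `s_{Λ'}` with `Λ' ∼ M` or `Λ' ≤ M`. -/
def IsLower (Λ : ZSym n D) (R : SimClass e s Λ → Xi θ)
    (u : Matrix (SimClass e s Λ) (ZSym n D) (ParamField r)) : Prop :=
  ∀ M : SimClass e s Λ,
    R M = ∑ Λ' with (ZSym.Similar e s Λ' M.1 ∨ Λ' ≤ M.1), u M Λ' • sSym θ Λ'

end

end

end RSymbol

/-! Let `T` be the matrix with `m_μ = ∑ T_{λμ} s_λ` (`transition`) and `A` the matrix of the `q^+`
in terms of the `m` (`qMatrix`), both block diagonal over the defects. The form makes `q^+` dual to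
`m`, so its Gram matrix in the Schur basis is `(T A Tᵀ)⁻¹` (`dual_iff_gram_eq`). Three facts about
`T` and `A` carry the theorem.

First, `T` is unitriangular for the order on symbols. If `T_{λμ} ≠ 0`, every component of `λ` is
dominated by that of `μ` (`partial_sums_le_of_transition_ne_zero`). Going up in the dominance order
strictly lowers the sum of minima (`minSum_ofPartition_lt`), hence the `a`-function, while similar
symbols of one defect have equal sums of minima. So `m_Λ - s_Λ` is a combination of the `s_{Λ'}`
with `Λ'` below `Λ` and not similar to it (`unitriangular_mSym`).

Second, `T A Tᵀ = 1` at `t = 0`. The coefficient of `x^{λ+δ}` in `a_δ m_μ` is the same signed sum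
over permutations as the coefficient of `h_μ` in the Jacobi-Trudi determinant of `λ`. At `t = 0` the
`q` are the `h`, so the chain from `s` to `h` to `m` and back to `s` gives the identity
(`transitionIn_mul_qMatrix_zero`). Thus the Gram matrix is regular at the origin and is the identity
there. Its principal submatrices are invertible over the rational functions regular at `0`, so `s_Λ`
can be corrected by lower inequivalent terms, with coefficients vanishing at `0`, to become
orthogonal to all those terms (`exists_orthogonal`). This gives the existence of the Hall-Littlewood
functions.

Third, the matrix of the `q^-` is the transpose of `A` (`kerMatrix_plus_eq_minus`). So `m` and `q^-`
are dual as well, and the statements for the sign `-` are those for `+` applied to the flipped form.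

The rest is linear algebra. Over the set `low` of an index, the families `s`, `m`, `P^+`, `P^-` all
span the same space. Condition (ii) puts `R` in the span of the `s` over the class and its `low`
set; condition (i) says that `R` is orthogonal to the `m` over `low`. By nondegeneracy `R` has no
component along `low`, so it is a combination of the `P` in the class (`mem_span_class`). If `v` is
the matrix of coefficients, the diagonal blocks are `u = v` and `c = v * Gram` (`expansion_iff`).
Then `u = 1` gives `P`, with `c` the nonsingular Gram matrix, and `c = 1` gives `v = Gram⁻¹`, which
is `Q`. -/

namespace RSymbol

/-! ### Similarity of symbols -/

section Similarity

variable {r e : ℕ} {s : Fin r → ℕ}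

/-- The shift on arrays of arbitrary shape. -/
def shiftArray (X : Σ m, SymbolArray e s m) : Σ m, SymbolArray e s m := ⟨_, X.2.shift⟩

/-- The shift is a function whose iterates commute, so having a common iterate is already an
equivalence relation; the generated relation stays inside it. -/
theorem exists_shift_eq_of_mk_eq {X Y : Σ m, SymbolArray e s m}
    (h : Quot.mk (ShiftStep e s) X = Quot.mk _ Y) :
    ∃ a b : ℕ, shiftArray^[a] X = shiftArray^[b] Y := by
  induction Quot.eqvGen_exact h with
  | rel X Y hXY => exact ⟨1, 0, Eq.symm hXY⟩
  | refl X => exact ⟨0, 0, rfl⟩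
  | symm X Y _ ih =>
    obtain ⟨a, b, h⟩ := ih (Quot.eqvGen_sound ‹_›)
    exact ⟨b, a, h.symm⟩
  | trans X Y Z _ _ ih1 ih2 =>
    obtain ⟨a, b, h⟩ := ih1 (Quot.eqvGen_sound ‹_›)
    obtain ⟨c, d, h'⟩ := ih2 (Quot.eqvGen_sound ‹_›)
    refine ⟨c + a, b + d, ?_⟩
    rw [Function.iterate_add_apply, h, ← Function.iterate_add_apply, add_comm c b,
      Function.iterate_add_apply, h', ← Function.iterate_add_apply]

theorem mk_iterate_shiftArray (a : ℕ) (X : Σ m, SymbolArray e s m) :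
    Quot.mk (ShiftStep e s) (shiftArray^[a] X) = Quot.mk _ X := by
  induction a generalizing X with
  | zero => rfl
  | succ a ih =>
    rw [Function.iterate_succ_apply, ih]
    exact (Quot.sound (r := ShiftStep e s) (a := X) (b := shiftArray X) rfl).symm

theorem entries_shift {m : Fin r → ℕ} (X : SymbolArray e s m) :
    X.shift.entries = X.entries.map (· + e) + Finset.univ.val.map s := by
  have hk : ∀ k, (Finset.univ : Finset (Fin (m k + 1))).val.map (X.shift.entry k) =
      ((Finset.univ : Finset (Fin (m k))).val.map (X.entry k)).map (· + e) + {s k} := by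
    intro k
    rw [Fin.univ_castSuccEmb, Finset.cons_val, Multiset.map_cons, Finset.map_val,
      Multiset.map_map, Multiset.map_map, Multiset.add_comm, Multiset.singleton_add]
    congr 1
    · simp [SymbolArray.shift]
    · refine Multiset.map_congr rfl fun i _ => ?_
      simp [SymbolArray.shift]
  simp only [SymbolArray.entries, hk, Finset.sum_add_distrib]
  congr 1
  · exact (map_sum (Multiset.mapAddMonoidHom (· + e))
      (fun k => (Finset.univ : Finset (Fin (m k))).val.map (X.entry k)) Finset.univ).symm
  · conv_rhs => rw [← Multiset.sum_map_singleton (Finset.univ.val.map s), Multiset.map_map]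
    rfl

/-- On multisets of entries the shift is translation by `e` followed by the addition of a fixed
multiset, and both are injective whatever the row lengths are. -/
theorem entries_iterate_shiftArray_inj (a : ℕ) (X Y : Σ m, SymbolArray e s m) :
    (shiftArray^[a] X).2.entries = (shiftArray^[a] Y).2.entries ↔ X.2.entries = Y.2.entries := by
  induction a generalizing X Y with
  | zero => rfl
  | succ a ih =>
    rw [Function.iterate_succ_apply, Function.iterate_succ_apply, ih]
    simp only [shiftArray, entries_shift, add_left_inj]
    exact (Multiset.map_injective (add_left_injective e)).eq_iff

theorem card_entries_iterate_shiftArray (a : ℕ) (X : Σ m, SymbolArray e s m) :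
    (shiftArray^[a] X).2.entries.card = X.2.entries.card + a * r := by
  induction a generalizing X with
  | zero => simp
  | succ a ih =>
    rw [Function.iterate_succ_apply, ih]
    simp only [shiftArray, entries_shift, Multiset.card_add, Multiset.card_map, Finset.card_val,
      Finset.card_univ, Fintype.card_fin]
    ring

theorem similar_mk_iff {X Y : Σ m, SymbolArray e s m} :
    Symbol.Similar (Quot.mk (ShiftStep e s) X) (Quot.mk _ Y) ↔
      ∃ a b, (shiftArray^[a] X).2.entries = (shiftArray^[b] Y).2.entries := by
  constructor
  · rintro ⟨X', Y', hX, hY, h⟩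
    obtain ⟨a, b, hab⟩ := exists_shift_eq_of_mk_eq hX
    obtain ⟨c, d, hcd⟩ := exists_shift_eq_of_mk_eq hY
    refine ⟨c + b, a + d, ?_⟩
    rw [Function.iterate_add_apply, Function.iterate_add_apply, ← hab, ← hcd,
      ← Function.iterate_add_apply, ← Function.iterate_add_apply, add_comm a c,
      entries_iterate_shiftArray_inj]
    exact h
  · rintro ⟨a, b, h⟩
    exact ⟨_, _, mk_iterate_shiftArray a X, mk_iterate_shiftArray b Y, h⟩

theorem Symbol.Similar.symm {Λ Λ' : Symbol e s} (h : Λ.Similar Λ') : Λ'.Similar Λ := by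
  obtain ⟨X, Y, hX, hY, h⟩ := h
  exact ⟨Y, X, hY, hX, h.symm⟩

/-- The two similarities may use different levels of the middle symbol; further shifts bring them to
a common level. -/
theorem Symbol.Similar.trans {Λ Λ' Λ'' : Symbol e s} (h : Λ.Similar Λ') (h' : Λ'.Similar Λ'') :
    Λ.Similar Λ'' := by
  induction Λ using Quot.ind with | _ X
  induction Λ' using Quot.ind with | _ Y
  induction Λ'' using Quot.ind with | _ Z
  obtain ⟨a, b, h⟩ := similar_mk_iff.1 h
  obtain ⟨c, d, h'⟩ := similar_mk_iff.1 h'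
  refine similar_mk_iff.2 ⟨c + a, b + d, ?_⟩
  rw [Function.iterate_add_apply, Function.iterate_add_apply,
    (entries_iterate_shiftArray_inj c _ _).2 h, ← (entries_iterate_shiftArray_inj b _ _).2 h',
    ← Function.iterate_add_apply, ← Function.iterate_add_apply, add_comm]

/-- Each shift adds `r > 0` entries, so arrays of equal shape need the same number of shifts on both
sides, and these cancel. -/
theorem similar_mk_iff_entries_eq [NeZero r] {m : Fin r → ℕ} {X Y : SymbolArray e s m} :
    Symbol.Similar (Quot.mk (ShiftStep e s) ⟨m, X⟩) (Quot.mk _ ⟨m, Y⟩) ↔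
      X.entries = Y.entries := by
  refine ⟨fun h => ?_, fun h => ⟨_, _, rfl, rfl, h⟩⟩
  obtain ⟨a, b, h⟩ := similar_mk_iff.1 h
  have hc : X.entries.card = Y.entries.card := by simp [SymbolArray.entries]
  have h1 := congrArg Multiset.card h
  rw [card_entries_iterate_shiftArray, card_entries_iterate_shiftArray] at h1
  simp only [hc, add_right_inj] at h1
  obtain rfl := Nat.eq_of_mul_eq_mul_right (Nat.pos_of_neZero r) h1
  exact (entries_iterate_shiftArray_inj a ⟨m, X⟩ ⟨m, Y⟩).1 h

end Similarity

/-! ### The sum of the minima of the pairs of entries -/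

section MinSum

variable {r e : ℕ} {s m : Fin r → ℕ}

/-- An unordered pair off the diagonal comes from exactly two ordered pairs. Ordered pairs are
easier to handle, since their sum splits over pairs of rows. -/
theorem sum_sum_eq_two_mul_sum_sym2_add {ι : Type*} [Fintype ι] [DecidableEq ι] (f : ι → ι → ℕ)
    (hf : ∀ x y, f x y = f y x) :
    ∑ x, ∑ y, f x y =
      2 * ∑ p ∈ (Finset.univ : Finset ι).sym2 with ¬ p.IsDiag, Sym2.lift ⟨f, hf⟩ p +
        ∑ x, f x x := by
  classical
  have h1 : ∑ x, ∑ y, f x y = ∑ x, f x x + ∑ z ∈ (Finset.univ : Finset ι).offDiag, f z.1 z.2 := by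
    rw [← Finset.sum_product', ← Finset.diag_union_offDiag,
      Finset.sum_union (Finset.disjoint_diag_offDiag _), Finset.sum_diag]
  rw [h1, add_comm]
  congr 1
  have h2 : ∀ z ∈ (Finset.univ : Finset ι).offDiag, (Sym2.mk z.1 z.2) ∈
      (Finset.univ : Finset ι).sym2.filter fun p => ¬ p.IsDiag := by
    intro z hz
    simpa using (Finset.mem_offDiag.1 hz).2.2
  rw [← Finset.sum_fiberwise_of_maps_to h2, Finset.mul_sum]
  refine Finset.sum_congr rfl fun p hp => ?_
  induction p using Sym2.ind with | _ x y
  have hxy : x ≠ y := by simpa using (Finset.mem_filter.1 hp).2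
  have h3 : (Finset.univ : Finset ι).offDiag.filter (fun z => Sym2.mk z.1 z.2 = s(x, y)) =
      {(x, y), (y, x)} := by
    ext ⟨a, b⟩
    simp only [Finset.mem_filter, Finset.mem_offDiag, Finset.mem_univ, true_and,
      Finset.mem_insert, Finset.mem_singleton, Sym2.eq_iff, Prod.mk.injEq]
    constructor
    · exact fun h => h.2
    · rintro (⟨rfl, rfl⟩ | ⟨rfl, rfl⟩)
      · exact ⟨hxy, Or.inl ⟨rfl, rfl⟩⟩
      · exact ⟨hxy.symm, Or.inr ⟨rfl, rfl⟩⟩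
  rw [h3, Finset.sum_pair (by simp [hxy]), Sym2.lift_mk, hf y x]
  simp only
  ring

theorem SymbolArray.sum_entries {M : Type*} [AddCommMonoid M] (X : SymbolArray e s m)
    (g : ℕ → M) : (X.entries.map g).sum = ∑ k, ∑ i, g (X.entry k i) := by
  have : ∀ S : Multiset ℕ, (S.map g).sum =
      (Multiset.sumAddMonoidHom.comp (Multiset.mapAddMonoidHom g)) S := fun _ => rfl
  rw [this, SymbolArray.entries, map_sum]
  refine Finset.sum_congr rfl fun k _ => ?_
  rw [← this, Multiset.map_map]
  rfl

theorem SymbolArray.two_mul_minSum_add (X : SymbolArray e s m) :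
    2 * X.minSum + ∑ k, ∑ i, X.entry k i =
      ∑ k, ∑ l, ∑ i, ∑ j, min (X.entry k i) (X.entry l j) := by
  have h := sum_sum_eq_two_mul_sum_sym2_add (ι := Σ k, Fin (m k))
    (fun x y => min (X.entry x.1 x.2) (X.entry y.1 y.2)) fun _ _ => min_comm _ _
  rw [SymbolArray.minSum]
  simp only [min_self, Fintype.sum_sigma] at h
  rw [← h]
  exact Finset.sum_congr rfl fun k _ => Finset.sum_comm

/-- The sum over ordered pairs and the total of the entries depend only on the multiset of entries.
-/
theorem SymbolArray.minSum_eq_of_entries_eq {X Y : SymbolArray e s m}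
    (h : X.entries = Y.entries) : X.minSum = Y.minSum := by
  have h1 : ∀ X : SymbolArray e s m, 2 * X.minSum + (X.entries.map id).sum =
      (X.entries.map fun a => (X.entries.map fun b => min a b).sum).sum := by
    intro X
    simp only [SymbolArray.sum_entries, id]
    rw [two_mul_minSum_add]
    exact Finset.sum_congr rfl fun k _ => Finset.sum_comm
  have h2 := h1 X
  rw [h, ← h1 Y] at h2
  omega

/-- This is concavity of `min (·, b)`. Cutting where `a` falls below `b`, the left side is at most
`p * b` plus the tail of `a'` from `p` on, the right side equals `p * b` plus the tail of `a`, and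
tails compare in the direction opposite to partial sums because the totals agree. -/
theorem sum_min_le_of_partial_sums_le {N : ℕ} {a a' : ℕ → ℕ} (ha : Antitone a)
    (hle : ∀ p ≤ N, ∑ i ∈ Finset.range p, a i ≤ ∑ i ∈ Finset.range p, a' i)
    (heq : ∑ i ∈ Finset.range N, a i = ∑ i ∈ Finset.range N, a' i) (b : ℕ) :
    ∑ i ∈ Finset.range N, min (a' i) b ≤ ∑ i ∈ Finset.range N, min (a i) b := by
  -- `p` is the first index with an entry smaller than `b`, or `N` if there is none.
  obtain ⟨p, hp, hp1, hp2⟩ : ∃ p ≤ N, (∀ i < p, b ≤ a i) ∧ ∀ i, p ≤ i → i < N → a i ≤ b := by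
    by_cases h : ∃ i, i < N ∧ a i < b
    · classical
      refine ⟨Nat.find h, (Nat.find_spec h).1.le, fun i hi => ?_, fun i hi _ => ?_⟩
      · by_contra h'
        exact Nat.find_min h hi ⟨hi.trans (Nat.find_spec h).1, not_le.1 h'⟩
      · exact (ha hi).trans (Nat.find_spec h).2.le
    · push Not at h
      exact ⟨N, le_rfl, h, fun i h1 h2 => absurd h1 (not_le.2 h2)⟩
  have split : ∀ f : ℕ → ℕ, ∑ i ∈ Finset.range N, f i =
      ∑ i ∈ Finset.range p, f i + ∑ i ∈ Finset.Ico p N, f i := fun f =>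
    (Finset.sum_range_add_sum_Ico f hp).symm
  have e1 : ∑ i ∈ Finset.range p, min (a i) b = ∑ i ∈ Finset.range p, b :=
    Finset.sum_congr rfl fun i hi => min_eq_right (hp1 i (Finset.mem_range.1 hi))
  have e2 : ∑ i ∈ Finset.Ico p N, min (a i) b = ∑ i ∈ Finset.Ico p N, a i :=
    Finset.sum_congr rfl fun i hi =>
      min_eq_left (hp2 i (Finset.mem_Ico.1 hi).1 (Finset.mem_Ico.1 hi).2)
  have e3 : ∑ i ∈ Finset.range p, min (a' i) b ≤ ∑ i ∈ Finset.range p, b :=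
    Finset.sum_le_sum fun i _ => min_le_right _ _
  have e4 : ∑ i ∈ Finset.Ico p N, min (a' i) b ≤ ∑ i ∈ Finset.Ico p N, a' i :=
    Finset.sum_le_sum fun i _ => min_le_left _ _
  have e5 := hle p hp
  rw [split a, split a'] at heq
  rw [split, split, e1, e2]
  omega

theorem sum_sum_min_le_of_partial_sums_le {N N' : ℕ} {a a' b b' : ℕ → ℕ} (ha : Antitone a)
    (hb : Antitone b)
    (hle : ∀ p ≤ N, ∑ i ∈ Finset.range p, a i ≤ ∑ i ∈ Finset.range p, a' i)
    (heq : ∑ i ∈ Finset.range N, a i = ∑ i ∈ Finset.range N, a' i)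
    (hle' : ∀ p ≤ N', ∑ i ∈ Finset.range p, b i ≤ ∑ i ∈ Finset.range p, b' i)
    (heq' : ∑ i ∈ Finset.range N', b i = ∑ i ∈ Finset.range N', b' i) :
    ∑ i ∈ Finset.range N, ∑ j ∈ Finset.range N', min (a' i) (b' j) ≤
      ∑ i ∈ Finset.range N, ∑ j ∈ Finset.range N', min (a i) (b j) := by
  refine le_trans (Finset.sum_le_sum fun i _ =>
    (?_ : _ ≤ ∑ j ∈ Finset.range N', min (a' i) (b j))) ?_
  · simp only [min_comm (a' i)]
    exact sum_min_le_of_partial_sums_le hb hle' heq' _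
  · rw [Finset.sum_comm, Finset.sum_comm (f := fun i j => min (a i) (b j))]
    exact Finset.sum_le_sum fun j _ => sum_min_le_of_partial_sums_le ha hle heq _

/-- For a decreasing sequence the minimum is the entry of larger index, and `i` is the larger index
of `2 * i + 1` ordered pairs. -/
theorem sum_sum_min_self {N : ℕ} {a : ℕ → ℕ} (ha : Antitone a) :
    ∑ i ∈ Finset.range N, ∑ j ∈ Finset.range N, min (a i) (a j) =
      ∑ i ∈ Finset.range N, (2 * i + 1) * a i := by
  induction N with
  | zero => simp
  | succ N ih =>
    simp only [Finset.sum_range_succ, Finset.sum_add_distrib, ih, min_self]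
    have h1 : ∑ i ∈ Finset.range N, min (a i) (a N) = N * a N := by
      rw [Finset.sum_congr rfl fun i hi => min_eq_right (ha (Finset.mem_range.1 hi).le)]
      simp
    have h2 : ∑ i ∈ Finset.range N, min (a N) (a i) = N * a N := by
      simpa only [min_comm] using h1
    rw [h1, h2]
    ring

/-- Abel summation: `a i` occurs in `N - i` of the partial sums. -/
theorem sum_mul_add_sum_partial_sums {N : ℕ} (a : ℕ → ℕ) :
    ∑ i ∈ Finset.range N, i * a i + ∑ p ∈ Finset.range (N + 1), ∑ i ∈ Finset.range p, a i =
      N * ∑ i ∈ Finset.range N, a i := by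
  induction N with
  | zero => simp
  | succ N ih =>
    rw [Finset.sum_range_succ _ N, Finset.sum_range_succ _ (N + 1)]
    have : ∑ i ∈ Finset.range N, i * a i + N * a N +
        (∑ p ∈ Finset.range (N + 1), ∑ i ∈ Finset.range p, a i + ∑ i ∈ Finset.range (N + 1), a i)
        = (∑ i ∈ Finset.range N, i * a i +
          ∑ p ∈ Finset.range (N + 1), ∑ i ∈ Finset.range p, a i) +
          (N * a N + ∑ i ∈ Finset.range (N + 1), a i) := by ring
    rw [this, ih, Finset.sum_range_succ]
    ring

/-- By the two preceding identities the double sum is `(2N + 1)` times the total minus twice the sum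
of all partial sums. If an entry differs, some partial sum differs, which gives strictness. -/
theorem sum_sum_min_lt_of_partial_sums_le {N : ℕ} {a a' : ℕ → ℕ} (ha : Antitone a)
    (ha' : Antitone a')
    (hle : ∀ p ≤ N, ∑ i ∈ Finset.range p, a i ≤ ∑ i ∈ Finset.range p, a' i)
    (heq : ∑ i ∈ Finset.range N, a i = ∑ i ∈ Finset.range N, a' i)
    (hne : ∃ i < N, a i ≠ a' i) :
    ∑ i ∈ Finset.range N, ∑ j ∈ Finset.range N, min (a' i) (a' j) <
      ∑ i ∈ Finset.range N, ∑ j ∈ Finset.range N, min (a i) (a j) := by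
  have h1 : ∑ p ∈ Finset.range (N + 1), ∑ i ∈ Finset.range p, a i <
      ∑ p ∈ Finset.range (N + 1), ∑ i ∈ Finset.range p, a' i := by
    refine lt_of_le_of_ne (Finset.sum_le_sum fun p hp =>
      hle p (Nat.lt_succ_iff.1 (Finset.mem_range.1 hp))) fun h => ?_
    rw [Finset.sum_eq_sum_iff_of_le fun p hp =>
      hle p (Nat.lt_succ_iff.1 (Finset.mem_range.1 hp))] at h
    obtain ⟨i, hi, hne⟩ := hne
    have h2 := h i (Finset.mem_range.2 (by omega))
    have h3 := h (i + 1) (Finset.mem_range.2 (by omega))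
    rw [Finset.sum_range_succ, Finset.sum_range_succ] at h3
    omega
  rw [sum_sum_min_self ha, sum_sum_min_self ha']
  have h2 := sum_mul_add_sum_partial_sums (N := N) a
  have h3 := sum_mul_add_sum_partial_sums (N := N) a'
  have h4 : ∀ b : ℕ → ℕ, ∑ i ∈ Finset.range N, (2 * i + 1) * b i =
      2 * ∑ i ∈ Finset.range N, i * b i + ∑ i ∈ Finset.range N, b i := by
    intro b
    rw [Finset.mul_sum, ← Finset.sum_add_distrib]
    exact Finset.sum_congr rfl fun i _ => by ring
  rw [h4, h4]
  rw [heq] at h2 ⊢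
  omega

/-- The array of a larger `r`-partition in the dominance order has a smaller sum of minima. -/
theorem minSum_ofPartition_lt {lam mu : Fin r → YoungDiagram}
    (hle : ∀ k p, ∑ i ∈ Finset.range p, (lam k).rowLen i ≤ ∑ i ∈ Finset.range p, (mu k).rowLen i)
    (heq : ∀ k, ∑ i ∈ Finset.range (m k), (lam k).rowLen i =
      ∑ i ∈ Finset.range (m k), (mu k).rowLen i)
    (hne : ∃ k, ∃ i < m k, (lam k).rowLen i ≠ (mu k).rowLen i) :
    (SymbolArray.ofPartition e s m mu).minSum < (SymbolArray.ofPartition e s m lam).minSum := by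
  let a : (Fin r → YoungDiagram) → Fin r → ℕ → ℕ :=
    fun lam k i => s k + (m k - 1 - i) * e + (lam k).rowLen i
  have hentry : ∀ lam k (i : Fin (m k)),
      (SymbolArray.ofPartition e s m lam).entry k i = a lam k i := fun _ _ _ => rfl
  have hanti : ∀ lam k, Antitone (a lam k) := fun lam k i j hij =>
    Nat.add_le_add (Nat.add_le_add_left (Nat.mul_le_mul_right e (by omega)) _)
      ((lam k).rowLen_anti i j hij)
  have hle' : ∀ k p, ∑ i ∈ Finset.range p, a lam k i ≤ ∑ i ∈ Finset.range p, a mu k i := by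
    intro k p
    simp only [a, Finset.sum_add_distrib]
    exact Nat.add_le_add_left (hle k p) _
  have heq' : ∀ k, ∑ i ∈ Finset.range (m k), a lam k i = ∑ i ∈ Finset.range (m k), a mu k i := by
    intro k
    simp only [a, Finset.sum_add_distrib, heq k]
  have key : ∀ lam, 2 * (SymbolArray.ofPartition e s m lam).minSum +
      ∑ k, ∑ i ∈ Finset.range (m k), a lam k i =
      ∑ k, ∑ l, ∑ i ∈ Finset.range (m k), ∑ j ∈ Finset.range (m l),
        min (a lam k i) (a lam l j) := by
    intro lam
    simp only [Finset.sum_range]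
    simp only [← hentry]
    exact (SymbolArray.ofPartition e s m lam).two_mul_minSum_add
  have h1 := key lam
  have h2 := key mu
  rw [Finset.sum_congr rfl fun k _ => heq' k] at h1
  have h3 : ∀ k l, ∑ i ∈ Finset.range (m k), ∑ j ∈ Finset.range (m l), min (a mu k i) (a mu l j) ≤
      ∑ i ∈ Finset.range (m k), ∑ j ∈ Finset.range (m l), min (a lam k i) (a lam l j) :=
    fun k l => sum_sum_min_le_of_partial_sums_le (hanti _ _) (hanti _ _) (fun p _ => hle' k p)
      (heq' k) (fun p _ => hle' l p) (heq' l)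
  obtain ⟨k, i, hi, hne⟩ := hne
  have h4 : ∑ k, ∑ l, ∑ i ∈ Finset.range (m k), ∑ j ∈ Finset.range (m l),
      min (a mu k i) (a mu l j) < ∑ k, ∑ l, ∑ i ∈ Finset.range (m k), ∑ j ∈ Finset.range (m l),
      min (a lam k i) (a lam l j) := by
    -- Pairs of rows compare weakly; the pairing of row `k` with itself is strict, where `k` is a
    -- row on which the partitions differ.
    refine Finset.sum_lt_sum (fun k _ => Finset.sum_le_sum fun l _ => h3 k l)
      ⟨k, Finset.mem_univ _, Finset.sum_lt_sum (fun l _ => h3 k l) ⟨k, Finset.mem_univ _, ?_⟩⟩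
    exact sum_sum_min_lt_of_partial_sums_le (hanti _ _) (hanti _ _) (fun p _ => hle' k p)
      (heq' k) ⟨i, hi, fun h => hne (Nat.add_left_cancel h)⟩
  omega

end MinSum

/-! ### Rational functions without pole at the origin -/

section ValueRing

variable {r : ℕ}

theorem algebraMap_ne_zero_of_eval_ne_zero {q : MvPolynomial (Fin r) ℚ} (hq : q.eval 0 ≠ 0) :
    algebraMap (MvPolynomial (Fin r) ℚ) (ParamField r) q ≠ 0 := by
  intro h
  rw [FaithfulSMul.algebraMap_eq_zero_iff] at h
  exact hq (by rw [h, map_zero])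

theorem hasValueAtZero_algebraMap (p : MvPolynomial (Fin r) ℚ) :
    HasValueAtZero (algebraMap _ (ParamField r) p) (p.eval 0) :=
  ⟨p, 1, by simp, by simp, by simp⟩

/-- The graph of the evaluation at `t = 0` of the rational functions without pole at `t = 0`. -/
def valueRing (r : ℕ) : Subring (ParamField r × ℚ) where
  carrier := {x | HasValueAtZero x.1 x.2}
  zero_mem' := by simpa using hasValueAtZero_algebraMap (0 : MvPolynomial (Fin r) ℚ)
  one_mem' := by simpa using hasValueAtZero_algebraMap (1 : MvPolynomial (Fin r) ℚ)
  add_mem' := by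
    rintro ⟨g, c⟩ ⟨g', c'⟩ ⟨p, q, hq, rfl, rfl⟩ ⟨p', q', hq', rfl, rfl⟩
    have h := algebraMap_ne_zero_of_eval_ne_zero hq
    have h' := algebraMap_ne_zero_of_eval_ne_zero hq'
    refine ⟨p * q' + q * p', q * q', by rw [map_mul]; exact mul_ne_zero hq hq', ?_, ?_⟩
    · simp [div_add_div _ _ h h']
    · simp only [map_add, map_mul]
      exact div_add_div _ _ hq hq'
  mul_mem' := by
    rintro ⟨g, c⟩ ⟨g', c'⟩ ⟨p, q, hq, rfl, rfl⟩ ⟨p', q', hq', rfl, rfl⟩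
    exact ⟨p * p', q * q', by rw [map_mul]; exact mul_ne_zero hq hq', by simp [div_mul_div_comm],
      by simp [div_mul_div_comm]⟩
  neg_mem' := by
    rintro ⟨g, c⟩ ⟨p, q, hq, rfl, rfl⟩
    exact ⟨-p, q, hq, by simp [neg_div], by simp [neg_div]⟩

namespace valueRing

/-- The rational function underlying an element of `valueRing r`. -/
noncomputable def toField (r : ℕ) : valueRing r →+* ParamField r :=
  (RingHom.fst _ _).comp (valueRing r).subtype

/-- The value at `t = 0`. -/
noncomputable def value (r : ℕ) : valueRing r →+* ℚ := (RingHom.snd _ _).comp (valueRing r).subtype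

theorem hasValueAtZero (x : valueRing r) : HasValueAtZero (toField r x) (value r x) := x.2

/-- If `x = p / q`, the value is `p(0) / q(0)`, so the reciprocal `q / p` is again regular at the
origin. -/
theorem isUnit_of_value_ne_zero {x : valueRing r} (hx : value r x ≠ 0) : IsUnit x := by
  obtain ⟨p, q, hq, hg, hc⟩ := hasValueAtZero x
  have hp : p.eval 0 ≠ 0 := by
    intro h
    rw [hc, h, zero_div] at hx
    exact hx rfl
  refine IsUnit.of_mul_eq_one
    (⟨((toField r x)⁻¹, (value r x)⁻¹), q, p, hp, by simp [hg], by simp [hc]⟩) ?_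
  have h := algebraMap_ne_zero_of_eval_ne_zero hq
  have h' := algebraMap_ne_zero_of_eval_ne_zero hp
  refine Subtype.ext (Prod.ext ?_ ?_)
  · exact mul_inv_cancel₀ (a := toField r x) (by rw [hg]; exact div_ne_zero h' h)
  · exact mul_inv_cancel₀ hx

/-- A matrix whose value at `t = 0` is the identity is invertible. -/
theorem isUnit_det_of_map_value_eq_one {ι : Type*} [Fintype ι] [DecidableEq ι]
    {E : Matrix ι ι (valueRing r)} (h : E.map (value r) = 1) : IsUnit E.det := by
  apply isUnit_of_value_ne_zero
  rw [RingHom.map_det, RingHom.mapMatrix_apply, h, Matrix.det_one]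
  exact one_ne_zero

theorem map_value_inv {ι : Type*} [Fintype ι] [DecidableEq ι]
    {E : Matrix ι ι (valueRing r)} (h : E.map (value r) = 1) : E⁻¹.map (value r) = 1 := by
  have h1 := congrArg (value r).mapMatrix (E.mul_nonsing_inv (isUnit_det_of_map_value_eq_one h))
  simpa [map_mul, h] using h1

end valueRing

end ValueRing

/-! ### Monomial symmetric functions -/

section Monomial

theorem exists_perm_antitone (f : ℕ →₀ ℕ) : ∃ σ : Equiv.Perm ℕ, Antitone fun i => f (σ i) := by
  obtain ⟨N, hN⟩ : ∃ N, ∀ i, N ≤ i → f i = 0 := by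
    refine ⟨f.support.sup id + 1, fun i hi => ?_⟩
    by_contra h
    have := Finset.le_sup (f := id) (Finsupp.mem_support_iff.2 h)
    simp only [id] at this
    omega
  -- Sorting into the order dual gives decreasing values; beyond `N` the function vanishes and the
  -- permutation is the identity.
  let g : Fin N → ℕᵒᵈ := fun i => OrderDual.toDual (f i)
  let σ : Equiv.Perm ℕ := (Tuple.sort g).extendDomain Fin.equivSubtype
  have h1 : ∀ (i : ℕ) (hi : i < N), σ i = Tuple.sort g ⟨i, hi⟩ := fun i hi => by
    simp only [σ]
    rw [Equiv.Perm.extendDomain_apply_subtype (b := i) _ _ hi]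
    rfl
  have h2 : ∀ i, N ≤ i → σ i = i := fun i hi =>
    Equiv.Perm.extendDomain_apply_not_subtype _ _ (not_lt.2 hi)
  refine ⟨σ, fun i j hij => ?_⟩
  by_cases hj : j < N
  · have := Tuple.monotone_sort g (show (⟨i, hij.trans_lt hj⟩ : Fin N) ≤ ⟨j, hj⟩ from hij)
    simp only [h1 j hj, h1 i (hij.trans_lt hj)]
    exact this
  · simp only [h2 j (not_lt.1 hj), hN j (not_lt.1 hj)]
    exact Nat.zero_le _

theorem exists_rowLen_eq {g : ℕ → ℕ} (hg : Antitone g) {N : ℕ} (hN : ∀ i, N ≤ i → g i = 0) :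
    ∃ μ : YoungDiagram, ∀ i, μ.rowLen i = g i := by
  let μ : YoungDiagram :=
    { cells := (Finset.range N ×ˢ Finset.range (g 0)).filter fun c => c.2 < g c.1
      isLowerSet := by
        rintro ⟨i, j⟩ ⟨i', j'⟩ ⟨h1, h2⟩ h
        simp only [Finset.coe_filter, Finset.mem_product, Finset.mem_range,
          Set.mem_ofPred_eq] at h h1 h2 ⊢
        have := hg h1
        omega }
  have hmem : ∀ i j, (i, j) ∈ μ ↔ j < g i := by
    intro i j
    rw [← YoungDiagram.mem_cells]
    simp only [μ, Finset.mem_filter, Finset.mem_product, Finset.mem_range, and_iff_right_iff_imp]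
    intro h
    refine ⟨?_, h.trans_le (hg (Nat.zero_le i))⟩
    by_contra h'
    rw [hN i (not_lt.1 h')] at h
    omega
  refine ⟨μ, fun i => le_antisymm ?_ ?_⟩
  · by_contra h
    exact lt_irrefl _ ((hmem i _).1 (YoungDiagram.mem_iff_lt_rowLen.2 (not_le.1 h)))
  · by_contra h
    exact lt_irrefl _ (YoungDiagram.mem_iff_lt_rowLen.1 ((hmem i _).2 (not_le.1 h)))

theorem youngDiagram_ext_rowLen {μ ν : YoungDiagram} (h : ∀ i, μ.rowLen i = ν.rowLen i) :
    μ = ν := by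
  refine YoungDiagram.ext (Finset.ext fun c => ?_)
  obtain ⟨i, j⟩ := c
  rw [YoungDiagram.mem_cells, YoungDiagram.mem_cells, YoungDiagram.mem_iff_lt_rowLen,
    YoungDiagram.mem_iff_lt_rowLen, h]

/-- The length of column `j` counts the rows longer than `j`, a number that permuting the rows does
not change. -/
theorem eq_of_rowLen_eq_comp_perm {μ ν : YoungDiagram} (σ : Equiv.Perm ℕ)
    (h : ∀ i, μ.rowLen i = ν.rowLen (σ i)) : μ = ν := by
  have h1 : ∀ j, μ.colLen j = ν.colLen j := by
    intro j
    rw [← Finset.card_range (μ.colLen j), ← Finset.card_range (ν.colLen j)]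
    refine Finset.card_bij (fun i _ => σ i) ?_ (fun _ _ _ _ h => σ.injective h) ?_
    · intro i hi
      rw [Finset.mem_range, ← YoungDiagram.mem_iff_lt_colLen,
        YoungDiagram.mem_iff_lt_rowLen] at hi ⊢
      rwa [← h]
    · intro i hi
      refine ⟨σ.symm i, ?_, by simp⟩
      rw [Finset.mem_range, ← YoungDiagram.mem_iff_lt_colLen,
        YoungDiagram.mem_iff_lt_rowLen] at hi ⊢
      rwa [h, Equiv.apply_symm_apply]
  refine YoungDiagram.ext (Finset.ext fun c => ?_)
  obtain ⟨i, j⟩ := c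
  rw [YoungDiagram.mem_cells, YoungDiagram.mem_cells, YoungDiagram.mem_iff_lt_colLen,
    YoungDiagram.mem_iff_lt_colLen, h1]

variable {r : ℕ}

/-- The exponent of the monomial `∏_k ∏_i (x^{(k)}_i) ^ lam^{(k)}_i`. -/
noncomputable def expo (lam : Fin r → YoungDiagram) : Fin r × ℕ →₀ ℕ :=
  Finsupp.onFinset
    (Finset.univ ×ˢ Finset.range (Finset.univ.sup fun k => (lam k).colLen 0))
    (fun x => (lam x.1).rowLen x.2) (by
      rintro ⟨k, i⟩ h
      simp only [Finset.mem_product, Finset.mem_univ, true_and, Finset.mem_range]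
      by_contra h'
      exact h (rowLen_eq_zero ((Finset.le_sup (f := fun k => (lam k).colLen 0)
        (Finset.mem_univ k)).trans (not_lt.1 h'))))

@[simp] theorem expo_apply (lam : Fin r → YoungDiagram) (x : Fin r × ℕ) :
    expo lam x = (lam x.1).rowLen x.2 := rfl

/-- The exponent `ν` is obtained from `lam` by permutations in each family of variables. -/
def IsRearr (ν : Fin r × ℕ →₀ ℕ) (lam : Fin r → YoungDiagram) : Prop :=
  ∃ σ : Fin r → Equiv.Perm ℕ, ∀ k i, ν (k, σ k i) = (lam k).rowLen i

theorem isRearr_expo (lam : Fin r → YoungDiagram) : IsRearr (expo lam) lam :=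
  ⟨fun _ => Equiv.refl _, fun _ _ => rfl⟩

theorem exists_isRearr (ν : Fin r × ℕ →₀ ℕ) : ∃ lam, IsRearr ν lam := by
  have h : ∀ k : Fin r, ∃ (σ : Equiv.Perm ℕ) (μ : YoungDiagram),
      ∀ i, ν (k, σ i) = μ.rowLen i := by
    intro k
    let f : ℕ →₀ ℕ := ν.comapDomain (fun i => (k, i)) (fun _ _ _ _ h => (Prod.mk.inj h).2)
    obtain ⟨σ, hσ⟩ := exists_perm_antitone f
    obtain ⟨N, hN⟩ : ∃ N, ∀ i, N ≤ i → f (σ i) = 0 := by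
      refine ⟨f.support.sup σ.symm + 1, fun i hi => ?_⟩
      by_contra h
      have := Finset.le_sup (f := σ.symm) (Finsupp.mem_support_iff.2 h)
      rw [Equiv.symm_apply_apply] at this
      omega
    obtain ⟨μ, hμ⟩ := exists_rowLen_eq hσ hN
    exact ⟨σ, μ, fun i => (hμ i).symm⟩
  choose σ lam h using h
  exact ⟨lam, σ, h⟩

theorem IsRearr.unique {ν : Fin r × ℕ →₀ ℕ} {lam mu : Fin r → YoungDiagram}
    (h : IsRearr ν lam) (h' : IsRearr ν mu) : lam = mu := by
  obtain ⟨σ, hσ⟩ := h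
  obtain ⟨τ, hτ⟩ := h'
  funext k
  refine eq_of_rowLen_eq_comp_perm ((σ k).trans (τ k).symm) fun i => ?_
  rw [← hσ, ← hτ]
  simp

theorem IsRearr.eq_equivMapDomain {ν : Fin r × ℕ →₀ ℕ} {lam : Fin r → YoungDiagram}
    (h : IsRearr ν lam) :
    ∃ σ : Fin r → Equiv.Perm ℕ, ν = (expo lam).equivMapDomain (varPerm σ) := by
  obtain ⟨σ, hσ⟩ := h
  refine ⟨σ, Finsupp.ext fun x => ?_⟩
  obtain ⟨k, i⟩ := x
  rw [Finsupp.equivMapDomain_apply, expo_apply]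
  simp [varPerm, Equiv.prodShear, ← hσ]

theorem coeff_monoSum (p : (Fin r × ℕ →₀ ℕ) → Prop) (ν : Fin r × ℕ →₀ ℕ) [Decidable (p ν)] :
    MvPowerSeries.coeff ν (monoSum p) = if p ν then 1 else 0 := by
  by_cases h : p ν <;> simp [monoSum, MvPowerSeries.coeff_apply, h]

open Classical in
theorem coeff_mFn (lam : Fin r → YoungDiagram) (ν : Fin r × ℕ →₀ ℕ) :
    MvPowerSeries.coeff ν (mFn lam) = if IsRearr ν lam then 1 else 0 := by
  exact coeff_monoSum (fun ν => IsRearr ν lam) ν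

theorem IsRearr.degree_eq {ν : Fin r × ℕ →₀ ℕ} {lam : Fin r → YoungDiagram}
    (h : IsRearr ν lam) : ν.degree = ∑ k, (lam k).card := by
  classical
  refine (mFn_mem ⟨lam, rfl⟩).2 ν ?_
  rw [coeff_mFn, if_pos h]
  exact one_ne_zero

theorem IsRearr.coeff_eq {n : ℕ} {F : PS r} (hF : F ∈ symFn r n) {ν : Fin r × ℕ →₀ ℕ}
    {lam : Fin r → YoungDiagram} (h : IsRearr ν lam) :
    MvPowerSeries.coeff ν F = MvPowerSeries.coeff (expo lam) F := by
  obtain ⟨σ, rfl⟩ := h.eq_equivMapDomain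
  conv_lhs => rw [← hF.1 σ]
  have := MvPowerSeries.coeff_embDomain_rename (varPerm σ).toEmbedding F (expo lam)
  rw [Finsupp.embDomain_eq_mapDomain] at this
  rw [Finsupp.equivMapDomain_eq_mapDomain]
  exact this

noncomputable instance (r n : ℕ) : Fintype (RPartition r n) := Fintype.ofFinite _

theorem coeff_mFn_expo {n : ℕ} [DecidableEq (RPartition r n)] (lam mu : RPartition r n) :
    MvPowerSeries.coeff (expo mu.1) (mFn lam.1) = if lam = mu then 1 else 0 := by
  classical
  rw [coeff_mFn]
  refine if_congr ⟨fun h => ?_, fun h => h ▸ isRearr_expo _⟩ rfl rfl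
  exact Subtype.ext (h.unique (isRearr_expo _))

/-- Each orbit of exponents of degree `n` contains exactly one `r`-partition, and the coefficients
of `F` are constant on orbits. -/
theorem eq_sum_mFn {n : ℕ} {F : PS r} (hF : F ∈ symFn r n) :
    F = ∑ lam : RPartition r n, MvPowerSeries.coeff (expo lam.1) F • mFn lam.1 := by
  classical
  ext ν
  rw [map_sum]
  simp only [map_smul, coeff_mFn, smul_eq_mul, mul_ite, mul_one, mul_zero]
  obtain ⟨lam, hlam⟩ := exists_isRearr ν
  by_cases hn : ν.degree = n
  · have h1 : ∑ k, (lam k).card = n := hlam.degree_eq ▸ hn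
    rw [Finset.sum_eq_single (⟨lam, h1⟩ : RPartition r n), if_pos hlam, hlam.coeff_eq hF]
    · intro mu _ hne
      rw [if_neg fun h => hne (Subtype.ext (h.unique hlam))]
    · exact fun h => absurd (Finset.mem_univ _) h
  · rw [not_not.1 (mt (hF.2 ν) hn), Finset.sum_eq_zero]
    intro mu _
    rw [if_neg fun h => hn (h.degree_eq.trans mu.2)]

/-- The coefficients of a symmetric function in the basis of monomial symmetric functions. -/
noncomputable def monomialCoeffs (r n : ℕ) :
    symFn r n ≃ₗ[ParamField r] (RPartition r n → ParamField r) where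
  toFun F lam := MvPowerSeries.coeff (expo lam.1) (F : PS r)
  map_add' F G := by ext; simp
  map_smul' c F := by ext; simp
  invFun c := ∑ lam, c lam • ⟨mFn lam.1, mFn_mem lam⟩
  left_inv F := by
    refine Subtype.ext ?_
    rw [Submodule.coe_sum]
    exact (eq_sum_mFn F.2).symm
  right_inv c := by
    classical
    ext mu
    simp only
    rw [Submodule.coe_sum, map_sum]
    simp only [Submodule.coe_smul, map_smul, coeff_mFn_expo, smul_eq_mul, mul_ite, mul_one,
      mul_zero]
    simp

end Monomial

/-! ### The kernel -/

section Kernel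

theorem prod_sum_antidiagonal_eq {σ R : Type*} [DecidableEq σ] [CommSemiring R]
    (ν : σ →₀ ℕ) {S : Finset σ} (hS : ν.support ⊆ S) (f : σ → ℕ → ℕ → R) :
    ∏ x ∈ S, ∑ p ∈ Finset.HasAntidiagonal.antidiagonal (ν x), f x p.1 p.2 =
      ∑ p ∈ Finset.HasAntidiagonal.antidiagonal ν, ∏ x ∈ S, f x (p.1 x) (p.2 x) := by
  rw [Finset.prod_sum]
  symm
  refine Finset.sum_bij (fun p _ x _ => (p.1 x, p.2 x)) ?_ ?_ ?_ ?_
  · rintro ⟨ν₁, ν₂⟩ h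
    rw [Finset.HasAntidiagonal.mem_antidiagonal] at h
    simp [Finset.mem_pi, ← h]
  · rintro ⟨ν₁, ν₂⟩ h ⟨ν₁', ν₂'⟩ h' heq
    rw [Finset.HasAntidiagonal.mem_antidiagonal] at h h'
    have key : ∀ x, ν₁ x = ν₁' x ∧ ν₂ x = ν₂' x := by
      intro x
      by_cases hx : x ∈ S
      · simpa using congrFun (congrFun heq x) hx
      · have h0 : ν x = 0 := by
          by_contra h0
          exact hx (hS (Finsupp.mem_support_iff.2 h0))
        have e1 := DFunLike.congr_fun h x
        have e2 := DFunLike.congr_fun h' x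
        simp only [Finsupp.add_apply, h0] at e1 e2
        omega
    exact Prod.ext (Finsupp.ext fun x => (key x).1) (Finsupp.ext fun x => (key x).2)
  · intro p hp
    rw [Finset.mem_pi] at hp
    refine ⟨(Finsupp.indicator S fun x hx => (p x hx).1,
      Finsupp.indicator S fun x hx => (p x hx).2), ?_, ?_⟩
    · rw [Finset.HasAntidiagonal.mem_antidiagonal]
      ext x
      by_cases hx : x ∈ S
      · simpa [hx] using hp x hx
      · simp only [Finsupp.add_apply, Finsupp.indicator_of_notMem hx]
        by_contra h0
        exact hx (hS (Finsupp.mem_support_iff.2 (Ne.symm h0)))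
    · funext x hx
      simp [hx]
  · rintro ⟨ν₁, ν₂⟩ h
    exact (Finset.prod_attach S fun x => f x (ν₁ x) (ν₂ x)).symm

/-- The coefficient of `z ^ b` in `(1 - t z) / (1 - z)`, where the numerator is present only
if `p` holds and the denominator is present only if `q` holds. -/
def kerWeight {R : Type*} [CommRing R] (p q : Prop) [Decidable p] [Decidable q] (t : R) (b : ℕ) :
    R :=
  ∑ c ∈ Finset.HasAntidiagonal.antidiagonal b,
    (if c.1 = 0 then 1 else if p ∧ c.1 = 1 then -t else 0) * (if q ∨ c.2 = 0 then 1 else 0)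

theorem map_kerWeight {R R' : Type*} [CommRing R] [CommRing R'] (φ : R →+* R') (p q : Prop)
    [Decidable p] [Decidable q] (t : R) (b : ℕ) :
    φ (kerWeight p q t b) = kerWeight p q (φ t) b := by
  simp only [kerWeight, map_sum, map_mul, apply_ite φ, map_one, map_neg, map_zero]

/-- The sum over all the matrices `l` of nonnegative integers with row sums `lam` and column sums
`mu` of the products of the weights `W x y (l x y)`. -/
noncomputable def matrixSum {σ R : Type*} [DecidableEq σ] [CommSemiring R] (W : σ → σ → ℕ → R)
    (lam mu : σ →₀ ℕ) : R :=
  ∑ l ∈ Finset.finsuppAntidiag lam.support mu with ∀ x ∈ lam.support, (l x).degree = lam x,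
    ∏ x ∈ lam.support, ∏ y ∈ mu.support, W x y (l x y)

theorem map_matrixSum {σ R R' : Type*} [DecidableEq σ] [CommSemiring R] [CommSemiring R']
    (φ : R →+* R') (W : σ → σ → ℕ → R) (lam mu : σ →₀ ℕ) :
    φ (matrixSum W lam mu) = matrixSum (fun x y b => φ (W x y b)) lam mu := by
  simp only [matrixSum, map_sum, map_prod]

/-- The transpose of a finitely supported matrix. -/
noncomputable def finsuppTranspose {σ : Type*} (l : σ →₀ σ →₀ ℕ) : σ →₀ σ →₀ ℕ :=
  (l.uncurry.equivMapDomain (Equiv.prodComm σ σ)).curry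

@[simp] theorem finsuppTranspose_apply {σ : Type*} (l : σ →₀ σ →₀ ℕ) (x y : σ) :
    finsuppTranspose l x y = l y x := by
  simp [finsuppTranspose, Finsupp.curry_apply, Finsupp.equivMapDomain_apply]

/-- The index set of `matrixSum` is described so that rows and columns play the same role, which
makes it visibly stable under transposition. -/
theorem mem_matrices_iff {σ : Type*} [DecidableEq σ] {lam mu : σ →₀ ℕ} {l : σ →₀ σ →₀ ℕ} :
    (l ∈ (Finset.finsuppAntidiag lam.support mu).filter
      fun l => ∀ x ∈ lam.support, (l x).degree = lam x) ↔
    (∀ x y, l x y ≠ 0 → x ∈ lam.support ∧ y ∈ mu.support) ∧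
    (∀ x, ∑ y ∈ mu.support, l x y = lam x) ∧ (∀ y, ∑ x ∈ lam.support, l x y = mu y) := by
  rw [Finset.mem_filter, Finset.mem_finsuppAntidiag]
  constructor
  · rintro ⟨⟨h1, h2⟩, h3⟩
    have h4 : ∀ y, ∑ x ∈ lam.support, l x y = mu y := by
      intro y
      rw [← h1, Finsupp.finsetSum_apply]
    have h5 : ∀ x y, l x y ≠ 0 → x ∈ lam.support ∧ y ∈ mu.support := by
      intro x y hxy
      have hx : x ∈ lam.support := h2 (Finsupp.mem_support_iff.2 fun h => hxy (by simp [h]))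
      refine ⟨hx, Finsupp.mem_support_iff.2 ?_⟩
      have := Finset.single_le_sum (f := fun x => l x y) (fun _ _ => Nat.zero_le _) hx
      rw [h4] at this
      omega
    refine ⟨h5, fun x => ?_, h4⟩
    by_cases hx : x ∈ lam.support
    · rw [← h3 x hx, Finsupp.degree_apply]
      refine (Finset.sum_subset (fun y hy => (h5 x y (Finsupp.mem_support_iff.1 hy)).2) ?_).symm
      exact fun y _ hy => Finsupp.notMem_support_iff.1 hy
    · rw [Finsupp.notMem_support_iff.1 hx]
      refine Finset.sum_eq_zero fun y _ => ?_
      by_contra h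
      exact hx (h5 x y h).1
  · rintro ⟨h1, h2, h3⟩
    refine ⟨⟨?_, ?_⟩, ?_⟩
    · ext y
      rw [Finsupp.finsetSum_apply, h3]
    · intro x hx
      obtain ⟨y, hy⟩ := DFunLike.ne_iff.1 (Finsupp.mem_support_iff.1 hx)
      exact (h1 x y hy).1
    · intro x _
      rw [← h2 x, Finsupp.degree_apply]
      refine Finset.sum_subset (fun y hy => (h1 x y (Finsupp.mem_support_iff.1 hy)).2) ?_
      exact fun y _ hy => Finsupp.notMem_support_iff.1 hy

theorem matrixSum_transpose {σ R : Type*} [DecidableEq σ] [CommSemiring R] (W : σ → σ → ℕ → R)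
    (lam mu : σ →₀ ℕ) : matrixSum W lam mu = matrixSum (fun x y => W y x) mu lam := by
  have h : ∀ {lam mu : σ →₀ ℕ} {l : σ →₀ σ →₀ ℕ},
      (l ∈ (Finset.finsuppAntidiag lam.support mu).filter
        fun l => ∀ x ∈ lam.support, (l x).degree = lam x) →
      (finsuppTranspose l ∈ (Finset.finsuppAntidiag mu.support lam).filter
        fun l => ∀ x ∈ mu.support, (l x).degree = mu x) := by
    intro lam mu l hl
    rw [mem_matrices_iff] at hl ⊢
    simp only [finsuppTranspose_apply]
    exact ⟨fun x y h => (hl.1 y x h).symm, hl.2.2, hl.2.1⟩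
  refine Finset.sum_bij' (fun l _ => finsuppTranspose l) (fun l _ => finsuppTranspose l)
    (fun l hl => h hl) (fun l hl => h hl) ?_ ?_ ?_
  · intro l _
    ext; simp
  · intro l _
    ext; simp
  · intro l _
    rw [Finset.prod_comm]
    simp

variable {r : ℕ}

open Classical in
theorem coeff_hFn (k : Fin r) (a : ℕ) (ν : Fin r × ℕ →₀ ℕ) :
    MvPowerSeries.coeff ν (hFn k a) =
      if (∀ x, x.1 ≠ k → ν x = 0) ∧ ν.degree = a then 1 else 0 :=
  coeff_monoSum _ ν

open Classical in
theorem coeff_eFn (k : Fin r) (a : ℕ) (ν : Fin r × ℕ →₀ ℕ) :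
    MvPowerSeries.coeff ν (eFn k a) =
      if (∀ x, x.1 ≠ k → ν x = 0) ∧ (∀ x, ν x ≤ 1) ∧ ν.degree = a then 1 else 0 :=
  coeff_monoSum _ ν

theorem hFn_zero (k : Fin r) : hFn k 0 = 1 := by
  classical
  ext ν
  rw [coeff_hFn, MvPowerSeries.coeff_one]
  refine if_congr ⟨fun h => ?_, fun h => by simp [h]⟩ rfl rfl
  exact (Finsupp.degree_eq_zero_iff ν).1 h.2

theorem eFn_zero (k : Fin r) : eFn k 0 = 1 := by
  classical
  ext ν
  rw [coeff_eFn, MvPowerSeries.coeff_one]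
  refine if_congr ⟨fun h => ?_, fun h => by simp [h]⟩ rfl rfl
  exact (Finsupp.degree_eq_zero_iff ν).1 h.2.2

theorem prod_expo_eq (lam : Fin r → YoungDiagram) {M : Type*} [CommMonoid M]
    (g : Fin r → ℕ → M) (hg : ∀ k, g k 0 = 1) :
    (expo lam).prod (fun x a => g x.1 a) =
      ∏ k, ∏ i ∈ Finset.range ((lam k).colLen 0), g k ((lam k).rowLen i) := by
  rw [Finset.prod_sigma', Finsupp.prod]
  refine Finset.prod_bij_ne_one (fun x _ _ => ⟨x.1, x.2⟩) ?_ ?_ ?_ ?_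
  · rintro ⟨k, i⟩ h _
    simp only [Finset.mem_sigma, Finset.mem_univ, true_and, Finset.mem_range]
    by_contra h'
    exact Finsupp.mem_support_iff.1 h (rowLen_eq_zero (not_lt.1 h'))
  · rintro ⟨k, i⟩ _ _ ⟨k', i'⟩ _ _ h
    simp only [Sigma.mk.injEq, heq_eq_eq] at h
    exact Prod.ext h.1 h.2
  · rintro ⟨k, i⟩ h hne
    refine ⟨(k, i), ?_, hne, rfl⟩
    rw [Finsupp.mem_support_iff]
    intro h0
    rw [expo_apply] at h0
    simp only at hne h0
    rw [h0, hg] at hne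
    exact hne rfl
  · intro x _ _
    rfl

/-- The product of complete symmetric functions with degrees given by the exponent `ν`. -/
noncomputable def hProd (ν : Fin r × ℕ →₀ ℕ) : PS r := ν.prod fun x a => hFn x.1 a

theorem IsRearr.hProd_eq {ν : Fin r × ℕ →₀ ℕ} {lam : Fin r → YoungDiagram}
    (h : IsRearr ν lam) : hProd ν = hProd (expo lam) := by
  obtain ⟨σ, rfl⟩ := h.eq_equivMapDomain
  rw [hProd, Finsupp.equivMapDomain_eq_mapDomain, Finsupp.prod_mapDomain_index_inj
    (varPerm σ).injective]
  rfl

variable [NeZero r]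

/-- The coefficients of the functions `q^±`, with parameters in an arbitrary ring. -/
noncomputable def kerMatrix {R : Type*} [CommRing R] (ε : Sign) (t : Fin r → R)
    (lam mu : Fin r × ℕ →₀ ℕ) : R :=
  matrixSum (fun x y b => kerWeight (y.1 = ε.adj x.1) (y.1 = x.1) (t (ε.sub x.1)) b) lam mu

theorem map_kerMatrix {R R' : Type*} [CommRing R] [CommRing R'] (φ : R →+* R') (ε : Sign)
    (t : Fin r → R) (lam mu : Fin r × ℕ →₀ ℕ) :
    φ (kerMatrix ε t lam mu) = kerMatrix ε (fun k => φ (t k)) lam mu := by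
  simp only [kerMatrix, map_matrixSum, map_kerWeight]

/-- The symmetry of the kernel. -/
theorem kerMatrix_plus_eq_minus {R : Type*} [CommRing R] (t : Fin r → R)
    (lam mu : Fin r × ℕ →₀ ℕ) : kerMatrix .plus t lam mu = kerMatrix .minus t mu lam := by
  rw [kerMatrix, matrixSum_transpose, kerMatrix]
  congr 1
  funext x y b
  simp only [kerWeight]
  refine Finset.sum_congr rfl fun c _ => ?_
  congr 1
  · refine if_congr Iff.rfl rfl ?_
    -- The conditions `x.1 = y.1 - 1` and `y.1 = x.1 + 1` agree, and under them `t_{y.1 - 1} =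
    -- t_{x.1}`: this is the purpose of `c = 1` for `+` and `c = 0` for `-`. Otherwise the parameter
    -- does not occur in the weight.
    by_cases h : x.1 = Sign.plus.adj y.1
    · have h2 : y.1 = Sign.minus.adj x.1 := by
        rw [h]
        exact (sub_add_cancel y.1 1).symm
      have h3 : Sign.plus.sub y.1 = Sign.minus.sub x.1 := h.symm
      exact if_congr (and_congr (iff_of_true h h2) Iff.rfl) (by rw [h3]) rfl
    · have h2 : ¬ y.1 = Sign.minus.adj x.1 := fun h' => h (by
        rw [h']
        exact (add_sub_cancel_right x.1 1).symm)
      rw [if_neg fun h' => h h'.1, if_neg fun h' => h2 h'.1]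
  · exact if_congr (by rw [eq_comm]) rfl rfl

/-- The generating series is a product over the variables, so a coefficient is a product of
one-variable weights. For `r = 1` the families `k` and `k ∓ 1` coincide, so both conditions in
`kerWeight` may hold for one variable. -/
theorem coeff_qOne (ε : Sign) (k : Fin r) (t : ParamField r) (a : ℕ) (ν : Fin r × ℕ →₀ ℕ)
    {S : Finset (Fin r × ℕ)} (hS : ν.support ⊆ S) :
    MvPowerSeries.coeff ν (qOne ε k t a) =
      if ν.degree = a then ∏ x ∈ S, kerWeight (x.1 = ε.adj k) (x.1 = k) t (ν x) else 0 := by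
  classical
  have hsub : ∀ p ∈ Finset.HasAntidiagonal.antidiagonal ν, p.1.support ⊆ S ∧ p.2.support ⊆ S := by
    intro p hp
    rw [Finset.HasAntidiagonal.mem_antidiagonal] at hp
    have : ∀ x, x ∉ S → ν x = 0 := fun x hx => by
      by_contra h0
      exact hx (hS (Finsupp.mem_support_iff.2 h0))
    constructor
    · intro x hx
      by_contra hxS
      have := this x hxS
      rw [← hp, Finsupp.add_apply] at this
      exact (Finsupp.mem_support_iff.1 hx) (by omega)
    · intro x hx
      by_contra hxS
      have := this x hxS
      rw [← hp, Finsupp.add_apply] at this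
      exact (Finsupp.mem_support_iff.1 hx) (by omega)
  have hnum : ∀ ν' : Fin r × ℕ →₀ ℕ, ν'.support ⊆ S →
      ∏ x ∈ S, (if ν' x = 0 then (1 : ParamField r)
        else if x.1 = ε.adj k ∧ ν' x = 1 then -t else 0) =
      if (∀ x, x.1 ≠ ε.adj k → ν' x = 0) ∧ (∀ x, ν' x ≤ 1) then (-t) ^ ν'.degree else 0 := by
    intro ν' hν'
    split_ifs with h
    · have h1 : ∀ x, (if ν' x = 0 then (1 : ParamField r)
        else if x.1 = ε.adj k ∧ ν' x = 1 then -t else 0) = (-t) ^ ν' x := by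
        intro x
        have := h.2 x
        interval_cases hx : ν' x
        · simp
        · have : x.1 = ε.adj k := by
            by_contra h'
            have := h.1 x h'
            omega
          simp [this]
      simp only [h1]
      rw [Finset.prod_pow_eq_pow_sum, Finsupp.degree_apply]
      congr 1
      exact (Finset.sum_subset hν' fun x _ hx => Finsupp.notMem_support_iff.1 hx).symm
    · obtain ⟨x, hx1, hx2⟩ : ∃ x, ν' x ≠ 0 ∧ ¬ (x.1 = ε.adj k ∧ ν' x = 1) := by
        by_contra hcon
        push Not at hcon
        refine h ⟨fun x hx => ?_, fun x => ?_⟩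
        · by_contra h0
          exact hx (hcon x h0).1
        · by_cases h0 : ν' x = 0
          · omega
          · exact (hcon x h0).2.le
      refine Finset.prod_eq_zero (hν' (Finsupp.mem_support_iff.2 hx1)) ?_
      rw [if_neg hx1, if_neg hx2]
  have hden : ∀ ν' : Fin r × ℕ →₀ ℕ, ν'.support ⊆ S →
      ∏ x ∈ S, (if x.1 = k ∨ ν' x = 0 then (1 : ParamField r) else 0) =
      if (∀ x, x.1 ≠ k → ν' x = 0) then 1 else 0 := by
    intro ν' hν'
    rw [Finset.prod_ite_zero, Finset.prod_const_one]
    refine if_congr ⟨fun h x hx => ?_, fun h x _ => ?_⟩ rfl rfl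
    · by_contra h0
      exact (h x (hν' (Finsupp.mem_support_iff.2 h0))).elim hx h0
    · by_cases hx : x.1 = k
      · exact Or.inl hx
      · exact Or.inr (h x hx)
  simp only [kerWeight]
  rw [prod_sum_antidiagonal_eq ν hS (fun x b c =>
    (if b = 0 then (1 : ParamField r) else if x.1 = ε.adj k ∧ b = 1 then -t else 0) *
      (if x.1 = k ∨ c = 0 then 1 else 0))]
  simp only [qOne, map_sum, map_smul, MvPowerSeries.coeff_mul, coeff_eFn, coeff_hFn, smul_eq_mul,
    Finset.mul_sum]
  rw [Finset.sum_comm]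
  split_ifs with hdeg
  · refine Finset.sum_congr rfl fun p hp => ?_
    rw [Finset.prod_mul_distrib, hnum _ (hsub p hp).1, hden _ (hsub p hp).2]
    have hp' := Finset.HasAntidiagonal.mem_antidiagonal.1 hp
    have hd : (p.1.degree, p.2.degree) ∈ Finset.HasAntidiagonal.antidiagonal a := by
      rw [Finset.HasAntidiagonal.mem_antidiagonal, ← hdeg, ← hp', map_add]
    rw [Finset.sum_eq_single_of_mem _ hd]
    · simp only [and_true]
      split_ifs <;> simp
    · intro q _ hq
      by_cases h1 : p.1.degree = q.1
      · have h2 : p.2.degree ≠ q.2 := fun h2 => hq (Prod.ext h1.symm h2.symm)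
        simp [h2]
      · simp [h1]
  · refine Finset.sum_eq_zero fun p hp => Finset.sum_eq_zero fun q hq => ?_
    rw [Finset.HasAntidiagonal.mem_antidiagonal] at hp hq
    by_cases h1 : p.1.degree = q.1
    · have h2 : p.2.degree ≠ q.2 := fun h2 => hdeg (by rw [← hp, map_add, h1, h2, hq])
      simp [h2]
    · simp [h1]

/-- Row `x` of a matrix `l` is the exponent taken from the factor of index `x`. Homogeneity of that
factor fixes the row sums, and the total exponent `mu` fixes the column sums. -/
theorem coeff_prod_qOne (ε : Sign) (t : Fin r → ParamField r) (lam mu : Fin r × ℕ →₀ ℕ) :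
    MvPowerSeries.coeff mu (lam.prod fun x a => qOne ε x.1 (t (ε.sub x.1)) a) =
      kerMatrix ε t lam mu := by
  classical
  rw [Finsupp.prod, MvPowerSeries.coeff_prod, kerMatrix, matrixSum, Finset.sum_filter]
  refine Finset.sum_congr rfl fun l hl => ?_
  have hsub : ∀ x ∈ lam.support, (l x).support ⊆ mu.support := by
    intro x hx y hy
    rw [Finset.mem_finsuppAntidiag] at hl
    rw [Finsupp.mem_support_iff] at hy ⊢
    have := Finset.single_le_sum (f := fun x => l x y) (fun _ _ => Nat.zero_le _) hx
    rw [← hl.1, Finsupp.finsetSum_apply]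
    omega
  rw [Finset.prod_congr rfl fun x hx => coeff_qOne ε x.1 _ (lam x) (l x) (hsub x hx),
    Finset.prod_ite_zero]

theorem qOne_zero_right (ε : Sign) (k : Fin r) (t : ParamField r) : qOne ε k t 0 = 1 := by
  simp [qOne, hFn_zero, eFn_zero]

theorem qOne_zero_param (ε : Sign) (k : Fin r) (a : ℕ) : qOne ε k 0 a = hFn k a := by
  rw [qOne, Finset.sum_eq_single (0, a)]
  · simp [eFn_zero]
  · rintro ⟨b, c⟩ h hne
    have hb : b ≠ 0 := by
      rintro rfl
      simp only [Finset.HasAntidiagonal.mem_antidiagonal, zero_add] at h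
      exact hne (by rw [h])
    simp [hb]
  · simp

theorem coeff_qFn (ε : Sign) (lam : Fin r → YoungDiagram) (mu : Fin r × ℕ →₀ ℕ) :
    MvPowerSeries.coeff mu (qFn ε lam) = kerMatrix ε tvar (expo lam) mu := by
  rw [← coeff_prod_qOne, prod_expo_eq lam (fun k a => qOne ε k (tvar (ε.sub k)) a)
    fun k => qOne_zero_right _ _ _, qFn]

theorem coeff_hProd (ε : Sign) (lam mu : Fin r × ℕ →₀ ℕ) :
    MvPowerSeries.coeff mu (hProd lam) = kerMatrix ε (0 : Fin r → ParamField r) lam mu := by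
  rw [← coeff_prod_qOne]
  simp only [Pi.zero_apply, qOne_zero_param]
  rfl

end Kernel

/-! ### Complete symmetric functions in finitely many variables and alternants -/

section Bialternant

variable {r : ℕ}

/-- The complete symmetric function of degree `a` in the variables in `S`. -/
noncomputable def hFin (S : Finset (Fin r × ℕ)) (a : ℕ) : PS r :=
  monoSum fun ν => ν.support ⊆ S ∧ ν.degree = a

open Classical in
theorem coeff_hFin (S : Finset (Fin r × ℕ)) (a : ℕ) (ν : Fin r × ℕ →₀ ℕ) :
    MvPowerSeries.coeff ν (hFin S a) = if ν.support ⊆ S ∧ ν.degree = a then 1 else 0 :=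
  coeff_monoSum _ ν

theorem hFin_zero (S : Finset (Fin r × ℕ)) : hFin S 0 = 1 := by
  classical
  ext ν
  rw [coeff_hFin, MvPowerSeries.coeff_one]
  refine if_congr ⟨fun h => ?_, fun h => by simp [h]⟩ rfl rfl
  exact (Finsupp.degree_eq_zero_iff ν).1 h.2

/-- The monomials of degree `a + 1` divisible by `x` are the multiples by `x` of those of degree
`a`; the others involve only `S`. -/
theorem hFin_insert {S : Finset (Fin r × ℕ)} {x : Fin r × ℕ} (hx : x ∉ S) (a : ℕ) :
    hFin (insert x S) (a + 1) - hFin (insert x S) a * MvPowerSeries.X x = hFin S (a + 1) := by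
  classical
  ext ν
  rw [map_sub, MvPowerSeries.X, MvPowerSeries.coeff_mul_monomial, coeff_hFin, coeff_hFin,
    coeff_hFin, mul_one]
  by_cases h0 : ν x = 0
  · have h1 : ¬ Finsupp.single x 1 ≤ ν := by
      rw [Finsupp.single_le_iff]
      omega
    rw [if_neg h1, sub_zero]
    refine if_congr (and_congr_left fun _ => ?_) rfl rfl
    exact Finset.subset_insert_iff_of_notMem (by simpa using h0)
  · have h1 : Finsupp.single x 1 ≤ ν := by
      rw [Finsupp.single_le_iff]
      omega
    have h2 : ¬ ν.support ⊆ S := fun h => hx (h (Finsupp.mem_support_iff.2 h0))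
    obtain ⟨ν', rfl⟩ : ∃ ν', ν = ν' + Finsupp.single x 1 := ⟨_, (tsub_add_cancel_of_le h1).symm⟩
    rw [if_pos h1, add_tsub_cancel_right, if_neg (c := _ ⊆ S ∧ _) fun h => h2 h.1, sub_eq_zero]
    refine if_congr (and_congr ⟨fun h y hy => ?_, fun h y hy => ?_⟩ (by simp)) rfl rfl
    · exact h (Finsupp.mem_support_iff.2 (by
        rw [Finsupp.mem_support_iff] at hy
        rw [Finsupp.add_apply]
        omega))
    · by_cases hyx : y = x
      · exact hyx ▸ Finset.mem_insert_self _ _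
      · refine h (Finsupp.mem_support_iff.2 ?_)
        simpa [Finsupp.single_apply, Ne.symm hyx] using hy

theorem mk_hFin_mul_prod (S : Finset (Fin r × ℕ)) :
    PowerSeries.mk (hFin S) *
      ∏ x ∈ S, (1 - PowerSeries.C (MvPowerSeries.X x : PS r) * PowerSeries.X) = 1 := by
  classical
  induction S using Finset.induction_on with
  | empty =>
    rw [Finset.prod_empty, mul_one]
    ext1 a
    rw [PowerSeries.coeff_mk, PowerSeries.coeff_one]
    split_ifs with h
    · rw [h, hFin_zero]
    · ext ν
      rw [coeff_hFin, if_neg]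
      · simp
      · rintro ⟨h1, h2⟩
        rw [Finset.subset_empty, Finsupp.support_eq_empty] at h1
        rw [h1] at h2
        exact h (by simpa using h2.symm)
  | insert x S hx ih =>
    rw [Finset.prod_insert hx, ← mul_assoc]
    convert ih using 2
    ext1 a
    rw [mul_sub, mul_one, map_sub, PowerSeries.coeff_mk, PowerSeries.coeff_mk, ← mul_assoc]
    cases a with
    | zero => simp [hFin_zero]
    | succ a =>
      rw [PowerSeries.coeff_succ_mul_X, PowerSeries.coeff_mul_C, PowerSeries.coeff_mk,
        hFin_insert hx]

/-- The polynomial `∏ (1 - x u)`, with `x` in `S \ {y}`. -/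
noncomputable def omitPoly (S : Finset (Fin r × ℕ)) (y : Fin r × ℕ) : Polynomial (PS r) :=
  open Classical in
  ∏ x ∈ S.erase y, (1 - Polynomial.C (MvPowerSeries.X x : PS r) * Polynomial.X)

theorem natDegree_omitPoly_lt {S : Finset (Fin r × ℕ)} {y : Fin r × ℕ} (hy : y ∈ S) :
    (omitPoly S y).natDegree < S.card := by
  classical
  refine lt_of_le_of_lt ((Polynomial.natDegree_prod_le _ _).trans
    (Finset.sum_le_card_nsmul _ _ 1 fun x _ => ?_)) ?_
  · refine (Polynomial.natDegree_sub_le _ _).trans ?_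
    rw [Polynomial.natDegree_one, max_eq_right (Nat.zero_le _)]
    exact (Polynomial.natDegree_C_mul_le _ _).trans Polynomial.natDegree_X_le
  · rw [smul_eq_mul, mul_one]
    exact Finset.card_erase_lt_of_mem hy

/-- Multiplying `∏_{x ∈ S} (1 - x u)⁻¹` by all factors `1 - x u` except that of `y` leaves the
geometric series `(1 - y u)⁻¹`. -/
theorem sum_hFin_mul_coeff_omitPoly {S : Finset (Fin r × ℕ)} {y : Fin r × ℕ} (hy : y ∈ S)
    (a : ℕ) : ∑ c ∈ Finset.range (a + 1), hFin S (a - c) * (omitPoly S y).coeff c =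
      MvPowerSeries.X y ^ a := by
  classical
  have h1 : PowerSeries.mk (hFin S) * (omitPoly S y : PowerSeries (PS r)) =
      PowerSeries.mk fun a => (MvPowerSeries.X y : PS r) ^ a := by
    have h2 : (omitPoly S y : PowerSeries (PS r)) =
        ∏ x ∈ S.erase y, (1 - PowerSeries.C (MvPowerSeries.X x : PS r) * PowerSeries.X) := by
      rw [omitPoly, ← Polynomial.coeToPowerSeries.ringHom_apply, map_prod]
      simp
    have h3 := mk_hFin_mul_prod S
    rw [← Finset.prod_erase_mul _ _ hy, ← h2, ← mul_assoc] at h3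
    have h4 : (PowerSeries.mk fun a => (MvPowerSeries.X y : PS r) ^ a) *
        (1 - PowerSeries.C (MvPowerSeries.X y : PS r) * PowerSeries.X) = 1 := by
      ext1 a
      rw [mul_sub, mul_one, map_sub, PowerSeries.coeff_mk, ← mul_assoc]
      cases a with
      | zero => simp
      | succ a =>
        rw [PowerSeries.coeff_succ_mul_X, PowerSeries.coeff_mul_C, PowerSeries.coeff_mk,
          PowerSeries.coeff_one, if_neg (Nat.succ_ne_zero a), pow_succ, sub_self]
    exact (IsUnit.of_mul_eq_one_right _ h4).mul_right_cancel (h3.trans h4.symm)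
  have h2 := congrArg (PowerSeries.coeff a) h1
  rw [PowerSeries.coeff_mk, mul_comm, PowerSeries.coeff_mul,
    Finset.Nat.sum_antidiagonal_eq_sum_range_succ_mk] at h2
  rw [← h2]
  refine Finset.sum_congr rfl fun c _ => ?_
  rw [Polynomial.coeff_coe, PowerSeries.coeff_mk, mul_comm]

/-- The Jacobi-Trudi matrix of the sequence `g` in the variables in `S`. -/
noncomputable def jtFin (S : Finset (Fin r × ℕ)) (N : ℕ) (g : ℕ → ℕ) :
    Matrix (Fin N) (Fin N) (PS r) :=
  Matrix.of fun i j => if (i : ℕ) ≤ g i + j then hFin S (g i + j - i) else 0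

/-- The first `N` variables of the family `k`. -/
def firstVars (N : ℕ) (k : Fin r) : Finset (Fin r × ℕ) :=
  (Finset.range N).map ⟨fun i => (k, i), fun _ _ h => (Prod.mk.inj h).2⟩

/-- The alternant with exponents `g i + N - 1 - i`, in the first `N` variables of the family
`k`. -/
noncomputable def alternant (N : ℕ) (k : Fin r) (g : ℕ → ℕ) : Matrix (Fin N) (Fin N) (PS r) :=
  Matrix.of fun i j => MvPowerSeries.X (k, (j : ℕ)) ^ (g i + (N - 1 - i))

theorem jtFin_mul (N : ℕ) (k : Fin r) (g : ℕ → ℕ) :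
    jtFin (firstVars N k) N g *
      (Matrix.of fun l j : Fin N => (omitPoly (firstVars N k) (k, (j : ℕ))).coeff (N - 1 - l)) =
      alternant N k g := by
  ext1 i j
  rw [Matrix.mul_apply]
  have hy : ((k, (j : ℕ)) : Fin r × ℕ) ∈ firstVars N k :=
    Finset.mem_map.2 ⟨j, Finset.mem_range.2 j.2, rfl⟩
  have hcard : (firstVars N k).card = N := by simp [firstVars]
  simp only [jtFin, alternant, Matrix.of_apply]
  -- After reversal the summation index is the degree `c` in `omitPoly`, and the identity is applied
  -- with `a = g i + (N - 1 - i)`.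
  rw [← sum_hFin_mul_coeff_omitPoly hy, ← Equiv.sum_comp Fin.revPerm]
  have h1 : ∀ c : Fin N, (if (i : ℕ) ≤ g i + (Fin.revPerm c : Fin N) then
      hFin (firstVars N k) (g i + (Fin.revPerm c : Fin N) - i) else 0) *
      (omitPoly (firstVars N k) (k, (j : ℕ))).coeff (N - 1 - (Fin.revPerm c : Fin N)) =
      (fun c : ℕ => if c < g i + (N - 1 - i) + 1 then
        hFin (firstVars N k) (g i + (N - 1 - i) - c) *
        (omitPoly (firstVars N k) (k, (j : ℕ))).coeff c else 0) c := by
    intro c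
    have hi := i.2
    have hc := c.2
    have e1 : ((Fin.revPerm c : Fin N) : ℕ) = N - 1 - c := by
      rw [Fin.revPerm_apply, Fin.val_rev]
      omega
    have e2 : N - 1 - (N - 1 - (c : ℕ)) = c := by omega
    have e3 : g i + (N - 1 - c) - i = g i + (N - 1 - i) - c := by omega
    simp only [e1, e2, e3, ite_mul, zero_mul]
    exact if_congr (by omega) rfl rfl
  rw [Finset.sum_congr rfl fun c _ => h1 c, Fin.sum_univ_eq_sum_range (fun c : ℕ =>
    if c < g i + (N - 1 - i) + 1 then hFin (firstVars N k) (g i + (N - 1 - i) - c) *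
        (omitPoly (firstVars N k) (k, (j : ℕ))).coeff c else 0), ← Finset.sum_filter]
  refine Finset.sum_subset (fun c hc => ?_) fun c hc hc' => ?_
  · exact Finset.mem_range.2 (Finset.mem_filter.1 hc).2
  -- `omitPoly` has degree less than `N`, so the terms with `c ≥ N` missing from the matrix product
  -- vanish.
  · rw [Polynomial.coeff_eq_zero_of_natDegree_lt, mul_zero]
    refine lt_of_lt_of_le (natDegree_omitPoly_lt hy) ?_
    by_contra h
    rw [hcard] at h
    exact hc' (Finset.mem_filter.2 ⟨Finset.mem_range.2 (not_le.1 h), Finset.mem_range.1 hc⟩)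

theorem det_jtFin_zero (S : Finset (Fin r × ℕ)) (N : ℕ) : (jtFin S N 0).det = 1 := by
  rw [Matrix.det_of_isUpperTriangular]
  · simp [jtFin, hFin_zero]
  · intro i j hij
    have : ¬ (i : ℕ) ≤ j := not_le.2 hij
    simp only [jtFin, Matrix.of_apply, Pi.zero_apply, zero_add, if_neg this]

/-- The bialternant formula. -/
theorem det_alternant (N : ℕ) (k : Fin r) (g : ℕ → ℕ) :
    (alternant N k g).det = (jtFin (firstVars N k) N g).det * (alternant N k 0).det := by
  -- The second factor in `jtFin_mul` does not depend on `g`; taking `g = 0` identifies its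
  -- determinant with the Vandermonde determinant.
  rw [← jtFin_mul N k g, ← jtFin_mul N k 0, Matrix.det_mul, Matrix.det_mul, det_jtFin_zero,
    one_mul]

/-- A row beyond the last part has `1` on the diagonal and zeros to its left, so expansion along the
last row removes it. -/
theorem det_jtEntry_eq (k : Fin r) (μ : YoungDiagram) {N : ℕ} (hN : μ.colLen 0 ≤ N) :
    Matrix.det (Matrix.of fun i j : Fin (μ.colLen 0) => jtEntry k μ i j) =
      Matrix.det (Matrix.of fun i j : Fin N => jtEntry k μ i j) := by
  induction N, hN using Nat.le_induction with
  | base => rfl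
  | succ N hN ih =>
    rw [ih, Matrix.det_succ_row _ (Fin.last N), Finset.sum_eq_single (Fin.last N)]
    · have h1 : jtEntry k μ N N = 1 := by
        simp [jtEntry, rowLen_eq_zero hN, hFn_zero]
      rw [Matrix.of_apply, Fin.val_last, h1, ← two_mul, pow_mul, neg_one_sq, one_pow, one_mul,
        one_mul]
      congr 1
      ext1 i j
      simp [Fin.succAbove_last]
    · intro j _ hj
      have h1 : (j : ℕ) < N := lt_of_le_of_ne (Nat.lt_succ_iff.1 j.2) fun h => hj (Fin.ext h)
      have h2 : jtEntry k μ N j = 0 := by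
        simp [jtEntry, rowLen_eq_zero hN, h1]
      rw [Matrix.of_apply, Fin.val_last, h2]
      simp
    · simp

/-- The power series without monomials in the first `N` variables of each family. -/
def highIdeal (r N : ℕ) : Ideal (PS r) where
  carrier := {f | ∀ ν, (∀ x, N ≤ x.2 → ν x = 0) → MvPowerSeries.coeff ν f = 0}
  zero_mem' := fun ν _ => by simp
  add_mem' := fun {f g} hf hg ν hν => by rw [map_add, hf ν hν, hg ν hν, add_zero]
  smul_mem' := fun f g hg ν hν => by
    classical
    rw [smul_eq_mul, MvPowerSeries.coeff_mul]
    refine Finset.sum_eq_zero fun p hp => ?_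
    rw [hg, mul_zero]
    intro x hx
    have := hν x hx
    rw [← Finset.HasAntidiagonal.mem_antidiagonal.1 hp, Finsupp.add_apply] at this
    omega

theorem coeff_eq_of_mk_eq {N : ℕ} {f g : PS r}
    (h : Ideal.Quotient.mk (highIdeal r N) f = Ideal.Quotient.mk _ g)
    {ν : Fin r × ℕ →₀ ℕ} (hν : ∀ x, N ≤ x.2 → ν x = 0) :
    MvPowerSeries.coeff ν f = MvPowerSeries.coeff ν g := by
  rw [Ideal.Quotient.eq] at h
  have := h ν hν
  rwa [map_sub, sub_eq_zero] at this

theorem mk_hFn_eq (N : ℕ) (k : Fin r) (a : ℕ) :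
    Ideal.Quotient.mk (highIdeal r N) (hFn k a) =
      Ideal.Quotient.mk _ (hFin (firstVars N k) a) := by
  classical
  rw [Ideal.Quotient.eq]
  intro ν hν
  rw [map_sub, coeff_hFn, coeff_hFin, sub_eq_zero]
  refine if_congr (and_congr_left fun _ => ⟨fun h x hx => ?_, fun h x hx => ?_⟩) rfl rfl
  · rw [Finsupp.mem_support_iff] at hx
    have h1 : x.1 = k := by
      by_contra h'
      exact hx (h x h')
    have h2 : x.2 < N := by
      by_contra h'
      exact hx (hν x (not_lt.1 h'))
    simp only [firstVars, Finset.mem_map, Finset.mem_range]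
    exact ⟨x.2, h2, Prod.ext h1.symm rfl⟩
  · by_contra h0
    have := h (Finsupp.mem_support_iff.2 h0)
    simp only [firstVars, Finset.mem_map, Finset.mem_range] at this
    obtain ⟨i, _, rfl⟩ := this
    exact hx rfl

/-- The bialternant formula needs finitely many variables. Working modulo the series without
monomials in the first `N` variables of each family is enough, since only coefficients at such
monomials are read off later. -/
theorem mk_alternant_mul_sFn {N : ℕ} {lam : Fin r → YoungDiagram}
    (hN : ∀ k, (lam k).colLen 0 ≤ N) :
    Ideal.Quotient.mk (highIdeal r N) ((∏ k, (alternant N k 0).det) * sFn lam) =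
      Ideal.Quotient.mk _ (∏ k, (alternant N k (lam k).rowLen).det) := by
  rw [sFn, ← Finset.prod_mul_distrib, map_prod, map_prod]
  refine Finset.prod_congr rfl fun k _ => ?_
  have h : Ideal.Quotient.mk (highIdeal r N)
      (Matrix.det (Matrix.of fun i j : Fin N => jtEntry k (lam k) i j)) =
      Ideal.Quotient.mk _ (jtFin (firstVars N k) N (lam k).rowLen).det := by
    rw [RingHom.map_det, RingHom.map_det]
    congr 1
    ext1 i j
    simp only [RingHom.mapMatrix_apply, Matrix.map_apply, Matrix.of_apply, jtEntry, jtFin]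
    split_ifs
    · exact mk_hFn_eq N k _
    · rfl
  rw [det_alternant N k (lam k).rowLen, det_jtEntry_eq k (lam k) (hN k), map_mul, map_mul, h,
    mul_comm]

end Bialternant

/-! ### The transition matrix between Schur functions and monomial symmetric functions -/

section Transition

variable {r : ℕ}

/-- The exponent with the value `g k i` at the variable `x^{(k)}_i`, for `i < N`. -/
noncomputable def finExp (N : ℕ) (g : Fin r → Fin N → ℕ) : Fin r × ℕ →₀ ℕ :=
  Finsupp.onFinset (Finset.univ ×ˢ Finset.range N)
    (fun x => if h : x.2 < N then g x.1 ⟨x.2, h⟩ else 0) (by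
      rintro ⟨k, i⟩ h
      simp only [Finset.mem_product, Finset.mem_univ, true_and, Finset.mem_range]
      by_contra h'
      exact h (dif_neg h'))

theorem finExp_apply (N : ℕ) (g : Fin r → Fin N → ℕ) (x : Fin r × ℕ) :
    finExp N g x = if h : x.2 < N then g x.1 ⟨x.2, h⟩ else 0 := rfl

@[simp] theorem finExp_apply_fin (N : ℕ) (g : Fin r → Fin N → ℕ) (k : Fin r) (i : Fin N) :
    finExp N g (k, (i : ℕ)) = g k i := by
  rw [finExp_apply, dif_pos i.2]

theorem finExp_eq_zero (N : ℕ) (g : Fin r → Fin N → ℕ) (x : Fin r × ℕ) (hx : N ≤ x.2) :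
    finExp N g x = 0 := by
  rw [finExp_apply, dif_neg (not_lt.2 hx)]

theorem finExp_prod {M : Type*} [CommMonoid M] (N : ℕ) (g : Fin r → Fin N → ℕ)
    (f : Fin r × ℕ → ℕ → M) (hf : ∀ x, f x 0 = 1) :
    (finExp N g).prod f = ∏ k, ∏ i : Fin N, f (k, (i : ℕ)) (g k i) := by
  rw [Finsupp.prod_of_support_subset (s := Finset.univ ×ˢ Finset.range N) (finExp N g)
    Finsupp.support_onFinset_subset f fun x _ => hf x, Finset.prod_product]
  refine Finset.prod_congr rfl fun k _ => ?_
  rw [Finset.prod_range]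
  simp

theorem finExp_degree (N : ℕ) (g : Fin r → Fin N → ℕ) :
    (finExp N g).degree = ∑ k, ∑ i, g k i :=
  finExp_prod (M := Multiplicative ℕ) N g (fun _ a => Multiplicative.ofAdd a) fun _ => rfl

theorem finExp_inj {N : ℕ} {g g' : Fin r → Fin N → ℕ} : finExp N g = finExp N g' ↔ g = g' := by
  refine ⟨fun h => ?_, fun h => h ▸ rfl⟩
  funext k i
  rw [← finExp_apply_fin N g, h, finExp_apply_fin]

theorem finExp_rowLen {N : ℕ} {lam : Fin r → YoungDiagram} (hN : ∀ k, (lam k).colLen 0 ≤ N) :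
    finExp N (fun k i => (lam k).rowLen i) = expo lam := by
  ext x
  rw [finExp_apply, expo_apply]
  split_ifs with h
  · rfl
  · exact (rowLen_eq_zero ((hN _).trans (not_lt.1 h))).symm

theorem finExp_le_finExp {N : ℕ} {g g' : Fin r → Fin N → ℕ} :
    finExp N g ≤ finExp N g' ↔ ∀ k i, g k i ≤ g' k i := by
  constructor
  · intro h k i
    simpa using h (k, (i : ℕ))
  · intro h x
    rw [finExp_apply, finExp_apply]
    split_ifs
    · exact h _ _
    · exact le_rfl

theorem finExp_sub_finExp {N : ℕ} (g g' : Fin r → Fin N → ℕ) :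
    finExp N g - finExp N g' = finExp N fun k i => g k i - g' k i := by
  ext x
  simp only [Finsupp.tsub_apply, finExp_apply]
  split_ifs <;> rfl

/-- The sign of a family of permutations. -/
def famSign {N : ℕ} (w : Fin r → Equiv.Perm (Fin N)) : ℤ := ∏ k, (Equiv.Perm.sign (w k) : ℤ)

theorem prod_det_alternant (N : ℕ) (g : Fin r → ℕ → ℕ) :
    ∏ k, (alternant N k (g k)).det = ∑ w : Fin r → Equiv.Perm (Fin N), (famSign w : PS r) *
      MvPowerSeries.monomial (finExp N fun k i => g k (w k i) + (N - 1 - (w k i : ℕ))) 1 := by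
  simp only [Matrix.det_apply']
  rw [Finset.prod_univ_sum, Fintype.piFinset_univ]
  refine Finset.sum_congr rfl fun w _ => ?_
  rw [Finset.prod_mul_distrib, famSign, Int.cast_prod, MvPowerSeries.monomial_eq',
    finExp_prod _ _ _ fun _ => pow_zero _]
  simp [alternant]

theorem prod_det_jtEntry (N : ℕ) (lam : Fin r → YoungDiagram) :
    ∏ k, Matrix.det (Matrix.of fun i j : Fin N => jtEntry k (lam k) i j) =
      ∑ w : Fin r → Equiv.Perm (Fin N), (famSign w : PS r) *
        ∏ k, ∏ i : Fin N, jtEntry k (lam k) i (w k i) := by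
  have h : ∀ k, Matrix.det (Matrix.of fun i j : Fin N => jtEntry k (lam k) i j) =
      ∑ w : Equiv.Perm (Fin N), ((Equiv.Perm.sign w : ℤ) : PS r) *
        ∏ i : Fin N, jtEntry k (lam k) i (w i) := by
    intro k
    rw [← Matrix.det_transpose, Matrix.det_apply']
    rfl
  simp only [h]
  rw [Finset.prod_univ_sum, Fintype.piFinset_univ]
  refine Finset.sum_congr rfl fun w _ => ?_
  rw [Finset.prod_mul_distrib, famSign, Int.cast_prod]

/-- All the entries `lam_i - i + w (i)` are non-negative. -/
def JTNonneg {N : ℕ} (lam : Fin r → YoungDiagram) (w : Fin r → Equiv.Perm (Fin N)) : Prop :=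
  ∀ k (i : Fin N), (i : ℕ) ≤ (lam k).rowLen i + w k i

/-- The exponent with the entries `lam_i - i + w (i)`. -/
noncomputable def jtExp {N : ℕ} (lam : Fin r → YoungDiagram) (w : Fin r → Equiv.Perm (Fin N)) :
    Fin r × ℕ →₀ ℕ :=
  finExp N fun k i => (lam k).rowLen i + w k i - i

/-- The exponent `lam_i + N - 1 - i`. -/
noncomputable def deltaExp (N : ℕ) (lam : Fin r → YoungDiagram) : Fin r × ℕ →₀ ℕ :=
  finExp N fun k i => (lam k).rowLen i + (N - 1 - (i : ℕ))

theorem colLen_le {n : ℕ} (lam : RPartition r n) (k : Fin r) : (lam.1 k).colLen 0 ≤ n := by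
  refine le_trans ?_ (le_trans (Finset.single_le_sum (f := fun k => (lam.1 k).card)
        (fun _ _ => Nat.zero_le _) (Finset.mem_univ k)) lam.2.le)
  rw [YoungDiagram.colLen_eq_card]
  exact Finset.card_le_card (Finset.filter_subset _ _)

open Classical in
-- The Vandermonde product is the signed sum of the monomials `x^{w δ}`, and `λ + δ - w δ` has the
-- entries `λ_i - i + w(i)`, the degrees occurring in the Jacobi-Trudi expansion.
theorem coeff_alternant_mul (N : ℕ) (lam : Fin r → YoungDiagram) (F : PS r) :
    MvPowerSeries.coeff (deltaExp N lam) ((∏ k, (alternant N k 0).det) * F) =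
      ∑ w : Fin r → Equiv.Perm (Fin N), (famSign w : ParamField r) *
        if JTNonneg lam w then MvPowerSeries.coeff (jtExp lam w) F else 0 := by
  rw [prod_det_alternant N (fun _ => 0), Finset.sum_mul, map_sum]
  refine Finset.sum_congr rfl fun w _ => ?_
  rw [mul_assoc, ← zsmul_eq_mul, ← Int.cast_smul_eq_zsmul (ParamField r), map_smul, smul_eq_mul,
    MvPowerSeries.coeff_monomial_mul]
  congr 1
  rw [deltaExp, finExp_sub_finExp, one_mul, jtExp]
  have h1 : ∀ k (i : Fin N), (N - 1 - (w k i : ℕ) ≤ (lam k).rowLen i + (N - 1 - (i : ℕ)) ↔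
      (i : ℕ) ≤ (lam k).rowLen i + w k i) ∧ (lam k).rowLen i + (N - 1 - (i : ℕ)) -
        (N - 1 - (w k i : ℕ)) = (lam k).rowLen i + w k i - i := by
    intro k i
    have h1 := i.2
    have h2 := (w k i).2
    omega
  simp only [Pi.zero_apply, zero_add, h1]
  refine if_congr ?_ rfl rfl
  rw [finExp_le_finExp]
  exact forall_congr' fun k => forall_congr' fun i => (h1 k i).1

theorem coeff_alternant_mul_sFn {n N : ℕ} [DecidableEq (RPartition r n)]
    (lam mu : RPartition r n) (hN : n ≤ N) :
    MvPowerSeries.coeff (deltaExp N lam.1) ((∏ k, (alternant N k 0).det) * sFn mu.1) =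
      if lam = mu then 1 else 0 := by
  have hcol : ∀ (lam : RPartition r n) k, (lam.1 k).colLen 0 ≤ N :=
    fun lam k => (colLen_le lam k).trans hN
  rw [coeff_eq_of_mk_eq (ν := deltaExp N lam.1) (mk_alternant_mul_sFn (hcol mu))
    (finExp_eq_zero _ _), prod_det_alternant,
    map_sum]
  have hanti : ∀ (lam : RPartition r n) k,
      StrictAnti fun i : Fin N => (lam.1 k).rowLen i + (N - 1 - (i : ℕ)) := by
    intro lam k i j hij
    have h1 := (lam.1 k).rowLen_anti i j hij.le
    have h2 : (i : ℕ) < j := hij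
    have h3 := j.2
    simp only
    omega
  have hcoeff : ∀ w : Fin r → Equiv.Perm (Fin N), MvPowerSeries.coeff (deltaExp N lam.1)
      ((famSign w : PS r) * MvPowerSeries.monomial
        (finExp N fun k i => (mu.1 k).rowLen (w k i) + (N - 1 - (w k i : ℕ))) 1) =
      if w = 1 ∧ lam = mu then 1 else 0 := by
    classical
    intro w
    rw [← zsmul_eq_mul, ← Int.cast_smul_eq_zsmul (ParamField r), map_smul, smul_eq_mul,
      MvPowerSeries.coeff_monomial, deltaExp]
    by_cases h : (fun k (i : Fin N) => (lam.1 k).rowLen i + (N - 1 - (i : ℕ))) =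
        fun k i => (mu.1 k).rowLen (w k i) + (N - 1 - (w k i : ℕ))
    -- Both exponents `λ + δ` and `μ + δ` are strictly decreasing, so `w k` is increasing, hence the
    -- identity.
    · have hw : w = 1 := by
        funext k
        refine Equiv.ext (congrFun ((StrictMono.range_inj (f := w k) (g := id) ?_
          strictMono_id).1 (by simp)))
        intro i j hij
        have h1 := hanti lam k hij
        have h2 := congrFun (congrFun h k) i
        have h3 := congrFun (congrFun h k) j
        simp only at h1 h2 h3
        rw [h2, h3] at h1
        exact (hanti mu k).lt_iff_gt.1 h1
      subst hw
      have hlm : lam = mu := by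
        refine Subtype.ext (funext fun k => youngDiagram_ext_rowLen fun i => ?_)
        by_cases hi : i < N
        · exact Nat.add_right_cancel (congrFun (congrFun h k) ⟨i, hi⟩)
        · rw [rowLen_eq_zero ((hcol lam k).trans (not_lt.1 hi)),
            rowLen_eq_zero ((hcol mu k).trans (not_lt.1 hi))]
      rw [if_pos (finExp_inj.2 h), if_pos ⟨rfl, hlm⟩]
      simp [famSign]
    · rw [if_neg fun h' => h (finExp_inj.1 h'), if_neg, mul_zero]
      rintro ⟨rfl, rfl⟩
      exact h rfl
  simp only [hcoeff]
  split_ifs with h <;> simp [h]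

open Classical in
/-- The coefficient of `s_lam` in the monomial symmetric function `m_mu`, and of `h_mu` in
`s_lam`. -/
noncomputable def transition (r n : ℕ) : Matrix (RPartition r n) (RPartition r n) ℤ :=
  Matrix.of fun lam mu => ∑ w : Fin r → Equiv.Perm (Fin n),
    famSign w * if JTNonneg lam.1 w ∧ IsRearr (jtExp lam.1 w) mu.1 then 1 else 0

theorem coeff_alternant_mul_mFn {n : ℕ} (lam mu : RPartition r n) :
    MvPowerSeries.coeff (deltaExp n lam.1) ((∏ k, (alternant n k 0).det) * mFn mu.1) =
      (transition r n lam mu : ParamField r) := by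
  classical
  rw [coeff_alternant_mul, transition, Matrix.of_apply, Int.cast_sum]
  refine Finset.sum_congr rfl fun w _ => ?_
  rw [coeff_mFn, Int.cast_mul, ← ite_and]
  simp

theorem jtExp_degree {n : ℕ} {lam : RPartition r n} {w : Fin r → Equiv.Perm (Fin n)}
    (h : JTNonneg lam.1 w) : (jtExp lam.1 w).degree = n := by
  rw [jtExp, finExp_degree]
  have h1 : ∀ k, ∑ i : Fin n, ((lam.1 k).rowLen i + w k i - i) = (lam.1 k).card := by
    intro k
    rw [Finset.sum_tsub_distrib _ fun i _ => h k i, Finset.sum_add_distrib,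
      Equiv.sum_comp (w k) fun i : Fin n => (i : ℕ), Nat.add_sub_cancel,
      Fin.sum_univ_eq_sum_range, ← sum_rowLen]
    refine (Finset.sum_subset (Finset.range_subset_range.2 (colLen_le lam k)) ?_).symm
    intro i _ hi
    exact rowLen_eq_zero (not_lt.1 fun h => hi (Finset.mem_range.2 h))
  simp only [h1, lam.2]

/-- The expansion of Schur functions in products of complete symmetric functions. -/
theorem sFn_eq_sum_hProd {n : ℕ} (lam : RPartition r n) :
    sFn lam.1 = ∑ mu, (transition r n lam mu : ParamField r) • hProd (expo mu.1) := by
  classical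
  have h1 : sFn lam.1 = ∏ k, Matrix.det (Matrix.of fun i j : Fin n => jtEntry k (lam.1 k) i j) :=
    Finset.prod_congr rfl fun k _ => det_jtEntry_eq k (lam.1 k) (colLen_le lam k)
  have h2 : ∀ w : Fin r → Equiv.Perm (Fin n), ∏ k, ∏ i : Fin n, jtEntry k (lam.1 k) i (w k i) =
      ∑ mu : RPartition r n, (if JTNonneg lam.1 w ∧ IsRearr (jtExp lam.1 w) mu.1
        then (1 : ParamField r) else 0) • hProd (expo mu.1) := by
    intro w
    by_cases h : JTNonneg lam.1 w
    · have e1 : ∏ k, ∏ i : Fin n, jtEntry k (lam.1 k) i (w k i) = hProd (jtExp lam.1 w) := by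
        rw [hProd, jtExp, finExp_prod _ _ _ fun x => hFn_zero x.1]
        refine Finset.prod_congr rfl fun k _ => Finset.prod_congr rfl fun i _ => ?_
        rw [jtEntry, if_pos (h k i)]
      obtain ⟨mu, hmu⟩ := exists_isRearr (jtExp lam.1 w)
      have hn : ∑ k, (mu k).card = n := hmu.degree_eq ▸ jtExp_degree h
      rw [e1, hmu.hProd_eq, Finset.sum_eq_single (⟨mu, hn⟩ : RPartition r n)]
      · rw [if_pos ⟨h, hmu⟩, one_smul]
      · intro mu' _ hne
        rw [if_neg fun h' => hne (Subtype.ext (h'.2.unique hmu)), zero_smul]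
      · simp
    · simp only [h, false_and, if_false, zero_smul, Finset.sum_const_zero]
      simp only [JTNonneg, not_forall] at h
      obtain ⟨k, i, hi⟩ := h
      refine Finset.prod_eq_zero (Finset.mem_univ k) (Finset.prod_eq_zero (Finset.mem_univ i) ?_)
      rw [jtEntry, if_neg hi]
  rw [h1, prod_det_jtEntry]
  simp only [h2, Finset.mul_sum]
  rw [Finset.sum_comm]
  refine Finset.sum_congr rfl fun mu _ => ?_
  rw [transition, Matrix.of_apply, Int.cast_sum, Finset.sum_smul]
  refine Finset.sum_congr rfl fun w _ => ?_
  rw [← zsmul_eq_mul, ← Int.cast_smul_eq_zsmul (ParamField r), smul_smul, Int.cast_mul]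
  simp

theorem sum_le_sum_range_card {f : ℕ → ℕ} (hf : Antitone f) (S : Finset ℕ) :
    ∑ i ∈ S, f i ≤ ∑ i ∈ Finset.range S.card, f i := by
  induction S using Finset.induction_on_max with
  | empty => simp
  | insert a S ha ih =>
    have hnot : a ∉ S := fun h => lt_irrefl _ (ha a h)
    rw [Finset.sum_insert hnot, Finset.card_insert_of_notMem hnot, Finset.sum_range_succ, add_comm]
    refine Nat.add_le_add ih (hf ?_)
    have := Finset.card_le_card (fun i hi => Finset.mem_range.2 (ha i hi) : S ⊆ Finset.range a)
    simpa using this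

theorem sum_range_card_le_sum {f : ℕ → ℕ} (hf : Monotone f) (S : Finset ℕ) :
    ∑ i ∈ Finset.range S.card, f i ≤ ∑ i ∈ S, f i := by
  induction S using Finset.induction_on_max with
  | empty => simp
  | insert a S ha ih =>
    have hnot : a ∉ S := fun h => lt_irrefl _ (ha a h)
    rw [Finset.sum_insert hnot, Finset.card_insert_of_notMem hnot, Finset.sum_range_succ, add_comm]
    refine Nat.add_le_add (hf ?_) ih
    have := Finset.card_le_card (fun i hi => Finset.mem_range.2 (ha i hi) : S ⊆ Finset.range a)
    simpa using this

/-- The parts of `mu` are the numbers `lam_i - i + w(i)` in decreasing order, so any `p` of these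
sum to at most the first `p` parts. -/
theorem partial_sums_of_isRearr {n : ℕ} {lam mu : RPartition r n}
    {w : Fin r → Equiv.Perm (Fin n)} (h : JTNonneg lam.1 w)
    (h' : IsRearr (jtExp lam.1 w) mu.1) (k : Fin r) {p : ℕ} (hp : p ≤ n) :
    ∑ i : Fin p, (lam.1 k).rowLen i + ∑ i : Fin p, (w k (Fin.castLE hp i) : ℕ) ≤
      ∑ i : Fin p, (mu.1 k).rowLen i + ∑ i : Fin p, (i : ℕ) := by
  obtain ⟨σ, hσ⟩ := h'
  have h1 : ∑ i : Fin p, (jtExp lam.1 w (k, (i : ℕ))) ≤ ∑ i : Fin p, (mu.1 k).rowLen i := by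
    rw [Fin.sum_univ_eq_sum_range (fun i => jtExp lam.1 w (k, i)),
      Fin.sum_univ_eq_sum_range (fun i => (mu.1 k).rowLen i)]
    have h2 := sum_le_sum_range_card (f := (mu.1 k).rowLen) (fun i j hij =>
      (mu.1 k).rowLen_anti i j hij) ((Finset.range p).map (σ k).symm.toEmbedding)
    rw [Finset.card_map, Finset.card_range, Finset.sum_map] at h2
    refine le_of_eq_of_le (Finset.sum_congr rfl fun i _ => ?_) h2
    rw [← hσ]
    simp
  have h2 : ∀ i : Fin p, jtExp lam.1 w (k, (i : ℕ)) + i =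
      (lam.1 k).rowLen i + w k (Fin.castLE hp i) := by
    intro i
    have e1 := finExp_apply_fin n (fun k i => (lam.1 k).rowLen i + w k i - i) k (Fin.castLE hp i)
    have e2 := h k (Fin.castLE hp i)
    simp only [Fin.val_castLE] at e1 e2
    rw [jtExp, e1]
    omega
  rw [← Finset.sum_add_distrib, ← Finset.sum_congr rfl fun i _ => h2 i, Finset.sum_add_distrib]
  exact Nat.add_le_add_right h1 _

theorem sum_val_le_sum_perm {n p : ℕ} (hp : p ≤ n) (w : Equiv.Perm (Fin n)) :
    ∑ i : Fin p, (i : ℕ) ≤ ∑ i : Fin p, (w (Fin.castLE hp i) : ℕ) := by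
  have h := sum_range_card_le_sum (f := id) monotone_id ((Finset.univ : Finset (Fin p)).map
    ⟨fun i => (w (Fin.castLE hp i) : ℕ), fun i j hij =>
      Fin.castLE_injective hp (w.injective (Fin.ext hij))⟩)
  rw [Finset.card_map, Finset.card_univ, Fintype.card_fin, Finset.sum_map] at h
  rw [Fin.sum_univ_eq_sum_range (fun i => i)]
  exact h

/-- The transition matrix is triangular with respect to the dominance order. -/
theorem partial_sums_le_of_transition_ne_zero {n : ℕ} {lam mu : RPartition r n}
    (h : transition r n lam mu ≠ 0) (k : Fin r) (p : ℕ) :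
    ∑ i ∈ Finset.range p, (lam.1 k).rowLen i ≤ ∑ i ∈ Finset.range p, (mu.1 k).rowLen i := by
  classical
  rw [transition, Matrix.of_apply] at h
  obtain ⟨w, _, hw⟩ := Finset.exists_ne_zero_of_sum_ne_zero h
  obtain ⟨h1, h2⟩ : JTNonneg lam.1 w ∧ IsRearr (jtExp lam.1 w) mu.1 := by
    by_contra h'
    simp [h'] at hw
  have key : ∀ p ≤ n,
      ∑ i ∈ Finset.range p, (lam.1 k).rowLen i ≤ ∑ i ∈ Finset.range p, (mu.1 k).rowLen i := by
    intro p hp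
    have h3 := partial_sums_of_isRearr h1 h2 k hp
    -- Any `p` distinct values sum to at least `0 + ⋯ + (p - 1)`, so the terms `w(i)` and `i` can be
    -- dropped from `h3`.
    have h4 := sum_val_le_sum_perm hp (w k)
    rw [Finset.sum_range, Finset.sum_range]
    omega
  rcases le_total p n with hp | hp
  · exact key p hp
  · rw [← Finset.sum_subset (Finset.range_subset_range.2 hp)
      (f := fun i => (lam.1 k).rowLen i)]
    · exact (key n le_rfl).trans (Finset.sum_le_sum_of_subset (Finset.range_subset_range.2 hp))
    · intro i _ hi
      exact rowLen_eq_zero ((colLen_le lam k).trans (not_lt.1 fun h => hi (Finset.mem_range.2 h)))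

/-- For `mu = lam` the inequalities behind dominance become equalities, so `w` has the partial sums
of the identity and is the identity. -/
theorem transition_self {n : ℕ} (lam : RPartition r n) : transition r n lam lam = 1 := by
  classical
  rw [transition, Matrix.of_apply, Finset.sum_eq_single 1]
  · have h1 : JTNonneg lam.1 (1 : Fin r → Equiv.Perm (Fin n)) := fun k i => by simp
    have h2 : jtExp lam.1 (1 : Fin r → Equiv.Perm (Fin n)) = expo lam.1 := by
      rw [jtExp, ← finExp_rowLen (colLen_le lam)]
      simp
    rw [if_pos ⟨h1, h2 ▸ isRearr_expo _⟩]
    simp [famSign]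
  · intro w _ hw
    rw [if_neg, mul_zero]
    rintro ⟨h1, h2⟩
    apply hw
    funext k
    have key : ∀ (p : ℕ) (hp : p ≤ n), ∑ i : Fin p, (w k (Fin.castLE hp i) : ℕ) =
        ∑ i : Fin p, (i : ℕ) := by
      intro p hp
      have h3 := partial_sums_of_isRearr h1 h2 k hp
      have h4 := sum_val_le_sum_perm hp (w k)
      omega
    refine Equiv.ext fun i => Fin.ext ?_
    have h3 := key i i.2.le
    have h4 := key (i + 1) i.2
    rw [Fin.sum_univ_castSucc, Fin.sum_univ_castSucc] at h4
    simp only [Fin.val_castSucc, Fin.val_last] at h4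
    have h5 : ∑ j : Fin i, (w k (Fin.castLE i.2 j.castSucc) : ℕ) =
        ∑ j : Fin i, (w k (Fin.castLE i.2.le j) : ℕ) := rfl
    rw [h5, h3] at h4
    exact Nat.add_left_cancel h4
  · simp

end Transition

/-! ### The basis of Schur functions -/

section SchurBasis

variable {r : ℕ}

/-- The coefficients of a symmetric function in the basis of Schur functions. -/
noncomputable def schurCoeffs (r n : ℕ) :
    symFn r n →ₗ[ParamField r] (RPartition r n → ParamField r) where
  toFun F lam := MvPowerSeries.coeff (deltaExp n lam.1) ((∏ k, (alternant n k 0).det) * (F : PS r))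
  map_add' F G := by
    ext
    simp [mul_add]
  map_smul' c F := by
    ext
    simp

theorem schurCoeffs_sFn {n : ℕ} [DecidableEq (RPartition r n)] (mu : RPartition r n) :
    schurCoeffs r n ⟨sFn mu.1, sFn_mem mu⟩ = Pi.single mu 1 := by
  funext lam
  rw [Pi.single_apply]
  exact coeff_alternant_mul_sFn lam mu le_rfl

theorem schurCoeffs_mFn {n : ℕ} (lam mu : RPartition r n) :
    schurCoeffs r n ⟨mFn mu.1, mFn_mem mu⟩ lam = transition r n lam mu :=
  coeff_alternant_mul_mFn lam mu

/-- The Schur functions map to the unit vectors, which gives surjectivity; the monomial basis shows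
that the dimensions agree. -/
theorem schurCoeffs_bijective (r n : ℕ) : Function.Bijective (schurCoeffs r n) := by
  classical
  have hfin : FiniteDimensional (ParamField r) (symFn r n) :=
    (monomialCoeffs r n).symm.finiteDimensional
  have hsurj : Function.Surjective (schurCoeffs r n) := by
    intro c
    refine ⟨∑ mu, c mu • ⟨sFn mu.1, sFn_mem mu⟩, ?_⟩
    rw [map_sum]
    simp only [map_smul, schurCoeffs_sFn]
    funext lam
    simp [Finset.sum_apply, Pi.single_apply]
  refine ⟨?_, hsurj⟩
  exact (LinearMap.injective_iff_surjective_of_finrank_eq_finrank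
    (monomialCoeffs r n).finrank_eq).2 hsurj

/-- The basis of Schur functions of the space of symmetric functions of degree `n`. -/
noncomputable def schurBasis (r n : ℕ) :
    Module.Basis (RPartition r n) (ParamField r) (symFn r n) :=
  Module.Basis.ofEquivFun (LinearEquiv.ofBijective (schurCoeffs r n) (schurCoeffs_bijective r n))

@[simp] theorem schurBasis_apply {n : ℕ} (lam : RPartition r n) :
    schurBasis r n lam = ⟨sFn lam.1, sFn_mem lam⟩ := by
  classical
  rw [schurBasis, Module.Basis.coe_ofEquivFun, LinearEquiv.symm_apply_eq]
  exact (schurCoeffs_sFn lam).symm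

theorem mFn_eq_sum_sFn {n : ℕ} (mu : RPartition r n) :
    (⟨mFn mu.1, mFn_mem mu⟩ : symFn r n) =
      ∑ lam : RPartition r n,
        (transition r n lam mu : ParamField r) • ⟨sFn lam.1, sFn_mem lam⟩ := by
  rw [← (schurBasis r n).sum_equivFun ⟨mFn mu.1, mFn_mem mu⟩]
  refine Finset.sum_congr rfl fun lam _ => ?_
  rw [schurBasis_apply, schurBasis, Module.Basis.equivFun_ofEquivFun, LinearEquiv.ofBijective_apply,
    schurCoeffs_mFn]

/-- The transition matrix with coefficients in a ring. -/
noncomputable def transitionIn (R : Type*) [Ring R] (r n : ℕ) :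
    Matrix (RPartition r n) (RPartition r n) R :=
  (transition r n).map (Int.castRingHom R)

theorem map_transitionIn {R R' : Type*} [Ring R] [Ring R'] (φ : R →+* R') (n : ℕ) :
    (transitionIn R r n).map φ = transitionIn R' r n := by
  ext lam mu
  simp [transitionIn]

variable [NeZero r]

/-- The coefficients of the functions `q^±` in the basis of monomial symmetric functions, with
parameters in an arbitrary ring. -/
noncomputable def qMatrix {R : Type*} [CommRing R] (ε : Sign) (t : Fin r → R) (n : ℕ) :
    Matrix (RPartition r n) (RPartition r n) R :=
  Matrix.of fun lam mu => kerMatrix ε t (expo lam.1) (expo mu.1)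

theorem qMatrix_minus {R : Type*} [CommRing R] (t : Fin r → R) (n : ℕ) :
    qMatrix .minus t n = (qMatrix .plus t n).transpose := by
  ext lam mu
  exact (kerMatrix_plus_eq_minus t _ _).symm

theorem map_qMatrix {R R' : Type*} [CommRing R] [CommRing R'] (φ : R →+* R') (ε : Sign)
    (t : Fin r → R) (n : ℕ) : (qMatrix ε t n).map φ = qMatrix ε (fun k => φ (t k)) n := by
  ext lam mu
  exact map_kerMatrix φ ε t _ _

theorem qFn_eq_sum_mFn (ε : Sign) {n : ℕ} (lam : RPartition r n) :
    (⟨qFn ε lam.1, qFn_mem ε lam⟩ : symFn r n) =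
      ∑ mu : RPartition r n, qMatrix ε tvar n lam mu • ⟨mFn mu.1, mFn_mem mu⟩ := by
  refine Subtype.ext ?_
  rw [Submodule.coe_sum]
  refine (eq_sum_mFn (qFn_mem ε lam)).trans (Finset.sum_congr rfl fun mu _ => ?_)
  rw [coeff_qFn]
  rfl

/-- The orthonormality of the Schur functions for `t = 0`, over the field of parameters. -/
theorem transitionIn_mul_qMatrix_zero_paramField (n : ℕ) [DecidableEq (RPartition r n)] :
    transitionIn (ParamField r) r n * qMatrix .plus (0 : Fin r → ParamField r) n *
      (transitionIn (ParamField r) r n).transpose = 1 := by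
  ext lam nu
  -- The three factors are changes of basis: Schur to `h` by Jacobi-Trudi, `h` to monomial by the
  -- kernel at `t = 0`, monomial to Schur by the transpose of the first.
  have h1 : ∀ rho : RPartition r n, MvPowerSeries.coeff (expo rho.1) (sFn lam.1) =
      (transitionIn (ParamField r) r n * qMatrix .plus (0 : Fin r → ParamField r) n) lam rho := by
    intro rho
    rw [sFn_eq_sum_hProd, map_sum, Matrix.mul_apply]
    refine Finset.sum_congr rfl fun mu _ => ?_
    rw [map_smul, coeff_hProd .plus, smul_eq_mul]
    rfl
  have h2 := congrFun (schurCoeffs_sFn lam) nu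
  have h3 : (⟨sFn lam.1, sFn_mem lam⟩ : symFn r n) = ∑ rho : RPartition r n,
      MvPowerSeries.coeff (expo rho.1) (sFn lam.1) • ⟨mFn rho.1, mFn_mem rho⟩ := by
    refine Subtype.ext ?_
    rw [Submodule.coe_sum]
    exact eq_sum_mFn (sFn_mem lam)
  rw [h3, map_sum, Finset.sum_apply, Pi.single_apply] at h2
  rw [Matrix.mul_apply, Matrix.one_apply, if_congr (eq_comm (a := lam)) rfl rfl, ← h2]
  refine Finset.sum_congr rfl fun rho _ => ?_
  rw [map_smul, Pi.smul_apply, schurCoeffs_mFn, h1]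
  rfl

/-- The orthonormality of the Schur functions for `t = 0`. -/
theorem transitionIn_mul_qMatrix_zero (r n : ℕ) [NeZero r] [DecidableEq (RPartition r n)] :
    transitionIn ℚ r n * qMatrix .plus (0 : Fin r → ℚ) n * (transitionIn ℚ r n).transpose = 1 := by
  have hinj : Function.Injective fun M : Matrix (RPartition r n) (RPartition r n) ℚ =>
      M.map (algebraMap ℚ (ParamField r)) :=
    Matrix.map_injective (algebraMap ℚ (ParamField r)).injective
  apply hinj
  simp only [Matrix.map_mul, Matrix.transpose_map, map_transitionIn, map_qMatrix, Pi.zero_apply,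
    map_zero]
  rw [Matrix.map_one _ (map_zero _) (map_one _)]
  exact transitionIn_mul_qMatrix_zero_paramField n

/-- The parameter `t_k` as an element of `valueRing r`. -/
noncomputable def tvarValue (k : Fin r) : valueRing r :=
  ⟨(tvar k, 0), by
    have := hasValueAtZero_algebraMap (MvPolynomial.X k : MvPolynomial (Fin r) ℚ)
    simp only [MvPolynomial.eval_X, Pi.zero_apply] at this
    exact this⟩

/-- The matrix that expresses the combinations of the `q^+` with the coefficients of the Schur
functions in the basis of products of complete symmetric functions, in the basis of Schur
functions. -/
noncomputable def schurKernel (r n : ℕ) [NeZero r] :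
    Matrix (RPartition r n) (RPartition r n) (valueRing r) :=
  transitionIn (valueRing r) r n * qMatrix .plus tvarValue n *
    (transitionIn (valueRing r) r n).transpose

theorem map_value_schurKernel (n : ℕ) [DecidableEq (RPartition r n)] :
    (schurKernel r n).map (valueRing.value r) = 1 := by
  rw [schurKernel, Matrix.map_mul, Matrix.map_mul, Matrix.transpose_map,
    map_transitionIn, map_qMatrix,
    ← transitionIn_mul_qMatrix_zero r n]
  rfl

theorem map_toField_schurKernel (n : ℕ) :
    (schurKernel r n).map (valueRing.toField r) =
      transitionIn (ParamField r) r n * qMatrix .plus tvar n *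
        (transitionIn (ParamField r) r n).transpose := by
  rw [schurKernel, Matrix.map_mul, Matrix.map_mul, Matrix.transpose_map,
    map_transitionIn, map_qMatrix]
  rfl

/-- `EqAtZero` compares coefficients of power series, so it must be known that multiplying by those
of a Schur function creates no pole. -/
theorem exists_toField_eq_coeff_sFn {n : ℕ} (lam : RPartition r n) (ν : Fin r × ℕ →₀ ℕ) :
    ∃ x, valueRing.toField r x = MvPowerSeries.coeff ν (sFn lam.1) := by
  refine ⟨∑ mu, transitionIn (valueRing r) r n lam mu *
    kerMatrix .plus (0 : Fin r → valueRing r) (expo mu.1) ν, ?_⟩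
  rw [sFn_eq_sum_hProd, map_sum, map_sum]
  refine Finset.sum_congr rfl fun mu _ => ?_
  rw [map_smul, coeff_hProd .plus, smul_eq_mul, map_mul, map_kerMatrix]
  simp only [Pi.zero_apply, map_zero, transitionIn, Matrix.map_apply]
  rw [eq_intCast, map_intCast]
  rfl

end SchurBasis

/-! ### Dual families that are triangular with respect to an order -/

section Triangular

theorem eq_sum_of_dual {Z K V : Type*} [Fintype Z] [DecidableEq Z] [Field K] [AddCommGroup V]
    [Module K V] (s : Module.Basis Z K V) {B : V →ₗ[K] V →ₗ[K] K} {q m : Z → V}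
    (hq : ∀ a b, B (q a) (m b) = if a = b then 1 else 0) (x : V) :
    x = ∑ d, B x (m d) • q d := by
  have hqli : LinearIndependent K q := by
    rw [Fintype.linearIndependent_iff]
    intro g hg d
    have := congrArg (fun x => B x (m d)) hg
    simpa [hq] using this
  have hfin : FiniteDimensional K V := Module.Basis.finiteDimensional_of_finite s
  have hx : x ∈ Submodule.span K (Set.range q) := by
    rw [hqli.span_eq_top_of_card_eq_finrank' (Module.finrank_eq_card_basis s).symm]
    trivial
  obtain ⟨g, rfl⟩ := (Submodule.mem_span_range_iff_exists_fun K).1 hx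
  refine Finset.sum_congr rfl fun d _ => ?_
  congr 1
  simp [hq]

variable {Z : Type*} [LinearOrder Z] {sim : Z → Z → Prop}

/-- The elements below `a` that are not equivalent to `a`. -/
def low (sim : Z → Z → Prop) (a : Z) : Set Z := {b | b < a ∧ ¬ sim b a}

/-- The complement of `low` is the range of summation for the `q` in condition (i). -/
theorem notMem_low_iff {a b : Z} : b ∉ low sim a ↔ sim b a ∨ a ≤ b := by
  simp only [low, Set.mem_ofPred_eq, not_and, not_not]
  constructor
  · intro hb
    by_cases hlt : b < a
    · exact Or.inl (hb hlt)
    · exact Or.inr (not_lt.1 hlt)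
  · rintro (hb | hb) hlt
    · exact hb
    · exact absurd hlt (not_lt.2 hb)

/-- The equivalence relation `sim` has classes that are intervals. -/
structure IntervalEquiv (sim : Z → Z → Prop) : Prop where
  equiv : Equivalence sim
  interval : ∀ a b c, a ≤ b → b ≤ c → sim a c → sim b a

namespace IntervalEquiv

theorem mem_low_of_le (h : IntervalEquiv sim) {a b c : Z} (hb : b ∈ low sim a) (hc : c ≤ b) :
    c ∈ low sim a :=
  ⟨hc.trans_lt hb.1, fun hca =>
    hb.2 (h.equiv.trans (h.interval c b a hc hb.1.le hca) hca)⟩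

theorem mem_low_of_sim (h : IntervalEquiv sim) {a b c : Z} (hb : b ∈ low sim a)
    (hc : sim c b) : c ∈ low sim a := by
  refine ⟨?_, fun hca => hb.2 (h.equiv.trans (h.equiv.symm hc) hca)⟩
  by_contra hlt
  exact hb.2 (h.equiv.symm (h.interval b a c hb.1.le (not_lt.1 hlt) (h.equiv.symm hc)))

theorem low_subset_of_sim (h : IntervalEquiv sim) {a b : Z} (hab : sim a b) :
    low sim a ⊆ low sim b := by
  intro c hc
  have hcb : ¬ sim c b := fun hcb => hc.2 (h.equiv.trans hcb (h.equiv.symm hab))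
  refine ⟨?_, hcb⟩
  by_contra hlt
  exact hcb (h.interval b c a (not_lt.1 hlt) hc.1.le (h.equiv.symm hab))

theorem low_eq_of_sim (h : IntervalEquiv sim) {a b : Z} (hab : sim a b) : low sim a = low sim b :=
  Set.Subset.antisymm (h.low_subset_of_sim hab) (h.low_subset_of_sim (h.equiv.symm hab))

theorem mem_low_or_mem_low (h : IntervalEquiv sim) {a b : Z} (hab : ¬ sim a b) :
    b ∈ low sim a ∨ a ∈ low sim b := by
  have hba : ¬ sim b a := fun hba => hab (h.equiv.symm hba)
  rcases lt_trichotomy a b with hlt | rfl | hlt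
  · exact Or.inr ⟨hlt, hab⟩
  · exact absurd (h.equiv.refl a) hab
  · exact Or.inl ⟨hlt, hba⟩

theorem sim_or_le_iff (h : IntervalEquiv sim) {a b : Z} :
    sim b a ∨ b ≤ a ↔ sim b a ∨ b ∈ low sim a := by
  by_cases hba : sim b a
  · simp [hba]
  · simp only [hba, false_or, low, Set.mem_ofPred_eq, not_false_eq_true, and_true]
    refine ⟨fun hle => lt_of_le_of_ne hle ?_, le_of_lt⟩
    rintro rfl
    exact hba (h.equiv.refl b)

end IntervalEquiv

variable {K V : Type*} [Field K] [AddCommGroup V] [Module K V]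

/-- The family `f` is obtained from the basis `s` by a unitriangular matrix. -/
def Unitriangular (sim : Z → Z → Prop) (s : Module.Basis Z K V) (f : Z → V) : Prop :=
  ∀ a, f a - s a ∈ Submodule.span K (s '' low sim a)

/-- A unitriangular change of basis is inverted by induction along the order, without leaving a set
that contains the `low` sets of its elements. -/
theorem Unitriangular.span_image_eq [Finite Z] {s : Module.Basis Z K V} {f : Z → V}
    (hf : Unitriangular sim s f) {I : Set Z} (hI : ∀ a ∈ I, low sim a ⊆ I) :
    Submodule.span K (f '' I) = Submodule.span K (s '' I) := by
  apply le_antisymm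
  · rw [Submodule.span_le]
    rintro _ ⟨a, ha, rfl⟩
    have h1 := Submodule.span_mono (Set.image_mono (hI a ha)) (hf a)
    have h2 : s a ∈ Submodule.span K (s '' I) := Submodule.subset_span ⟨a, ha, rfl⟩
    simpa using Submodule.add_mem _ h1 h2
  · have key : ∀ a, a ∈ I → s a ∈ Submodule.span K (f '' I) := by
      intro a
      induction a using WellFoundedLT.induction with
      | ind a ih =>
        intro ha
        have h1 : f a - s a ∈ Submodule.span K (f '' I) := by
          refine Submodule.span_le.2 ?_ (hf a)
          rintro _ ⟨b, hb, rfl⟩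
          exact ih b hb.1 (hI a ha hb)
        have h2 : f a ∈ Submodule.span K (f '' I) := Submodule.subset_span ⟨a, ha, rfl⟩
        simpa using Submodule.sub_mem _ h2 h1
    rw [Submodule.span_le]
    rintro _ ⟨a, ha, rfl⟩
    exact key a ha

theorem Unitriangular.span_range_eq_top [Finite Z] {s : Module.Basis Z K V} {f : Z → V}
    (hf : Unitriangular sim s f) : Submodule.span K (Set.range f) = ⊤ := by
  rw [← Set.image_univ, hf.span_image_eq fun _ _ => Set.subset_univ _, Set.image_univ, s.span_eq]

theorem Unitriangular.linearIndependent [Fintype Z] {s : Module.Basis Z K V} {f : Z → V}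
    (hf : Unitriangular sim s f) : LinearIndependent K f :=
  linearIndependent_of_top_le_span_of_card_eq_finrank hf.span_range_eq_top.ge
    (Module.finrank_eq_card_basis s).symm

theorem Unitriangular.span_low_eq [Finite Z] (h : IntervalEquiv sim) {s : Module.Basis Z K V}
    {f : Z → V} (hf : Unitriangular sim s f) (a : Z) :
    Submodule.span K (f '' low sim a) = Submodule.span K (s '' low sim a) :=
  hf.span_image_eq fun _ hb _ hc => h.mem_low_of_le hb hc.1.le

/-- The families `P` and `P'` are unitriangular, and orthogonal for inequivalent indices. -/
structure IsDualPair (sim : Z → Z → Prop) (s : Module.Basis Z K V) (B : V →ₗ[K] V →ₗ[K] K)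
    (P P' : Z → V) : Prop where
  left : Unitriangular sim s P
  right : Unitriangular sim s P'
  orth : ∀ a b, ¬ sim a b → B (P a) (P' b) = 0

namespace IsDualPair

variable {s : Module.Basis Z K V} {B : V →ₗ[K] V →ₗ[K] K} {P P' : Z → V}

theorem flip (h : IntervalEquiv sim) (hP : IsDualPair sim s B P P') :
    IsDualPair sim s B.flip P' P :=
  ⟨hP.right, hP.left, fun a b hab => hP.orth b a fun hba => hab (h.equiv.symm hba)⟩

theorem apply_eq_zero [Finite Z] (h : IntervalEquiv sim) (hP : IsDualPair sim s B P P') {a : Z}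
    {y : V} (hy : y ∈ Submodule.span K (s '' low sim a)) : B (P a) y = 0 := by
  rw [← hP.right.span_low_eq h] at hy
  have : Submodule.span K (P' '' low sim a) ≤ LinearMap.ker (B (P a)) := by
    rw [Submodule.span_le]
    rintro _ ⟨b, hb, rfl⟩
    exact hP.orth a b fun hab => hb.2 (h.equiv.symm hab)
  exact this hy

/-- On a union `I` of classes the pairing of the `P` with the `P'` stays nondegenerate, because the
`P` over `I` are already orthogonal to every `P'` outside `I`. -/
theorem eq_zero_of_mem_span [Finite Z] (h : IntervalEquiv sim) (hP : IsDualPair sim s B P P')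
    (hB : ∀ x, (∀ y, B x y = 0) → x = 0) {I : Set Z} (hI : ∀ a ∈ I, ∀ b, sim b a → b ∈ I) {x : V}
    (hx : x ∈ Submodule.span K (P '' I)) (hx' : ∀ a ∈ I, B x (P' a) = 0) : x = 0 := by
  have h0 : ∀ a, B x (P' a) = 0 := by
    intro a
    by_cases ha : a ∈ I
    · exact hx' a ha
    · have : Submodule.span K (P '' I) ≤ LinearMap.ker (B.flip (P' a)) := by
        rw [Submodule.span_le]
        rintro _ ⟨b, hb, rfl⟩
        exact hP.orth b a fun hba => ha (hI b hb a (h.equiv.symm hba))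
      exact this hx
  refine hB x fun y => ?_
  have : Submodule.span K (Set.range P') ≤ LinearMap.ker (B x) := by
    rw [Submodule.span_le]
    rintro _ ⟨b, rfl⟩
    exact h0 b
  rw [hP.right.span_range_eq_top] at this
  exact this trivial

/-- The difference `R a - P a` lies in the span over `low sim a` and is orthogonal to it; `low sim
a` is a union of classes. -/
theorem left_unique [Finite Z] (h : IntervalEquiv sim) (hP : IsDualPair sim s B P P')
    (hB : ∀ x, (∀ y, B x y = 0) → x = 0) {R R' : Z → V} (hR : IsDualPair sim s B R R') :
    R = P := by
  funext a
  rw [← sub_eq_zero]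
  refine hP.eq_zero_of_mem_span h hB (I := low sim a) (fun b hb c hc => h.mem_low_of_sim hb hc)
    ?_ fun b hb => ?_
  · rw [hP.left.span_low_eq h]
    have := Submodule.sub_mem _ (hR.left a) (hP.left a)
    simpa using this
  · have hmem : P' b ∈ Submodule.span K (s '' low sim a) := by
      rw [← hP.right.span_low_eq h]
      exact Submodule.subset_span ⟨b, hb, rfl⟩
    rw [map_sub, LinearMap.sub_apply, hR.apply_eq_zero h hmem, hP.apply_eq_zero h hmem, sub_zero]

/-- The matrix of pairings in an equivalence class. -/
def gramMatrix (sim : Z → Z → Prop) (B : V →ₗ[K] V →ₗ[K] K) (P P' : Z → V) (a : Z) :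
    Matrix {b // sim b a} {b // sim b a} K :=
  Matrix.of fun b c => B (P b.1) (P' c.1)

theorem sim_mem_class (h : IntervalEquiv sim) {a : Z} :
    ∀ b ∈ {b | sim b a}, ∀ c, sim c b → c ∈ {b | sim b a} :=
  fun _ hb _ hc => h.equiv.trans hc hb

theorem det_gramMatrix_ne_zero [Fintype Z] (h : IntervalEquiv sim)
    (hP : IsDualPair sim s B P P') (hB : ∀ x, (∀ y, B x y = 0) → x = 0) (a : Z)
    [Fintype {b // sim b a}] : (gramMatrix sim B P P' a).det ≠ 0 := by
  intro hdet
  obtain ⟨v, hv, hv'⟩ := Matrix.exists_vecMul_eq_zero_iff.2 hdet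
  apply hv
  have h0 : ∑ b, v b • P b.1 = 0 := by
    refine hP.eq_zero_of_mem_span h hB (I := {b | sim b a}) (sim_mem_class h) ?_ fun c hc => ?_
    · exact Submodule.sum_mem _ fun b _ => Submodule.smul_mem _ _
        (Submodule.subset_span ⟨b.1, b.2, rfl⟩)
    · have := congrFun hv' ⟨c, hc⟩
      simpa [Matrix.vecMul, dotProduct, gramMatrix] using this
  have h1 := hP.left.linearIndependent.comp (fun b : {b // sim b a} => b.1) Subtype.val_injective
  funext b
  exact Fintype.linearIndependent_iff.1 h1 v h0 b

/-- Here the two triangularity conditions meet: the first hypothesis on `x` bounds it from above,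
and orthogonality to the `m` removes everything below the class. -/
theorem mem_span_class [Finite Z] (h : IntervalEquiv sim) (hP : IsDualPair sim s B P P')
    (hB : ∀ x, (∀ y, B x y = 0) → x = 0) {m : Z → V} (hm : Unitriangular sim s m) {a : Z} {x : V}
    (hx : x ∈ Submodule.span K (s '' {b | sim b a ∨ b ≤ a}))
    (hx' : ∀ b ∈ low sim a, B x (m b) = 0) : x ∈ Submodule.span K (P '' {b | sim b a}) := by
  have hset : {b | sim b a ∨ b ≤ a} = {b | sim b a} ∪ low sim a := by
    ext b
    exact h.sim_or_le_iff
  have hclosed : ∀ b ∈ {b | sim b a ∨ b ≤ a}, low sim b ⊆ {b | sim b a ∨ b ≤ a} := by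
    rw [hset]
    rintro b (hb | hb)
    · rw [h.low_eq_of_sim hb]
      exact Set.subset_union_right
    · exact fun c hc => Or.inr (h.mem_low_of_le hb hc.1.le)
  rw [← hP.left.span_image_eq hclosed, hset, Set.image_union, Submodule.span_union] at hx
  obtain ⟨z, hz, y, hy, rfl⟩ := Submodule.mem_sup.1 hx
  -- The lower part `y` is orthogonal to the `P'` over `low`: `z + y` is, since the `m` and the `P'`
  -- span the same space there, and `z` is, since it comes from another class.
  have hy0 : y = 0 := by
    refine hP.eq_zero_of_mem_span h hB (I := low sim a)
      (fun b hb c hc => h.mem_low_of_sim hb hc) hy fun b hb => ?_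
    have e1 : B (z + y) (P' b) = 0 := by
      have : Submodule.span K (m '' low sim a) ≤ LinearMap.ker (B (z + y)) := by
        rw [Submodule.span_le]
        rintro _ ⟨c, hc, rfl⟩
        exact hx' c hc
      refine this ?_
      rw [hm.span_low_eq h, ← hP.right.span_low_eq h]
      exact Submodule.subset_span ⟨b, hb, rfl⟩
    have e2 : B z (P' b) = 0 := by
      have : Submodule.span K (P '' {b | sim b a}) ≤ LinearMap.ker (B.flip (P' b)) := by
        rw [Submodule.span_le]
        rintro _ ⟨c, hc, rfl⟩
        exact hP.orth c b fun hcb => hb.2 (h.equiv.trans (h.equiv.symm hcb) hc)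
      exact this hz
    rwa [map_add, LinearMap.add_apply, e2, zero_add] at e1
  rwa [hy0, add_zero]

theorem repr_left_apply (hP : IsDualPair sim s B P P') {a b : Z} (hab : b ∉ low sim a)
    [DecidableEq Z] : s.repr (P a) b = if a = b then 1 else 0 := by
  have h1 : s.repr (P a - s a) b = 0 := by
    by_contra hne
    exact hab ((Module.Basis.mem_span_image s).1 (hP.left a) (Finsupp.mem_support_iff.2 hne))
  rw [map_sub, Finsupp.sub_apply, s.repr_self, Finsupp.single_apply, sub_eq_zero] at h1
  exact h1

open Classical in
/-- A family indexed by an equivalence class, with triangular expansions in the basis `s` and in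
the basis `q` dual to `m`, consists of combinations of the `P b`, for `b` in the class. -/
theorem expansion_iff [Fintype Z] (h : IntervalEquiv sim) (hP : IsDualPair sim s B P P')
    (hB : ∀ x, (∀ y, B x y = 0) → x = 0) {m q : Z → V} (hm : Unitriangular sim s m)
    (hq : ∀ a b, B (q a) (m b) = if a = b then 1 else 0) (a : Z) [Fintype {b // sim b a}]
    (R : {b // sim b a} → V) (c₀ u₀ : Matrix {b // sim b a} {b // sim b a} K) :
    (∃ c u : Matrix {b // sim b a} Z K,
      (∀ b, R b = ∑ d with (sim d b.1 ∨ b.1 ≤ d), c b d • q d) ∧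
      (∀ b, R b = ∑ d with (sim d b.1 ∨ d ≤ b.1), u b d • s d) ∧
      c.submatrix id Subtype.val = c₀ ∧ u.submatrix id Subtype.val = u₀) ↔
    c₀ = u₀ * gramMatrix sim B P P' a ∧ ∀ b, R b = ∑ d, u₀ b d • P d.1 := by
  -- `m d - P' d` lies in the span over `low`, which `P b` annihilates.
  have hPm : ∀ b d, sim b d → B (P b) (m d) = B (P b) (P' d) := by
    intro b d hbd
    rw [← sub_eq_zero, ← map_sub]
    apply hP.apply_eq_zero h
    rw [h.low_eq_of_sim hbd]
    have := Submodule.sub_mem _ (hm d) (hP.right d)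
    simpa using this
  have hRm : ∀ v : Matrix {b // sim b a} {b // sim b a} K, (∀ b, R b = ∑ d, v b d • P d.1) →
      ∀ b d, B (R b) (m d.1) = (v * gramMatrix sim B P P' a) b d := by
    intro v hv b d
    rw [hv, map_sum, LinearMap.sum_apply, Matrix.mul_apply]
    refine Finset.sum_congr rfl fun x _ => ?_
    rw [map_smul, LinearMap.smul_apply, smul_eq_mul,
      hPm _ _ (h.equiv.trans x.2 (h.equiv.symm d.2))]
    rfl
  have hRs : ∀ v : Matrix {b // sim b a} {b // sim b a} K, (∀ b, R b = ∑ d, v b d • P d.1) →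
      ∀ b d, s.repr (R b) d.1 = v b d := by
    intro v hv b d
    rw [hv, map_sum, Finsupp.finsetSum_apply, Finset.sum_eq_single d]
    · rw [map_smul, Finsupp.smul_apply, hP.repr_left_apply
        (notMem_low_iff.2 (Or.inl (h.equiv.refl _))), if_pos rfl, smul_eq_mul, mul_one]
    · intro x _ hx
      rw [map_smul, Finsupp.smul_apply, hP.repr_left_apply
        (notMem_low_iff.2 (Or.inl (h.equiv.trans d.2 (h.equiv.symm x.2)))),
        if_neg fun hxd => hx (Subtype.ext hxd), smul_zero]
    · simp
  constructor
  · rintro ⟨c, u, hc, hu, rfl, rfl⟩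
    -- Pairing with the dual family `m` reads off the coefficients on the `q`; the support condition
    -- on `c` becomes orthogonality to the `m` over `low`.
    have hBc : ∀ b d, B (R b) (m d) = if (sim d b.1 ∨ b.1 ≤ d) then c b d else 0 := by
      intro b d
      rw [hc b, map_sum, LinearMap.sum_apply]
      simp only [map_smul, LinearMap.smul_apply, hq, smul_eq_mul, mul_ite, mul_one, mul_zero]
      rw [Finset.sum_ite_eq']
      simp
    have hsu : ∀ b d, s.repr (R b) d = if (sim d b.1 ∨ d ≤ b.1) then u b d else 0 := by
      intro b d
      rw [hu b, map_sum, Finsupp.finsetSum_apply]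
      simp only [map_smul, Finsupp.smul_apply, s.repr_self, Finsupp.single_apply, smul_eq_mul,
        mul_ite, mul_one, mul_zero]
      rw [Finset.sum_ite_eq']
      simp
    have hv : ∃ v : Matrix {b // sim b a} {b // sim b a} K, ∀ b, R b = ∑ d, v b d • P d.1 := by
      have hspan : ∀ b, ∃ v : {b // sim b a} → K, R b = ∑ d, v d • P d.1 := by
        intro b
        have h1 : R b ∈ Submodule.span K (P '' {d | sim d b.1}) := by
          refine hP.mem_span_class h hB hm ?_ ?_
          · rw [hu b]
            refine Submodule.sum_mem _ fun d hd => Submodule.smul_mem _ _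
              (Submodule.subset_span ⟨d, (Finset.mem_filter.1 hd).2, rfl⟩)
          · intro d hd
            rw [hBc, if_neg]
            rw [← notMem_low_iff, not_not]
            exact hd
        have h2 : P '' {d | sim d b.1} = Set.range fun d : {d // sim d a} => P d.1 := by
          ext x
          constructor
          · rintro ⟨d, hd, rfl⟩
            exact ⟨⟨d, h.equiv.trans hd b.2⟩, rfl⟩
          · rintro ⟨d, rfl⟩
            exact ⟨d.1, h.equiv.trans d.2 (h.equiv.symm b.2), rfl⟩
        rw [h2, Submodule.mem_span_range_iff_exists_fun] at h1
        obtain ⟨v, hv⟩ := h1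
        exact ⟨v, hv.symm⟩
      choose v hv using hspan
      exact ⟨v, hv⟩
    obtain ⟨v, hv⟩ := hv
    have hvu : v = u.submatrix id Subtype.val := by
      ext b d
      rw [← hRs v hv, hsu, if_pos (Or.inl (h.equiv.trans d.2 (h.equiv.symm b.2)))]
      rfl
    rw [← hvu]
    refine ⟨?_, hv⟩
    ext b d
    rw [← hRm v hv, hBc, if_pos (Or.inl (h.equiv.trans d.2 (h.equiv.symm b.2)))]
    rfl
  · rintro ⟨rfl, hv⟩
    -- The coefficients are the pairings with `m` and the coordinates in `s`; it remains to see that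
    -- they vanish outside the permitted ranges.
    have hqspan := eq_sum_of_dual s hq
    refine ⟨Matrix.of fun b d => B (R b) (m d), Matrix.of fun b d => s.repr (R b) d, ?_, ?_, ?_,
      ?_⟩
    · intro b
      refine (hqspan (R b)).trans (Finset.sum_subset (Finset.filter_subset _ _) ?_).symm
      intro d _ hd
      have hd' : d ∈ low sim b.1 := by
        by_contra hd'
        exact hd (Finset.mem_filter.2 ⟨Finset.mem_univ _, notMem_low_iff.1 hd'⟩)
      have hz : B (R b) (m d) = 0 := by
        rw [hv, map_sum, LinearMap.sum_apply]
        refine Finset.sum_eq_zero fun x _ => ?_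
        rw [map_smul, LinearMap.smul_apply, hP.apply_eq_zero h, smul_zero]
        rw [← hm.span_low_eq h]
        refine Submodule.subset_span ⟨d, ?_, rfl⟩
        rwa [h.low_eq_of_sim (h.equiv.trans x.2 (h.equiv.symm b.2))]
      exact (congrArg (· • _) hz).trans (zero_smul K _)
    · intro b
      refine (s.sum_repr (R b)).symm.trans
        (Finset.sum_subset (Finset.filter_subset _ _) ?_).symm
      intro d _ hd
      have hd' : ¬ (sim d b.1 ∨ d ≤ b.1) := fun hd' =>
        hd (Finset.mem_filter.2 ⟨Finset.mem_univ _, hd'⟩)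
      rw [h.sim_or_le_iff, not_or] at hd'
      have hz : s.repr (R b) d = 0 := by
        rw [hv, map_sum, Finsupp.finsetSum_apply]
        refine Finset.sum_eq_zero fun x _ => ?_
        have hxb := h.equiv.trans x.2 (h.equiv.symm b.2)
        rw [map_smul, Finsupp.smul_apply, hP.repr_left_apply, if_neg, smul_zero]
        · rintro rfl
          exact hd'.1 hxb
        · rw [h.low_eq_of_sim hxb]
          exact hd'.2
      exact (congrArg (· • _) hz).trans (zero_smul K _)
    · ext b d
      exact hRm _ hv b d
    · ext b d
      exact hRs _ hv b d

end IsDualPair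

end Triangular

/-! ### The bilinear form and the Hall-Littlewood functions, in coordinates -/

section Coordinates

theorem of_eq_one_iff {Z K : Type*} [Field K] [DecidableEq Z] {f : Z → Z → K} :
    (∀ a b, f a b = if a = b then 1 else 0) ↔ Matrix.of f = 1 := by
  rw [← Matrix.ext_iff]
  simp only [Matrix.of_apply, Matrix.one_apply]

variable {Z : Type*} [Fintype Z] {K V : Type*} [Field K] [AddCommGroup V] [Module K V]

theorem eq_zero_of_dual [DecidableEq Z] (s : Module.Basis Z K V) {B : V →ₗ[K] V →ₗ[K] K}
    {q m : Z → V} (hq : ∀ a b, B (q a) (m b) = if a = b then 1 else 0) (x : V)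
    (hx : ∀ y, B x y = 0) : x = 0 := by
  rw [eq_sum_of_dual s hq x]
  simp [hx]

theorem bilin_sum_sum (s : Z → V) (B : V →ₗ[K] V →ₗ[K] K) (M N : Matrix Z Z K) (a b : Z) :
    B (∑ c, M a c • s c) (∑ d, N d b • s d) =
      (M * (Matrix.of fun c d => B (s c) (s d)) * N) a b := by
  rw [Matrix.mul_apply]
  simp only [map_sum, LinearMap.sum_apply, map_smul, LinearMap.smul_apply, smul_eq_mul,
    Matrix.mul_apply, Matrix.of_apply, Finset.sum_mul, Finset.mul_sum]
  refine Finset.sum_congr rfl fun d _ => Finset.sum_congr rfl fun c _ => ?_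
  ring

variable {s m q q' : Z → V} {T A G : Matrix Z Z K} {B : V →ₗ[K] V →ₗ[K] K}

theorem pairing_q_m (hm : ∀ a, m a = ∑ b, T b a • s b) (hq : ∀ a, q a = ∑ b, A a b • m b)
    (a b : Z) : B (q a) (m b) =
      (A * T.transpose * (Matrix.of fun c d => B (s c) (s d)) * T) a b := by
  have h1 : q a = ∑ c, (A * T.transpose) a c • s c := by
    rw [hq]
    simp only [hm, Matrix.mul_apply, Finset.smul_sum, Finset.sum_smul, smul_smul]
    rw [Finset.sum_comm]
    rfl
  rw [h1, hm b, bilin_sum_sum]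

theorem pairing_m_q (hm : ∀ a, m a = ∑ b, T b a • s b) (hq' : ∀ a, q' a = ∑ b, A b a • m b)
    (a b : Z) : B (m a) (q' b) =
      (T.transpose * (Matrix.of fun c d => B (s c) (s d)) * (T * A)) a b := by
  have h1 : q' b = ∑ c, (T * A) c b • s c := by
    rw [hq']
    simp only [hm, Matrix.mul_apply, Finset.smul_sum, Finset.sum_smul, smul_smul]
    rw [Finset.sum_comm]
    exact Finset.sum_congr rfl fun c _ => Finset.sum_congr rfl fun d _ => by rw [mul_comm]
  rw [h1, hm a, ← bilin_sum_sum]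
  rfl

variable [DecidableEq Z]

/-- The form for which `q` and `m` are dual has the Gram matrix `(T A Tᵀ)⁻¹` in the basis `s`. -/
theorem dual_iff_gram_eq (hm : ∀ a, m a = ∑ b, T b a • s b) (hq : ∀ a, q a = ∑ b, A a b • m b)
    (hG : T * A * T.transpose * G = 1) :
    (∀ a b, B (q a) (m b) = if a = b then 1 else 0) ↔ ∀ a b, B (s a) (s b) = G a b := by
  rw [of_eq_one_iff]
  have h1 : (Matrix.of fun a b => B (q a) (m b)) =
      A * T.transpose * (Matrix.of fun c d => B (s c) (s d)) * T := by
    ext a b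
    exact pairing_q_m hm hq a b
  -- The last factor `T` is moved to the front, so that the product reads `T A Tᵀ` times the Gram
  -- matrix.
  rw [h1, mul_eq_one_comm, ← mul_assoc, ← mul_assoc]
  constructor
  · intro h a b
    have h2 : (Matrix.of fun c d => B (s c) (s d)) = G := by
      rw [mul_eq_one_comm] at hG
      rw [← one_mul (Matrix.of fun c d => B (s c) (s d)), ← hG, mul_assoc, h, mul_one]
    exact congrFun (congrFun h2 a) b
  · intro h
    have h2 : (Matrix.of fun c d => B (s c) (s d)) = G := Matrix.ext h
    rw [h2, hG]

/-- If `q` and `m` are dual for the form, then so are `m` and `q'`. -/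
theorem dual_of_dual (hm : ∀ a, m a = ∑ b, T b a • s b) (hq : ∀ a, q a = ∑ b, A a b • m b)
    (hq' : ∀ a, q' a = ∑ b, A b a • m b)
    (h : ∀ a b, B (q a) (m b) = if a = b then 1 else 0) (a b : Z) :
    B (m a) (q' b) = if a = b then 1 else 0 := by
  revert a b
  rw [of_eq_one_iff] at h ⊢
  have h1 : (Matrix.of fun a b => B (q a) (m b)) =
      A * (T.transpose * (Matrix.of fun c d => B (s c) (s d)) * T) := by
    ext a b
    simp only [← mul_assoc]
    exact pairing_q_m hm hq a b
  have h2 : (Matrix.of fun a b => B (m a) (q' b)) =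
      T.transpose * (Matrix.of fun c d => B (s c) (s d)) * T * A := by
    ext a b
    rw [mul_assoc _ T A]
    exact pairing_m_q hm hq' a b
  rw [h2, mul_eq_one_comm, ← h1, h]

end Coordinates

/-! ### Orthogonalization over the functions regular at the origin -/

section Existence

variable {r : ℕ} {Z : Type*} [Fintype Z] [LinearOrder Z] {V : Type*} [AddCommGroup V]
  [Module (ParamField r) V] {s : Z → V}
  {B : V →ₗ[ParamField r] V →ₗ[ParamField r] ParamField r} {G : Matrix Z Z (valueRing r)}

theorem exists_orthogonal (hG : G.map (valueRing.value r) = 1)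
    (hB : ∀ a b, B (s a) (s b) = valueRing.toField r (G a b)) {I : Set Z} {a : Z} (ha : a ∉ I) :
    ∃ u : Z → valueRing r, (∀ b, valueRing.value r (u b) = 0) ∧ (∀ b, b ∉ I → u b = 0) ∧
      ∀ c ∈ I, B (s a + ∑ b, valueRing.toField r (u b) • s b) (s c) = 0 := by
  classical
  let GI : Matrix I I (valueRing r) := G.submatrix Subtype.val Subtype.val
  have hGI : GI.map (valueRing.value r) = 1 := by
    ext b c
    have := congrFun (congrFun hG b.1) c.1
    simpa [GI, Matrix.one_apply, Subtype.ext_iff] using this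
  have hdet := valueRing.isUnit_det_of_map_value_eq_one hGI
  -- The orthogonality conditions are the linear system `v * GI = -(G a ·)`. As `a ∉ I`, the right
  -- side is off the diagonal of `G`, so it vanishes at the origin and `v` does too.
  let v : I → valueRing r := Matrix.vecMul (fun b => - G a b.1) GI⁻¹
  have hv : ∀ c : I, ∑ b : I, v b * G b.1 c.1 = - G a c.1 := by
    intro c
    have : Matrix.vecMul v GI = fun b : I => - G a b.1 := by
      simp only [v]
      rw [Matrix.vecMul_vecMul, Matrix.nonsing_inv_mul _ hdet, Matrix.vecMul_one]
    exact congrFun this c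
  refine ⟨fun b => if h : b ∈ I then v ⟨b, h⟩ else 0, fun b => ?_, fun b hb => dif_neg hb,
    fun c hc => ?_⟩
  · beta_reduce
    split_ifs with h
    · simp only [v, Matrix.vecMul, dotProduct, map_sum, map_mul]
      refine Finset.sum_eq_zero fun c _ => ?_
      have h1 := congrFun (congrFun hG a) c.1
      have hac : a ≠ c.1 := fun h => ha (h ▸ c.2)
      rw [Matrix.map_apply, Matrix.one_apply_ne hac] at h1
      rw [map_neg, h1, neg_zero, zero_mul]
    · exact map_zero _
  · have h1 : ∑ b, (if h : b ∈ I then v ⟨b, h⟩ else 0) * G b c = - G a c := by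
      rw [← hv ⟨c, hc⟩]
      symm
      refine Finset.sum_bij_ne_zero (fun b _ _ => b.1) (fun _ _ _ => Finset.mem_univ _)
        (fun _ _ _ _ _ _ h => Subtype.ext h) ?_ ?_
      · intro b _ hb
        by_cases h : b ∈ I
        · exact ⟨⟨b, h⟩, Finset.mem_univ _, by simpa [h] using hb, rfl⟩
        · simp [h] at hb
      · intro b _ _
        simp
    rw [map_add, LinearMap.add_apply, map_sum, LinearMap.sum_apply]
    simp only [map_smul, LinearMap.smul_apply, hB, smul_eq_mul, ← map_mul]
    rw [← map_sum, h1, ← map_add, add_neg_cancel, map_zero]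

end Existence

/-! ### The spaces `Ξ^{n,D}` -/

section Xi

variable {r : ℕ}

theorem linearIndependent_sFn (r n : ℕ) :
    LinearIndependent (ParamField r) fun lam : RPartition r n => sFn lam.1 := by
  have h := (schurBasis r n).linearIndependent.map' (symFn r n).subtype
    (Submodule.ker_subtype _)
  have h2 : (symFn r n).subtype ∘ schurBasis r n = fun lam => sFn lam.1 := by
    funext lam
    simp
  rwa [h2] at h

/-- The basis of `Ξ^{n,d}` given by the Schur functions `s_{θ(lam)}`. -/
noncomputable def defectBasis {n' n : ℕ} {θ : RPartition r n' → RPartition r n}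
    (hθ : Function.Injective θ) :
    Module.Basis (RPartition r n') (ParamField r) (defectSpace θ) :=
  Module.Basis.span ((linearIndependent_sFn r n).comp θ hθ)

theorem coe_defectBasis {n' n : ℕ} {θ : RPartition r n' → RPartition r n}
    (hθ : Function.Injective θ) (lam : RPartition r n') :
    (defectBasis hθ lam : PS r) = sFn (θ lam).1 :=
  congrArg Subtype.val (Module.Basis.span_apply ((linearIndependent_sFn r n).comp θ hθ) lam)

theorem existsUnique_isTheta {n' n : ℕ} {θ : RPartition r n' → RPartition r n}
    (hθ : Function.Injective θ) : ∃! Θ, IsTheta θ Θ := by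
  refine ⟨(schurBasis r n').constr (ParamField r) (defectBasis hθ), fun lam => ?_, ?_⟩
  · rw [← schurBasis_apply, Module.Basis.constr_basis, coe_defectBasis]
  · intro Θ hΘ
    refine (schurBasis r n').ext fun lam => Subtype.ext ?_
    rw [Module.Basis.constr_basis, coe_defectBasis, schurBasis_apply]
    exact hΘ lam

theorem bigTheta_sFn {n' n : ℕ} {θ : RPartition r n' → RPartition r n}
    (hθ : Function.Injective θ) (lam : RPartition r n') :
    bigTheta θ ⟨sFn lam.1, sFn_mem lam⟩ = defectBasis hθ lam := by
  refine Subtype.ext ?_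
  rw [coe_defectBasis]
  exact Classical.epsilon_spec (existsUnique_isTheta hθ).exists lam

variable [NeZero r] {α n : ℕ} {D : Finset (Defect r α)}

/-- The element of `Z_{n,D}` given by a defect and an `r`-partition. -/
def ZSym.mk (d : D) (lam : RPartition r (n - d.1.f)) : ZSym n D := ⟨d, lam⟩

theorem ZSym.exists_eq_mk (Λ : ZSym n D) : ∃ d lam, Λ = ZSym.mk d lam := ⟨Λ.1, Λ.2, rfl⟩

theorem ZSym.mk_injective (d : D) : Function.Injective (ZSym.mk (n := n) d) :=
  fun _ _ h => eq_of_heq (Sigma.mk.inj h).2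

theorem sum_zsym {M : Type*} [AddCommMonoid M] (g : ZSym n D → M) :
    ∑ Λ, g Λ = ∑ d : D, ∑ lam : RPartition r (n - d.1.f), g (ZSym.mk d lam) := by
  rw [Finset.sum_sigma']
  exact Finset.sum_bij (fun Λ _ => Λ)
    (fun _ _ => Finset.mem_sigma.2 ⟨Finset.mem_univ _, Finset.mem_univ _⟩)
    (fun _ _ _ _ h => h)
    (fun Λ _ => ⟨Λ, Finset.mem_univ _, rfl⟩) fun _ _ => rfl

/-- A block diagonal matrix, with the blocks given by the defects. -/
def defectDiagonal {R : Type*} [Zero R]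
    (M : ∀ n', Matrix (RPartition r n') (RPartition r n') R) :
    Matrix (ZSym n D) (ZSym n D) R :=
  Matrix.of fun Λ Λ' => if h : Λ'.1 = Λ.1 then M _ Λ.2 (h ▸ Λ'.2) else 0

section DefectDiagonal

variable {R : Type*}

theorem defectDiagonal_apply_eq [Zero R] (M : ∀ n', Matrix (RPartition r n') (RPartition r n') R)
    (d : D) (lam mu : RPartition r (n - d.1.f)) :
    defectDiagonal M (ZSym.mk d lam) (ZSym.mk d mu) = M _ lam mu :=
  dif_pos rfl

theorem defectDiagonal_apply_ne [Zero R] (M : ∀ n', Matrix (RPartition r n') (RPartition r n') R)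
    {d d' : D} (h : d ≠ d') (lam : RPartition r (n - d.1.f)) (mu : RPartition r (n - d'.1.f)) :
    defectDiagonal M (ZSym.mk d lam) (ZSym.mk d' mu) = 0 :=
  dif_neg (Ne.symm h)

theorem defectDiagonal_transpose [Zero R]
    (M : ∀ n', Matrix (RPartition r n') (RPartition r n') R) :
    (defectDiagonal M : Matrix (ZSym n D) (ZSym n D) R).transpose =
      defectDiagonal fun n' => (M n').transpose := by
  ext Λ Λ'
  obtain ⟨d, lam, rfl⟩ := Λ.exists_eq_mk
  obtain ⟨d', mu, rfl⟩ := Λ'.exists_eq_mk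
  rw [Matrix.transpose_apply]
  by_cases h : d = d'
  · subst h
    rw [defectDiagonal_apply_eq, defectDiagonal_apply_eq, Matrix.transpose_apply]
  · rw [defectDiagonal_apply_ne _ h, defectDiagonal_apply_ne _ (Ne.symm h)]

theorem defectDiagonal_map {R' F : Type*} [Zero R] [Zero R'] [FunLike F R R']
    [ZeroHomClass F R R'] (φ : F) (M : ∀ n', Matrix (RPartition r n') (RPartition r n') R) :
    (defectDiagonal M : Matrix (ZSym n D) (ZSym n D) R).map φ =
      defectDiagonal fun n' => (M n').map φ := by
  ext Λ Λ'
  obtain ⟨d, lam, rfl⟩ := Λ.exists_eq_mk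
  obtain ⟨d', mu, rfl⟩ := Λ'.exists_eq_mk
  rw [Matrix.map_apply]
  by_cases h : d = d'
  · subst h
    rw [defectDiagonal_apply_eq, defectDiagonal_apply_eq, Matrix.map_apply]
  · rw [defectDiagonal_apply_ne _ h, defectDiagonal_apply_ne _ h, map_zero]

theorem defectDiagonal_one [Zero R] [One R] [DecidableEq (ZSym n D)]
    [∀ n', DecidableEq (RPartition r n')] :
    (defectDiagonal fun n' => (1 : Matrix (RPartition r n') (RPartition r n') R) :
      Matrix (ZSym n D) (ZSym n D) R) = 1 := by
  ext Λ Λ'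
  obtain ⟨d, lam, rfl⟩ := Λ.exists_eq_mk
  obtain ⟨d', mu, rfl⟩ := Λ'.exists_eq_mk
  by_cases h : d = d'
  · subst h
    rw [defectDiagonal_apply_eq]
    by_cases h2 : lam = mu
    · subst h2
      rw [Matrix.one_apply_eq, Matrix.one_apply_eq]
    · rw [Matrix.one_apply_ne h2, Matrix.one_apply_ne fun h3 => h2 (ZSym.mk_injective d h3)]
  · have h2 : ZSym.mk d lam ≠ ZSym.mk d' mu := fun h3 => h (congrArg (fun Λ => Λ.1) h3)
    rw [defectDiagonal_apply_ne _ h, Matrix.one_apply_ne h2]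

theorem defectDiagonal_mul [NonUnitalNonAssocSemiring R]
    (M N : ∀ n', Matrix (RPartition r n') (RPartition r n') R) :
    (defectDiagonal M : Matrix (ZSym n D) (ZSym n D) R) * defectDiagonal N =
      defectDiagonal fun n' => M n' * N n' := by
  ext Λ Λ'
  obtain ⟨d, lam, rfl⟩ := Λ.exists_eq_mk
  obtain ⟨d', mu, rfl⟩ := Λ'.exists_eq_mk
  rw [Matrix.mul_apply, sum_zsym, Finset.sum_eq_single d]
  · by_cases h : d = d'
    · subst h
      simp only [defectDiagonal_apply_eq, Matrix.mul_apply]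
    · rw [defectDiagonal_apply_ne _ h]
      exact Finset.sum_eq_zero fun x _ => by rw [defectDiagonal_apply_ne N h, mul_zero]
  · intro d'' _ h
    exact Finset.sum_eq_zero fun x _ => by rw [defectDiagonal_apply_ne M (Ne.symm h), zero_mul]
  · simp

end DefectDiagonal

variable {θ : ∀ d : D, RPartition r (n - d.1.f) → RPartition r n}

theorem linearIndependent_sSym (hθ : ∀ d, Function.Injective (θ d)) :
    LinearIndependent (ParamField r) (sSym θ) := by
  have h := DFinsupp.linearIndependent_single (R := ParamField r)
    (fun d : D => (defectBasis (hθ d) : RPartition r (n - d.1.f) → defectSpace (θ d)))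
    fun d => (defectBasis (hθ d)).linearIndependent
  have h2 : sSym θ = fun x : (Σ d : D, RPartition r (n - d.1.f)) =>
      DFinsupp.single (β := fun d => defectSpace (θ d)) x.1 (defectBasis (hθ x.1) x.2) := by
    funext Λ
    rw [sSym, bigTheta_sFn (hθ _)]
    rfl
  rw [h2]
  exact h

theorem top_le_span_sSym (hθ : ∀ d, Function.Injective (θ d)) :
    ⊤ ≤ Submodule.span (ParamField r) (Set.range (sSym θ)) := by
  intro x _
  induction x using DirectSum.induction_on with
  | zero => exact Submodule.zero_mem _
  | add x y hx hy => exact Submodule.add_mem _ (hx trivial) (hy trivial)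
  | of d x =>
    have h : DirectSum.lof (ParamField r) D (fun d => defectSpace (θ d)) d x ∈
        Submodule.span (ParamField r) (Set.range (sSym θ)) := by
      rw [← (defectBasis (hθ d)).sum_repr x, map_sum]
      refine Submodule.sum_mem _ fun lam _ => ?_
      rw [map_smul, ← bigTheta_sFn (hθ d)]
      exact Submodule.smul_mem _ _ (Submodule.subset_span ⟨⟨d, lam⟩, rfl⟩)
    exact h

/-- The basis of `Ξ^{n,D}` given by the functions `s_Λ`. -/
noncomputable def sBasis (hθ : ∀ d, Function.Injective (θ d)) :
    Module.Basis (ZSym n D) (ParamField r) (Xi θ) :=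
  Module.Basis.mk (linearIndependent_sSym hθ) (top_le_span_sSym hθ)

theorem sBasis_apply (hθ : ∀ d, Function.Injective (θ d)) (Λ : ZSym n D) :
    sBasis hθ Λ = sSym θ Λ :=
  Module.Basis.mk_apply _ _ _

/-- The maps `bigTheta` are linear and act on each defect separately, so expansions between
symmetric functions carry over to `Ξ^{n,D}` with a block diagonal matrix. -/
theorem sum_defectDiagonal_smul (M : ∀ n', Matrix (RPartition r n') (RPartition r n')
    (ParamField r)) (F : ∀ d : D, RPartition r (n - d.1.f) → symFn r (n - d.1.f)) (Λ : ZSym n D)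
    (G : symFn r (n - Λ.1.1.f)) (hG : G = ∑ mu, M _ Λ.2 mu • F Λ.1 mu) :
    DirectSum.lof (ParamField r) D (fun d => defectSpace (θ d)) Λ.1 (bigTheta (θ Λ.1) G) =
      ∑ N : ZSym n D, defectDiagonal M Λ N • DirectSum.lof (ParamField r) D
        (fun d => defectSpace (θ d)) N.1 (bigTheta (θ N.1) (F N.1 N.2)) := by
  obtain ⟨d, lam, rfl⟩ := Λ.exists_eq_mk
  rw [sum_zsym, Finset.sum_eq_single d]
  · rw [hG]
    simp only [map_sum, map_smul]
    refine Finset.sum_congr rfl fun mu _ => ?_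
    congr 1
    exact (defectDiagonal_apply_eq M d lam mu).symm
  · intro d' _ hd'
    refine Finset.sum_eq_zero fun mu _ => ?_
    rw [defectDiagonal_apply_ne M hd'.symm, zero_smul]
  · simp

theorem mSym_eq_sum (Λ : ZSym n D) :
    mSym θ Λ = ∑ N, defectDiagonal (fun n' => transitionIn (ParamField r) r n') N Λ •
      sSym θ N := by
  have h := sum_defectDiagonal_smul (θ := θ)
    (fun n' => (transitionIn (ParamField r) r n').transpose)
    (fun _ lam => ⟨sFn lam.1, sFn_mem lam⟩) Λ _ (mFn_eq_sum_sFn Λ.2)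
  rw [← defectDiagonal_transpose] at h
  exact h

theorem qSym_eq_sum (ε : Sign) (Λ : ZSym n D) :
    qSym θ ε Λ = ∑ N, defectDiagonal (qMatrix ε tvar) Λ N • mSym θ N :=
  sum_defectDiagonal_smul (qMatrix ε tvar) (fun _ lam => ⟨mFn lam.1, mFn_mem lam⟩) Λ _
    (qFn_eq_sum_mFn ε Λ.2)

theorem defectDiagonal_qMatrix_minus :
    (defectDiagonal (qMatrix .minus tvar) : Matrix (ZSym n D) (ZSym n D) (ParamField r)) =
      (defectDiagonal (qMatrix .plus tvar)).transpose := by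
  have h : (qMatrix .minus (tvar (r := r))) = fun n' => (qMatrix .plus tvar n').transpose :=
    funext fun n' => qMatrix_minus _ _
  rw [h, defectDiagonal_transpose]

/-- The Gram matrix of the basis `s_Λ`. -/
noncomputable def schurGram (n : ℕ) (D : Finset (Defect r α)) [DecidableEq (ZSym n D)] :
    Matrix (ZSym n D) (ZSym n D) (valueRing r) :=
  (defectDiagonal fun n' => schurKernel r n')⁻¹

theorem map_value_defectDiagonal [DecidableEq (ZSym n D)] :
    (defectDiagonal (fun n' => schurKernel r n') : Matrix (ZSym n D) (ZSym n D) _).map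
      (valueRing.value r) = 1 := by
  classical
  rw [defectDiagonal_map]
  simp only [map_value_schurKernel]
  exact defectDiagonal_one

theorem map_toField_defectDiagonal :
    (defectDiagonal (fun n' => schurKernel r n') : Matrix (ZSym n D) (ZSym n D) _).map
      (valueRing.toField r) =
    defectDiagonal (fun n' => transitionIn (ParamField r) r n') *
      defectDiagonal (qMatrix .plus tvar) *
      (defectDiagonal fun n' => transitionIn (ParamField r) r n').transpose := by
  rw [defectDiagonal_transpose, defectDiagonal_mul, defectDiagonal_mul, defectDiagonal_map]
  simp only [map_toField_schurKernel]

theorem mul_schurGram [DecidableEq (ZSym n D)] :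
    defectDiagonal (fun n' => transitionIn (ParamField r) r n') *
      defectDiagonal (qMatrix .plus tvar) *
      (defectDiagonal fun n' => transitionIn (ParamField r) r n').transpose *
      (schurGram n D).map (valueRing.toField r) = 1 := by
  rw [← map_toField_defectDiagonal, ← Matrix.map_mul, schurGram,
    Matrix.mul_nonsing_inv _ (valueRing.isUnit_det_of_map_value_eq_one map_value_defectDiagonal),
    Matrix.map_one _ (map_zero _) (map_one _)]

theorem isForm_iff [DecidableEq (ZSym n D)]
    {B : Xi θ →ₗ[ParamField r] Xi θ →ₗ[ParamField r] ParamField r} :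
    IsForm θ B ↔ ∀ Λ Λ', B (sSym θ Λ) (sSym θ Λ') = valueRing.toField r (schurGram n D Λ Λ') := by
  have h := dual_iff_gram_eq (B := B) (s := sSym θ) (m := mSym θ) (q := qSym θ .plus)
    mSym_eq_sum (qSym_eq_sum .plus) mul_schurGram
  refine Iff.trans ⟨fun hB Λ Λ' => ?_, fun hB Λ Λ' => ?_⟩ h
  · split_ifs with hΛ
    · exact (hB Λ Λ').1 hΛ
    · exact (hB Λ Λ').2 hΛ
  · exact ⟨fun hΛ => (hB Λ Λ').trans (if_pos hΛ), fun hΛ => (hB Λ Λ').trans (if_neg hΛ)⟩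

theorem existsUnique_isForm (hθ : ∀ d, Function.Injective (θ d)) : ∃! B, IsForm θ B := by
  classical
  refine ⟨(sBasis hθ).constr (ParamField r) fun Λ => (sBasis hθ).constr (ParamField r) fun Λ' =>
    valueRing.toField r (schurGram n D Λ Λ'), ?_, fun B hB => ?_⟩
  · beta_reduce
    rw [isForm_iff]
    intro Λ Λ'
    rw [← sBasis_apply hθ, ← sBasis_apply hθ, Module.Basis.constr_basis, Module.Basis.constr_basis]
  · replace hB := isForm_iff.1 hB
    refine (sBasis hθ).ext fun Λ => (sBasis hθ).ext fun Λ' => ?_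
    rw [Module.Basis.constr_basis, Module.Basis.constr_basis, sBasis_apply, sBasis_apply, hB]

theorem form_sSym [DecidableEq (ZSym n D)] (hθ : ∀ d, Function.Injective (θ d))
    (Λ Λ' : ZSym n D) :
    form θ (sSym θ Λ) (sSym θ Λ') = valueRing.toField r (schurGram n D Λ Λ') :=
  isForm_iff.1 (Classical.epsilon_spec (existsUnique_isForm hθ).exists) Λ Λ'

theorem form_qSym_mSym [DecidableEq (ZSym n D)] (hθ : ∀ d, Function.Injective (θ d))
    (Λ Λ' : ZSym n D) : form θ (qSym θ .plus Λ) (mSym θ Λ') = if Λ = Λ' then 1 else 0 := by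
  have h : IsForm θ (form θ) := Classical.epsilon_spec (existsUnique_isForm hθ).exists
  split_ifs with hΛ
  · exact (h Λ Λ').1 hΛ
  · exact (h Λ Λ').2 hΛ

theorem qSym_minus_eq_sum (Λ : ZSym n D) :
    qSym θ .minus Λ = ∑ N, defectDiagonal (qMatrix .plus tvar) N Λ • mSym θ N := by
  rw [qSym_eq_sum, defectDiagonal_qMatrix_minus]
  simp only [Matrix.transpose_apply]

theorem apply_mSym_qSym_of_apply_qSym_mSym [DecidableEq (ZSym n D)]
    {B : Xi θ →ₗ[ParamField r] Xi θ →ₗ[ParamField r] ParamField r}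
    (hB : ∀ Λ Λ', B (qSym θ .plus Λ) (mSym θ Λ') = if Λ = Λ' then 1 else 0) (Λ Λ' : ZSym n D) :
    B (mSym θ Λ) (qSym θ .minus Λ') = if Λ = Λ' then 1 else 0 := by
  have h := dual_of_dual (B := B) (s := sSym θ) (m := mSym θ) (q := qSym θ .plus)
    (q' := qSym θ .minus) mSym_eq_sum (qSym_eq_sum .plus) qSym_minus_eq_sum
  exact h hB Λ Λ'

theorem form_mSym_qSym [DecidableEq (ZSym n D)] (hθ : ∀ d, Function.Injective (θ d))
    (Λ Λ' : ZSym n D) : form θ (mSym θ Λ) (qSym θ .minus Λ') = if Λ = Λ' then 1 else 0 :=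
  apply_mSym_qSym_of_apply_qSym_mSym (form_qSym_mSym hθ) Λ Λ'

end Xi

/-! ### Existence and characterization of dual families -/

section DualFamilies

variable {Z : Type*} [LinearOrder Z] {sim : Z → Z → Prop}

section Existence

variable {K V : Type*} [Field K] [AddCommGroup V] [Module K V]

theorem sum_smul_mem_span_low [Fintype Z] {s : Z → V} {u : Z → K} {a : Z}
    (hu : ∀ b, b ∉ low sim a → u b = 0) :
    ∑ b, u b • s b ∈ Submodule.span K (s '' low sim a) := by
  refine Submodule.sum_mem _ fun b _ => ?_
  by_cases hb : b ∈ low sim a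
  · exact Submodule.smul_mem _ _ (Submodule.subset_span ⟨b, hb, rfl⟩)
  · rw [hu b hb, zero_smul]
    exact Submodule.zero_mem _

/-- Of two inequivalent indices one is in the `low` set of the other, so orthogonality to lower
basis vectors on each side is enough. -/
theorem isDualPair_of_orthogonal (h : IntervalEquiv sim) {s : Module.Basis Z K V}
    {B : V →ₗ[K] V →ₗ[K] K} {P P' : Z → V} (hP : Unitriangular sim s P)
    (hP' : Unitriangular sim s P') (hB : ∀ a, ∀ c ∈ low sim a, B (P a) (s c) = 0)
    (hB' : ∀ a, ∀ c ∈ low sim a, B (s c) (P' a) = 0) : IsDualPair sim s B P P' := by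
  have key : ∀ f : Z → V, Unitriangular sim s f → ∀ a b, b ∈ low sim a →
      f b ∈ Submodule.span K (s '' low sim a) := by
    intro f hf a b hb
    have h1 := Submodule.span_mono
      (Set.image_mono fun c hc => h.mem_low_of_le hb (le_of_lt hc.1)) (hf b)
    have h2 : s b ∈ Submodule.span K (s '' low sim a) := Submodule.subset_span ⟨b, hb, rfl⟩
    simpa using Submodule.add_mem _ h1 h2
  refine ⟨hP, hP', fun a b hab => ?_⟩
  rcases h.mem_low_or_mem_low hab with hb | ha
  · have : Submodule.span K (s '' low sim a) ≤ LinearMap.ker (B (P a)) := by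
      rw [Submodule.span_le]
      rintro _ ⟨c, hc, rfl⟩
      exact hB a c hc
    exact this (key P' hP' a b hb)
  · have : Submodule.span K (s '' low sim b) ≤ LinearMap.ker (B.flip (P' b)) := by
      rw [Submodule.span_le]
      rintro _ ⟨c, hc, rfl⟩
      exact hB' b c hc
    exact this (key P hP b a ha)

end Existence

theorem exists_isDualPair {r : ℕ} {V : Type*} [AddCommGroup V] [Module (ParamField r) V]
    [Fintype Z] (h : IntervalEquiv sim) (s : Module.Basis Z (ParamField r) V)
    {B : V →ₗ[ParamField r] V →ₗ[ParamField r] ParamField r} {G : Matrix Z Z (valueRing r)}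
    (hG : G.map (valueRing.value r) = 1)
    (hB : ∀ a b, B (s a) (s b) = valueRing.toField r (G a b)) :
    ∃ u u' : Z → Z → valueRing r,
      ((∀ a b, valueRing.value r (u a b) = 0) ∧ ∀ a b, b ∉ low sim a → u a b = 0) ∧
      ((∀ a b, valueRing.value r (u' a b) = 0) ∧ ∀ a b, b ∉ low sim a → u' a b = 0) ∧
      IsDualPair sim s B (fun a => s a + ∑ b, valueRing.toField r (u a b) • s b)
        fun a => s a + ∑ b, valueRing.toField r (u' a b) • s b := by
  have hlow : ∀ a, a ∉ low sim a := fun a ha => lt_irrefl a ha.1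
  have hG' : G.transpose.map (valueRing.value r) = 1 := by
    rw [Matrix.transpose_map, hG, Matrix.transpose_one]
  choose u hu using fun a => exists_orthogonal (B := B) hG hB (hlow a)
  -- The second family solves the same problem for the flipped form, whose Gram matrix is the
  -- transpose.
  choose u' hu' using fun a => exists_orthogonal (B := B.flip) hG' (fun a b => hB b a) (hlow a)
  refine ⟨u, u', ⟨fun a => (hu a).1, fun a => (hu a).2.1⟩,
    ⟨fun a => (hu' a).1, fun a => (hu' a).2.1⟩, isDualPair_of_orthogonal h ?_ ?_
    (fun a => (hu a).2.2) fun a => (hu' a).2.2⟩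
  · intro a
    rw [add_sub_cancel_left]
    exact sum_smul_mem_span_low fun b hb => by rw [(hu a).2.1 b hb, map_zero]
  · intro a
    rw [add_sub_cancel_left]
    exact sum_smul_mem_span_low fun b hb => by rw [(hu' a).2.1 b hb, map_zero]

namespace IsDualPair

variable {K V : Type*} [Field K] [AddCommGroup V] [Module K V] {s : Module.Basis Z K V}
  {B : V →ₗ[K] V →ₗ[K] K} {P P' : Z → V}

open Classical in
theorem left_expansion_iff [Fintype Z] (h : IntervalEquiv sim) (hP : IsDualPair sim s B P P')
    (hB : ∀ x, (∀ y, B x y = 0) → x = 0) {m q : Z → V} (hm : Unitriangular sim s m)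
    (hq : ∀ a b, B (q a) (m b) = if a = b then 1 else 0) (a : Z) [Fintype {b // sim b a}]
    (R : {b // sim b a} → V) :
    (∃ c u : Matrix {b // sim b a} Z K,
      (∀ b, R b = ∑ d with (sim d b.1 ∨ b.1 ≤ d), c b d • q d) ∧
      (c.submatrix id Subtype.val).det ≠ 0 ∧
      (∀ b, R b = ∑ d with (sim d b.1 ∨ d ≤ b.1), u b d • s d) ∧
      u.submatrix id Subtype.val = (1 : Matrix {b // sim b a} {b // sim b a} K)) ↔
    ∀ b, R b = P b.1 := by
  have hsum : ∀ b, ∑ d, (1 : Matrix {b // sim b a} {b // sim b a} K) b d • P d.1 = P b.1 := by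
    intro b
    simp [Matrix.one_apply]
  constructor
  · rintro ⟨c, u, hc, -, hu, hu1⟩ b
    have := ((hP.expansion_iff h hB hm hq a R _ _).1 ⟨c, u, hc, hu, rfl, hu1⟩).2 b
    rw [this, hsum]
  · intro hR
    obtain ⟨c, u, hc, hu, hc1, hu1⟩ := (hP.expansion_iff h hB hm hq a R _ _).2
      ⟨rfl, fun b => (hR b).trans (hsum b).symm⟩
    refine ⟨c, u, hc, ?_, hu, hu1⟩
    rw [hc1, one_mul]
    exact hP.det_gramMatrix_ne_zero h hB a

open Classical in
theorem dual_expansion_iff [Fintype Z] (h : IntervalEquiv sim) (hP : IsDualPair sim s B P P')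
    (hB : ∀ x, (∀ y, B x y = 0) → x = 0) {m q : Z → V} (hm : Unitriangular sim s m)
    (hq : ∀ a b, B (q a) (m b) = if a = b then 1 else 0) (a : Z) [Fintype {b // sim b a}]
    (R : {b // sim b a} → V) :
    (∃ c u : Matrix {b // sim b a} Z K,
      (∀ b, R b = ∑ d with (sim d b.1 ∨ b.1 ≤ d), c b d • q d) ∧
      c.submatrix id Subtype.val = (1 : Matrix {b // sim b a} {b // sim b a} K) ∧
      (∀ b, R b = ∑ d with (sim d b.1 ∨ d ≤ b.1), u b d • s d) ∧
      (u.submatrix id Subtype.val).det ≠ 0) ↔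
    ∀ b, R b = ∑ d, (gramMatrix sim B P P' a)⁻¹ b d • P d.1 := by
  have hdet : IsUnit (gramMatrix sim B P P' a).det := (hP.det_gramMatrix_ne_zero h hB a).isUnit
  constructor
  · rintro ⟨c, u, hc, hc1, hu, -⟩ b
    obtain ⟨h1, h2⟩ := (hP.expansion_iff h hB hm hq a R _ _).1 ⟨c, u, hc, hu, hc1, rfl⟩
    rw [Matrix.inv_eq_left_inv h1.symm]
    exact h2 b
  · intro hR
    obtain ⟨c, u, hc, hu, hc1, hu1⟩ := (hP.expansion_iff h hB hm hq a R _ _).2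
      ⟨rfl, hR⟩
    refine ⟨c, u, hc, ?_, hu, ?_⟩
    · rw [hc1, Matrix.nonsing_inv_mul _ hdet]
    · rw [hu1]
      exact ((Matrix.isUnit_nonsing_inv_det_iff).2 hdet).ne_zero

/-- `hallQ` inverts the Gram matrix indexed by the class of its own argument; for equivalent indices
these classes are equal sets but different types. -/
theorem sum_inv_gramMatrix_eq (h : IntervalEquiv sim) (W : Z → V) {a b : Z} (hba : sim b a)
    [Fintype {d // sim d a}] [Fintype {d // sim d b}] :
    ∑ d, (gramMatrix sim B P P' b)⁻¹ ⟨b, h.equiv.refl b⟩ d • W d.1 =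
      ∑ d, (gramMatrix sim B P P' a)⁻¹ ⟨b, hba⟩ d • W d.1 := by
  let f : {d // sim d b} ≃ {d // sim d a} := Equiv.subtypeEquivRight fun d =>
    ⟨fun hd => h.equiv.trans hd hba, fun hd => h.equiv.trans hd (h.equiv.symm hba)⟩
  have h1 : gramMatrix sim B P P' b = (gramMatrix sim B P P' a).submatrix f f := rfl
  rw [h1, Matrix.inv_submatrix_equiv]
  exact Fintype.sum_equiv f _ _ fun d => rfl

end IsDualPair

end DualFamilies

/-! ### Hall-Littlewood functions -/

section HallLittlewood

theorem sub_mem_of_eq_add {K V : Type*} [Field K] [AddCommGroup V] [Module K V]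
    {W : Submodule K V} {x y z : V} (h : x = y + z) (hz : z ∈ W) : x - y ∈ W := by
  rwa [h, add_sub_cancel_left]

theorem sum_range_rowLen {μ : YoungDiagram} {p : ℕ} (h : μ.colLen 0 ≤ p) :
    ∑ i ∈ Finset.range p, μ.rowLen i = μ.card := by
  rw [← sum_rowLen]
  refine (Finset.sum_subset (Finset.range_subset_range.2 h) fun i _ hi => ?_).symm
  exact rowLen_eq_zero (not_lt.1 fun h => hi (Finset.mem_range.2 h))

/-- Dominance gives an inequality of sizes in each component, and the total size is `n` on both
sides. -/
theorem card_eq_of_transition_ne_zero {r n : ℕ} {lam mu : RPartition r n}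
    (h : transition r n lam mu ≠ 0) (k : Fin r) : (lam.1 k).card = (mu.1 k).card := by
  have hle : ∀ k ∈ Finset.univ, (lam.1 k).card ≤ (mu.1 k).card := by
    intro k _
    have := partial_sums_le_of_transition_ne_zero h k n
    rwa [sum_range_rowLen (colLen_le lam k), sum_range_rowLen (colLen_le mu k)] at this
  exact (Finset.sum_eq_sum_iff_of_le hle).1 (lam.2.trans mu.2.symm) k (Finset.mem_univ k)

theorem minSum_lt_of_transition_ne_zero {r n e : ℕ} {s m : Fin r → ℕ} {lam mu : RPartition r n}
    (hm : ∀ k, n ≤ m k) (h : transition r n lam mu ≠ 0) (hne : lam ≠ mu) :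
    (SymbolArray.ofPartition e s m mu.1).minSum < (SymbolArray.ofPartition e s m lam.1).minSum := by
  refine minSum_ofPartition_lt (partial_sums_le_of_transition_ne_zero h) (fun k => ?_) ?_
  · rw [sum_range_rowLen ((colLen_le lam k).trans (hm k)),
      sum_range_rowLen ((colLen_le mu k).trans (hm k)), card_eq_of_transition_ne_zero h]
  · by_contra hall
    push Not at hall
    refine hne (Subtype.ext (funext fun k => youngDiagram_ext_rowLen fun i => ?_))
    by_cases hi : i < m k
    · exact hall k i hi
    · rw [rowLen_eq_zero (((colLen_le lam k).trans (hm k)).trans (not_lt.1 hi)),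
        rowLen_eq_zero (((colLen_le mu k).trans (hm k)).trans (not_lt.1 hi))]

variable {r α : ℕ} [NeZero r] {n : ℕ} {D : Finset (Defect r α)} {e : ℕ} {s : Fin r → ℕ}

theorem ZSym.minSum_eq_of_similar {d : D} {lam mu : RPartition r (n - d.1.f)}
    (h : ZSym.Similar e s (ZSym.mk d lam) (ZSym.mk d mu)) :
    (SymbolArray.ofPartition e s (fun k => d.1.1 k + (n - d.1.f)) lam.1).minSum =
      (SymbolArray.ofPartition e s (fun k => d.1.1 k + (n - d.1.f)) mu.1).minSum :=
  SymbolArray.minSum_eq_of_entries_eq (similar_mk_iff_entries_eq.1 h)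

theorem ZSym.aFun_lt_of_minSum_lt {d : D} {lam mu : RPartition r (n - d.1.f)}
    (h : (SymbolArray.ofPartition e s (fun k => d.1.1 k + (n - d.1.f)) lam.1).minSum <
      (SymbolArray.ofPartition e s (fun k => d.1.1 k + (n - d.1.f)) mu.1).minSum) :
    (ZSym.mk d lam).aFun e s < (ZSym.mk d mu).aFun e s :=
  sub_lt_sub_right (Int.ofNat_lt.2 h) _

variable {θ : ∀ d : D, RPartition r (n - d.1.f) → RPartition r n}

theorem coeff_sSym (hθ : ∀ d, Function.Injective (θ d)) (Λ : ZSym n D) (d : D)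
    (ν : Fin r × ℕ →₀ ℕ) :
    ∃ x, valueRing.toField r x = MvPowerSeries.coeff ν (sSym θ Λ d : PS r) := by
  by_cases h : Λ.1 = d
  · subst h
    obtain ⟨x, hx⟩ := exists_toField_eq_coeff_sFn (θ Λ.1 Λ.2) ν
    refine ⟨x, ?_⟩
    rw [sSym, DirectSum.lof_eq_of, DirectSum.of_eq_same, bigTheta_sFn (hθ _), coe_defectBasis, hx]
  · refine ⟨0, ?_⟩
    rw [sSym, DirectSum.lof_eq_of, DirectSum.of_eq_of_ne _ _ _ (Ne.symm h), map_zero]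
    simp

theorem eqAtZero_sSym_add (hθ : ∀ d, Function.Injective (θ d)) {u : ZSym n D → valueRing r}
    (hu : ∀ N, valueRing.value r (u N) = 0) (Λ : ZSym n D) :
    EqAtZero θ (sSym θ Λ + ∑ N, valueRing.toField r (u N) • sSym θ N) (sSym θ Λ) := by
  intro d ν
  choose x hx using fun N => coeff_sSym hθ N d ν
  have h : MvPowerSeries.coeff ν
      ((sSym θ Λ + ∑ N, valueRing.toField r (u N) • sSym θ N : Xi θ) d : PS r) -
      MvPowerSeries.coeff ν (sSym θ Λ d : PS r) = valueRing.toField r (∑ N, u N * x N) := by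
    rw [DirectSum.add_apply, DirectSum.sum_apply, Submodule.coe_add, map_add, add_sub_cancel_left,
      Submodule.coe_sum, map_sum, map_sum]
    refine Finset.sum_congr rfl fun N _ => ?_
    rw [DirectSum.smul_apply, Submodule.coe_smul, map_smul, smul_eq_mul, map_mul, hx]
  have h2 : valueRing.value r (∑ N, u N * x N) = 0 := by
    rw [map_sum]
    exact Finset.sum_eq_zero fun N _ => by rw [map_mul, hu, zero_mul]
  rw [h, ← h2]
  exact valueRing.hasValueAtZero _

variable [LinearOrder (ZSym n D)]

theorem ZSym.intervalEquiv_similar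
    (hint : ∀ Λ M Λ' : ZSym n D, Λ ≤ M → M ≤ Λ' → ZSym.Similar e s Λ Λ' → ZSym.Similar e s M Λ) :
    IntervalEquiv (ZSym.Similar (n := n) (D := D) e s) :=
  ⟨⟨ZSym.Similar.refl e s, Symbol.Similar.symm, Symbol.Similar.trans⟩, hint⟩

theorem unitriangular_mSym (hθ : ∀ d, Function.Injective (θ d))
    (ha : ∀ Λ Λ' : ZSym n D, Λ'.aFun e s < Λ.aFun e s → Λ < Λ') :
    Unitriangular (ZSym.Similar e s) (sBasis hθ) (mSym θ) := by
  intro Λ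
  obtain ⟨d, mu, rfl⟩ := Λ.exists_eq_mk
  have hsum : mSym θ (ZSym.mk d mu) = sBasis hθ (ZSym.mk d mu) +
      ∑ N ∈ Finset.univ.erase (ZSym.mk d mu),
        defectDiagonal (fun n' => transitionIn (ParamField r) r n') N (ZSym.mk d mu) •
          sSym θ N := by
    rw [mSym_eq_sum, ← Finset.add_sum_erase _ _ (Finset.mem_univ (ZSym.mk d mu)),
      defectDiagonal_apply_eq, transitionIn, Matrix.map_apply, transition_self, map_one, one_smul,
      sBasis_apply]
  refine sub_mem_of_eq_add (V := Xi θ) hsum (Submodule.sum_mem _ fun N hN => ?_)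
  obtain ⟨d', lam, rfl⟩ := N.exists_eq_mk
  by_cases h0 : defectDiagonal (fun n' => transitionIn (ParamField r) r n')
      (ZSym.mk d' lam) (ZSym.mk d mu) = 0
  · rw [h0, zero_smul]
    exact Submodule.zero_mem _
  have hd : d' = d := by
    by_contra hd
    exact h0 (defectDiagonal_apply_ne _ hd _ _)
  subst hd
  rw [defectDiagonal_apply_eq, transitionIn, Matrix.map_apply] at h0
  have hne : lam ≠ mu := by
    rintro rfl
    simp at hN
  -- At this level every row has at least `n'` entries, so the arrays record all parts of the
  -- `r`-partitions.
  have hlt := minSum_lt_of_transition_ne_zero (e := e) (s := s)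
    (m := fun k => d'.1.1 k + (n - d'.1.f)) (fun k => Nat.le_add_left _ _)
    (fun h => h0 (by rw [h, map_zero])) hne
  refine Submodule.smul_mem _ _ (Submodule.subset_span ⟨ZSym.mk d' lam, ⟨?_, fun hsim => ?_⟩,
    sBasis_apply hθ _⟩)
  · exact ha _ _ (ZSym.aFun_lt_of_minSum_lt hlt)
  · exact hlt.ne (ZSym.minSum_eq_of_similar hsim).symm

theorem IsHallLittlewood.isDualPair (hθ : ∀ d, Function.Injective (θ d))
    {P : Sign → ZSym n D → Xi θ} (hP : IsHallLittlewood θ e s P) :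
    IsDualPair (ZSym.Similar e s) (sBasis hθ) (form θ) (P .plus) (P .minus) := by
  have key : ∀ ε, Unitriangular (ZSym.Similar e s) (sBasis hθ) (P ε) := by
    intro ε Λ
    obtain ⟨u, -, hu, hPu⟩ := hP.1 ε Λ
    rw [← sBasis_apply hθ] at hPu
    refine sub_mem_of_eq_add (V := Xi θ) hPu (Submodule.sum_mem _ fun N hN => ?_)
    by_cases hsim : ZSym.Similar e s N Λ
    · rw [hu N hsim, zero_smul]
      exact Submodule.zero_mem _
    · exact Submodule.smul_mem _ _ (Submodule.subset_span
        ⟨N, ⟨(Finset.mem_filter.1 hN).2, hsim⟩, sBasis_apply hθ N⟩)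
  exact ⟨key .plus, key .minus, hP.2.1⟩

theorem exists_isHallLittlewood (hθ : ∀ d, Function.Injective (θ d))
    (h : IntervalEquiv (ZSym.Similar (n := n) (D := D) e s)) :
    ∃ P, IsHallLittlewood θ e s P := by
  have hB : ∀ Λ Λ', form θ (sBasis hθ Λ) (sBasis hθ Λ') =
      valueRing.toField r (schurGram n D Λ Λ') := by
    intro Λ Λ'
    rw [sBasis_apply, sBasis_apply, form_sSym hθ]
  have hG : (schurGram n D).map (valueRing.value r) = 1 :=
    valueRing.map_value_inv map_value_defectDiagonal
  obtain ⟨u, u', hu, hu', hP⟩ :=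
    exists_isDualPair (V := Xi θ) (B := form θ) h (sBasis (θ := θ) hθ) hG hB
  simp only [sBasis_apply] at hP
  have key : ∀ v : ZSym n D → ZSym n D → valueRing r,
      ((∀ Λ N, valueRing.value r (v Λ N) = 0) ∧
        ∀ Λ N, N ∉ low (ZSym.Similar e s) Λ → v Λ N = 0) → ∀ Λ,
      (∃ w : ZSym n D → ParamField r, (∀ N, ∃ c, HasValueAtZero (w N) c) ∧
        (∀ N, ZSym.Similar e s N Λ → w N = 0) ∧
        sSym θ Λ + ∑ N, valueRing.toField r (v Λ N) • sSym θ N =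
          sSym θ Λ + ∑ N with N < Λ, w N • sSym θ N) ∧
      EqAtZero θ (sSym θ Λ + ∑ N, valueRing.toField r (v Λ N) • sSym θ N) (sSym θ Λ) := by
    intro v hv Λ
    refine ⟨⟨fun N => valueRing.toField r (v Λ N), fun N => ⟨_, valueRing.hasValueAtZero _⟩,
      fun N hN => ?_, ?_⟩, eqAtZero_sSym_add hθ (hv.1 Λ) Λ⟩
    · beta_reduce
      rw [hv.2 Λ N fun hN' => hN'.2 hN, map_zero]
    · congr 1
      refine (Finset.sum_subset (Finset.filter_subset _ _) fun N _ hN => ?_).symm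
      have hN' : N ∉ low (ZSym.Similar e s) Λ := fun hN' =>
        hN (Finset.mem_filter.2 ⟨Finset.mem_univ _, hN'.1⟩)
      rw [hv.2 Λ N hN', map_zero, zero_smul]
  refine ⟨fun ε => match ε with
    | .plus => fun Λ => sSym θ Λ + ∑ N, valueRing.toField r (u Λ N) • sSym θ N
    | .minus => fun Λ => sSym θ Λ + ∑ N, valueRing.toField r (u' Λ N) • sSym θ N,
    fun ε Λ => ?_, hP.orth, fun ε Λ => ?_⟩
  · cases ε
    · exact (key u hu Λ).1
    · exact (key u' hu' Λ).1
  · cases ε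
    · exact (key u hu Λ).2
    · exact (key u' hu' Λ).2

theorem form_nondegenerate_left (hθ : ∀ d, Function.Injective (θ d)) (x : Xi θ)
    (hx : ∀ y, form θ x y = 0) : x = 0 :=
  eq_zero_of_dual (V := Xi θ) (B := form θ) (q := qSym θ .plus) (m := mSym θ) (sBasis (θ := θ) hθ)
    (form_qSym_mSym (θ := θ) hθ) x hx

theorem flip_form_qSym_mSym (hθ : ∀ d, Function.Injective (θ d)) (Λ Λ' : ZSym n D) :
    (form θ).flip (qSym θ .minus Λ) (mSym θ Λ') = if Λ = Λ' then 1 else 0 := by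
  rw [LinearMap.flip_apply, form_mSym_qSym hθ]
  simp only [eq_comm]

theorem form_nondegenerate_right (hθ : ∀ d, Function.Injective (θ d)) (x : Xi θ)
    (hx : ∀ y, (form θ).flip x y = 0) : x = 0 :=
  eq_zero_of_dual (V := Xi θ) (B := (form θ).flip) (q := qSym θ .minus) (m := mSym θ)
    (sBasis (θ := θ) hθ)
    (flip_form_qSym_mSym (θ := θ) hθ) x hx

theorem existsUnique_isHallLittlewood (hθ : ∀ d, Function.Injective (θ d))
    (h : IntervalEquiv (ZSym.Similar (n := n) (D := D) e s)) :
    ∃! P, IsHallLittlewood θ e s P := by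
  obtain ⟨P, hP⟩ := exists_isHallLittlewood hθ h
  refine ⟨P, hP, fun R hR => funext fun ε => ?_⟩
  have hP' := hP.isDualPair hθ
  have hR' := IsHallLittlewood.isDualPair hθ hR
  cases ε
  · exact hP'.left_unique h (form_nondegenerate_left hθ) hR'
  · exact (hP'.flip h).left_unique h (form_nondegenerate_right hθ) (hR'.flip h)

theorem isDualPair_hallP (hθ : ∀ d, Function.Injective (θ d))
    (h : IntervalEquiv (ZSym.Similar (n := n) (D := D) e s)) :
    IsDualPair (ZSym.Similar e s) (sBasis hθ) (form θ) (hallP θ e s .plus) (hallP θ e s .minus) :=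
  IsHallLittlewood.isDualPair hθ (Classical.epsilon_spec (exists_isHallLittlewood hθ h))

theorem det_gram_ne_zero (hθ : ∀ d, Function.Injective (θ d))
    (h : IntervalEquiv (ZSym.Similar (n := n) (D := D) e s)) (Λ : ZSym n D) :
    (gram θ e s Λ).det ≠ 0 :=
  (isDualPair_hallP hθ h).det_gramMatrix_ne_zero h (form_nondegenerate_left hθ) Λ

theorem isUpper_isLower_iff_eq_hallP (hθ : ∀ d, Function.Injective (θ d))
    (h : IntervalEquiv (ZSym.Similar (n := n) (D := D) e s))
    (ha : ∀ Λ Λ' : ZSym n D, Λ'.aFun e s < Λ.aFun e s → Λ < Λ') (ε : Sign) (Λ : ZSym n D)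
    (R : SimClass e s Λ → Xi θ) :
    (∃ c u, IsUpper θ e s ε Λ R c ∧ (block c).det ≠ 0 ∧ IsLower θ e s Λ R u ∧ block u = 1) ↔
      ∀ M, R M = hallP θ e s ε M.1 := by
  have hP := isDualPair_hallP (e := e) (s := s) hθ h
  have hm := unitriangular_mSym (e := e) (s := s) hθ ha
  cases ε
  · have key := hP.left_expansion_iff h (form_nondegenerate_left hθ) hm
      (form_qSym_mSym hθ) Λ R
    simp only [sBasis_apply] at key
    exact key
  -- For the flipped form `P^-` is the left family, and the family dual to `m` is `q^-`.
  · have key := (hP.flip h).left_expansion_iff h (form_nondegenerate_right hθ) hm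
      (flip_form_qSym_mSym hθ) Λ R
    simp only [sBasis_apply] at key
    exact key

theorem hallQ_plus_eq (h : IntervalEquiv (ZSym.Similar (n := n) (D := D) e s)) {Λ : ZSym n D}
    (M : SimClass e s Λ) : hallQ θ e s .plus M.1 =
      ∑ N, (IsDualPair.gramMatrix (ZSym.Similar e s) (form θ) (hallP θ e s .plus)
        (hallP θ e s .minus) Λ)⁻¹ M N • hallP θ e s .plus N.1 :=
  IsDualPair.sum_inv_gramMatrix_eq h (hallP θ e s .plus) M.2

theorem hallQ_minus_eq (h : IntervalEquiv (ZSym.Similar (n := n) (D := D) e s)) {Λ : ZSym n D}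
    (M : SimClass e s Λ) : hallQ θ e s .minus M.1 =
      ∑ N, (IsDualPair.gramMatrix (ZSym.Similar e s) (form θ).flip (hallP θ e s .minus)
        (hallP θ e s .plus) Λ)⁻¹ M N • hallP θ e s .minus N.1 := by
  rw [← IsDualPair.sum_inv_gramMatrix_eq h (hallP θ e s .minus) M.2]
  refine Finset.sum_congr rfl fun N _ => ?_
  have h1 : IsDualPair.gramMatrix (ZSym.Similar e s) (form θ).flip (hallP θ e s .minus)
      (hallP θ e s .plus) M.1 = (gram θ e s M.1).transpose := rfl
  rw [h1, ← Matrix.transpose_nonsing_inv, Matrix.transpose_apply]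

theorem isUpper_isLower_iff_eq_hallQ (hθ : ∀ d, Function.Injective (θ d))
    (h : IntervalEquiv (ZSym.Similar (n := n) (D := D) e s))
    (ha : ∀ Λ Λ' : ZSym n D, Λ'.aFun e s < Λ.aFun e s → Λ < Λ') (ε : Sign) (Λ : ZSym n D)
    (R : SimClass e s Λ → Xi θ) :
    (∃ c u, IsUpper θ e s ε Λ R c ∧ block c = 1 ∧ IsLower θ e s Λ R u ∧ (block u).det ≠ 0) ↔
      ∀ M, R M = hallQ θ e s ε M.1 := by
  have hP := isDualPair_hallP (e := e) (s := s) hθ h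
  have hm := unitriangular_mSym (e := e) (s := s) hθ ha
  cases ε
  · have key := hP.dual_expansion_iff h (form_nondegenerate_left hθ) hm
      (form_qSym_mSym hθ) Λ R
    simp only [sBasis_apply] at key
    simp only [hallQ_plus_eq h]
    exact key
  · have key := (hP.flip h).dual_expansion_iff h (form_nondegenerate_right hθ) hm
      (flip_form_qSym_mSym hθ) Λ R
    simp only [sBasis_apply] at key
    simp only [hallQ_minus_eq h]
    exact key

end HallLittlewood

end RSymbol

theorem theorem3p9 {r α : ℕ} [NeZero r] (hα : α < r)
    (e : ℕ) (s : Fin r → ℕ) (hs : ∀ k, s k ≤ e)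
    (n : ℕ) (D : Finset (RSymbol.Defect r α)) (hD : ∀ d ∈ D, d.f ≤ n)
    (θ : ∀ d : D, RSymbol.RPartition r (n - d.1.f) → RSymbol.RPartition r n)
    (hθ : ∀ d, Function.Injective (θ d))
    [LinearOrder (RSymbol.ZSym n D)]
    (ha : ∀ Λ Λ' : RSymbol.ZSym n D, Λ'.aFun e s < Λ.aFun e s → Λ < Λ')
    (hint : ∀ Λ M Λ' : RSymbol.ZSym n D, Λ ≤ M → M ≤ Λ' →
      RSymbol.ZSym.Similar e s Λ Λ' → RSymbol.ZSym.Similar e s M Λ) :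
    -- the objects are well defined
    (∀ d : D, ∃! Θ, RSymbol.IsTheta (θ d) Θ) ∧
    (∃! B, RSymbol.IsForm θ B) ∧
    (∃! P, RSymbol.IsHallLittlewood θ e s P) ∧
    (∀ Λ : RSymbol.ZSym n D, (RSymbol.gram θ e s Λ).det ≠ 0) ∧
    -- characterization of the functions `P`
    (∀ (ε : RSymbol.Sign) (Λ : RSymbol.ZSym n D) (R : RSymbol.SimClass e s Λ → RSymbol.Xi θ),
      (∃ c u, RSymbol.IsUpper θ e s ε Λ R c ∧ (RSymbol.block c).det ≠ 0 ∧
        RSymbol.IsLower θ e s Λ R u ∧ RSymbol.block u = 1) ↔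
      ∀ M, R M = RSymbol.hallP θ e s ε M.1) ∧
    -- characterization of the functions `Q`
    (∀ (ε : RSymbol.Sign) (Λ : RSymbol.ZSym n D) (R : RSymbol.SimClass e s Λ → RSymbol.Xi θ),
      (∃ c u, RSymbol.IsUpper θ e s ε Λ R c ∧ RSymbol.block c = 1 ∧
        RSymbol.IsLower θ e s Λ R u ∧ (RSymbol.block u).det ≠ 0) ↔
      ∀ M, R M = RSymbol.hallQ θ e s ε M.1) := by
  have h := RSymbol.ZSym.intervalEquiv_similar hint
  exact ⟨fun d => RSymbol.existsUnique_isTheta (hθ d), RSymbol.existsUnique_isForm hθ,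
    RSymbol.existsUnique_isHallLittlewood hθ h, RSymbol.det_gram_ne_zero hθ h,
    RSymbol.isUpper_isLower_iff_eq_hallP hθ h ha, RSymbol.isUpper_isLower_iff_eq_hallQ hθ h ha⟩
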